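/- **Setting.** Let $M$ be a compact oriented smooth 4-manifold, $E\to M$ an $SO(3)$-vector bundle (a rank 3 bundle with fibre metric; its orientation plays no role below), and $\Lambda\neq 0$ a real number. In a local orthonormal frame $e_i$ of $E$, with repeated indices summed over $1,2,3$, a metric connection $A$ has curvature 2-forms $F^i$ determined by $(d_A)^2e_i=\epsilon_{ij}{}^{k}F^j\otimes e_k$; likewise $a\in\Omega^1(M,\mathfrak{so}(E))$ has components $a^i$ with $a(e_i)=\epsilon_{ij}{}^{k}a^j\otimes e_k$, and $(d_Aa)^i$ are the components of its covariant exterior derivative $d_Aa\in\Omega^2(M,\mathfrak{so}(E))$. Let $\mathscr D$ be the set of smooth metric connections $A$ in $E$ that are definite, i.e. $F_A(u,v)\neq0$ whenever $u,v$ are linearly independent tangent vectors, and for which the wedge product is positive (for the given orientation of $M$) on the span of the $F^i$, so that $F^i\wedge F^j=Q^{ij}\mu$ with $\mu$ a positive 4-form and $Q$ a positive definite matrix. Let $Y$ be the positive square root of $Q$ if $\Lambda>0$ and the negative one if $\Lambda<0$; fix the scale of $\mu$ by $\operatorname{tr}Y=\Lambda$ and write $\mu_A$ for the resulting 4-form.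 Put $X=Y^{-1}$, $\Sigma_i=X_{ij}F^j$, and let $\Lambda^+_A\subset\Lambda^2$ be the span of the $\Sigma_i$. A metric with volume form $\mu_A$ and bundle of self-dual forms $\Lambda^+_A$ is denoted $g_A$; its anti-self-dual forms are the wedge-orthogonal complement of $\Lambda^+_A$, and $d_A^+a$ denotes the self-dual part of $d_Aa$. The pure connection action is $$S(A)=\frac{\Lambda}{2}\int_M\mu_A=\frac12\int_M X_{ij}F^i\wedge F^j=\frac\Lambda2\operatorname{vol}(M,g_A).$$ For a matrix $B$ let $S^2_0(B)$ be its trace-free symmetric part, and let $S^2_0E$ be the bundle of trace-free symmetric endomorphisms of $E$. **Lemma.** Let $A\in\mathscr D$ be a critical point of $S$ (all derivatives $\frac{d}{dt}S(A+tb)|_{t=0}$, $b\in\Omega^1(M,\mathfrak{so}(E))$, vanish) and let $a\in T_A\mathscr D=\Omega^1(M,\mathfrak{so}(E))$. Write $(d_A^+a)^i=N^{ij}\Sigma_j$. Then there is at every point a unique $\phi\in S^2_0E$ with $S^2_0(X\phi)=S^2_0(XN)$; it depends smoothly on the point; and $t\mapsto S(A+ta)$ is twice differentiable at $t=0$, with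 second derivative $$D^2S(a,a)=\int_M\Big[-\epsilon_{ij}{}^{k}\,a^i\wedge a^j\wedge\Sigma_k+X_{ij}\big((d_Aa)^i-\phi^{ik}\Sigma_k\big)\wedge\big((d_Aa)^j-\phi^{jl}\Sigma_l\big)\Big].$$ The integrand does not depend on the local orthonormal frame. -/

import Mathlib

open Bundle Set Filter FiberBundle
open scoped Manifold ContDiff Topology

noncomputable section

namespace PureConnection

/-! ### Pointwise algebra of forms on a 4-dimensional vector space

A 1-form on `V` is represented by a function `V → ℝ`, a 2-form by a function `V → V → ℝ` and a
4-form by a function `(Fin 4 → V) → ℝ`. -/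

/-- The Levi-Civita symbol `ε_ijk` on three indices. -/
def eps (i j k : Fin 3) : ℝ :=
  (((j : ℕ) : ℝ) - (i : ℕ)) * (((k : ℕ) : ℝ) - (j : ℕ)) * (((k : ℕ) : ℝ) - (i : ℕ)) / 2

/-- The wedge product of two 1-forms. -/
def wedgeOne {V : Type*} (α β : V → ℝ) : V → V → ℝ :=
  fun u v => α u * β v - α v * β u

/-- The wedge product of two 2-forms, `(α ∧ β)(v) = (1 / (2! 2!)) ∑_σ sign(σ) α ⊗ β (v ∘ σ)`. -/
def wedgeTwo {V : Type*} (α β : V → V → ℝ) : (Fin 4 → V) → ℝ :=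
  fun v => (1 / 4) * ∑ σ : Equiv.Perm (Fin 4),
    ((Equiv.Perm.sign σ : ℤ) : ℝ) * (α (v (σ 0)) (v (σ 1)) * β (v (σ 2)) (v (σ 3)))

/-- `β` is the component of the 2-form `α` in the space `P` of 2-forms along the
wedge-orthogonal complement of `P`. If `P` is the space of self-dual forms of a conformal
structure, then the complement is the space of anti-self-dual forms, and `β` is the self-dual
part of `α`. -/
def IsSelfDualPart {V : Type*} (P : Submodule ℝ (V → V → ℝ)) (α β : V → V → ℝ) : Prop :=
  β ∈ P ∧ ∀ γ ∈ P, wedgeTwo (α - β) γ = 0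

/-- The trace-free symmetric part of a 3 × 3 matrix. -/
def symTraceFree (B : Matrix (Fin 3) (Fin 3) ℝ) : Matrix (Fin 3) (Fin 3) ℝ :=
  (1 / 2 : ℝ) • (B + B.transpose) - (B.trace / 3) • (1 : Matrix (Fin 3) (Fin 3) ℝ)

/-- The components `T^i` of an endomorphism `T ∈ 𝔰𝔬(V)` in an orthonormal basis `e_1, e_2, e_3`
of `V`: those for which `T e_i = ε_ijk T^j e_k`. They do not change if `e` is replaced by `-e`. -/
def soComp {V : Type*} [NormedAddCommGroup V] [InnerProductSpace ℝ V]
    (e : OrthonormalBasis (Fin 3) ℝ V) (T : V → V) (j : Fin 3) : ℝ :=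
  (1 / 2) * ∑ i, ∑ k, eps i j k * inner ℝ (T (e i)) (e k)

/-- The model space of the manifold. -/
abbrev Model4 : Type := EuclideanSpace ℝ (Fin 4)

/-- The model fibre of the bundle. -/
abbrev Model3 : Type := EuclideanSpace ℝ (Fin 3)

/-! ### Oriented 4-manifolds and integration of 4-forms -/

section Manifold

variable {M : Type*} [TopologicalSpace M] [ChartedSpace Model4 M] [IsManifold (𝓡 4) ∞ M]

/-- The coordinate vector fields `∂_1, …, ∂_4` of the preferred chart at `c`; they are meaningful
at the points `x` of the domain of that chart. -/
def coordFrame (c x : M) : Fin 4 → TangentSpace (𝓡 4) x :=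
  fun k => (trivializationAt Model4 (TangentSpace (𝓡 4) : M → Type) c).localFrame
    (EuclideanSpace.basisFun (Fin 4) ℝ).toBasis k x

/-- `1` on positively oriented bases, `-1` on negatively oriented bases and `0` on linearly
dependent families. -/
def orientSign {V : Type*} [AddCommGroup V] [Module ℝ V] (o : Orientation ℝ V (Fin 4))
    (v : Fin 4 → V) : ℝ :=
  ((SignType.sign (o.someVector v) : SignType) : ℝ)

/-- A pointwise choice of orientations of the tangent spaces is an orientation of the manifold if
the sign of the coordinate frame of every chart is a continuous (that is, locally constant)
function on the domain of the chart. -/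
def IsOrientation (o : ∀ x : M, Orientation ℝ (TangentSpace (𝓡 4) x) (Fin 4)) : Prop :=
  ∀ c : M, ContinuousOn (fun x => orientSign (o x) (coordFrame c x)) (chartAt Model4 c).source

variable [CompactSpace M] [T2Space M]

variable (M) in
/-- A smooth partition of unity subordinate to the domains of the preferred charts. -/
def chartPartition : SmoothPartitionOfUnity M (𝓡 4) M univ :=
  (SmoothPartitionOfUnity.exists_isSubordinate_chartAt_source (𝓡 4) M).choose

/-- The integral over the compact oriented manifold `(M, o)` of a (smooth) 4-form `η`: the sum
over a partition of unity subordinate to charts of the Lebesgue integrals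
`∫ ρ_c η(∂_1, …, ∂_4) dy` in the chart at `c`, with the sign by which the chart agrees with the
orientation. -/
def integral (o : ∀ x : M, Orientation ℝ (TangentSpace (𝓡 4) x) (Fin 4))
    (η : ∀ x : M, (Fin 4 → TangentSpace (𝓡 4) x) → ℝ) : ℝ :=
  ∑ᶠ c : M, ∫ y in (extChartAt (𝓡 4) c).target,
    (fun x : M => chartPartition M c x * (orientSign (o x) (coordFrame c x) *
      η x (coordFrame c x))) ((extChartAt (𝓡 4) c).symm y)

end Manifold

/-- A positively oriented basis of the tangent space at `x`. -/
def posBasis {M : Type*} [TopologicalSpace M] [ChartedSpace Model4 M] [IsManifold (𝓡 4) ∞ M]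
    (o : ∀ x : M, Orientation ℝ (TangentSpace (𝓡 4) x) (Fin 4)) (x : M) :
    Module.Basis (Fin 4) ℝ (TangentSpace (𝓡 4) x) :=
  ((trivializationAt Model4 (TangentSpace (𝓡 4) : M → Type) x).basisAt
    (EuclideanSpace.basisFun (Fin 4) ℝ).toBasis
    (mem_baseSet_trivializationAt Model4 (TangentSpace (𝓡 4) : M → Type) x)).adjustToOrientation
      (o x)

/-! ### Connections, curvature and the pure connection action -/

theorem finrank_fiber {M : Type*} [TopologicalSpace M] (E : M → Type*)
    [TopologicalSpace (TotalSpace Model3 E)] [∀ x, NormedAddCommGroup (E x)]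
    [∀ x, InnerProductSpace ℝ (E x)] [FiberBundle Model3 E] [VectorBundle ℝ Model3 E] (x : M) :
    Module.finrank ℝ (E x) = 3 := by
  have h := (VectorBundle.continuousLinearEquivAt ℝ Model3 E x).toLinearEquiv.finrank_eq
  rw [h]
  simp

section Bundle

variable {M : Type*} [TopologicalSpace M] [ChartedSpace Model4 M] [IsManifold (𝓡 4) ∞ M]
  {E : M → Type*} [TopologicalSpace (TotalSpace Model3 E)]
  [∀ x, NormedAddCommGroup (E x)] [∀ x, InnerProductSpace ℝ (E x)]
  [FiberBundle Model3 E] [VectorBundle ℝ Model3 E]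

/-- The curvature `F_A(u, v) s = ∇_U ∇_V σ - ∇_V ∇_U σ - ∇_[U, V] σ` at `x`, where `U`, `V`, `σ`
are local extensions of `u`, `v`, `s`. -/
def curvature (A : CovariantDerivative (𝓡 4) Model3 E) (x : M) (u v : TangentSpace (𝓡 4) x)
    (s : E x) : E x :=
  let U : ∀ y : M, TangentSpace (𝓡 4) y := extend Model4 u
  let V : ∀ y : M, TangentSpace (𝓡 4) y := extend Model4 v
  let σ : ∀ y : M, E y := extend Model3 s
  A (fun y => A σ y (V y)) x u - A (fun y => A σ y (U y)) x v
    - A σ x (VectorField.mlieBracket (𝓡 4) U V x)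

/-- `a ∈ Ω¹(M, 𝔰𝔬(E))`; here `a x s u` is `a_x(u) s`. -/
structure IsSoOneForm (a : ∀ x : M, E x →L[ℝ] TangentSpace (𝓡 4) x →L[ℝ] E x) : Prop where
  skew : ∀ (x : M) (u : TangentSpace (𝓡 4) x) (s s' : E x),
    inner ℝ (a x s u) s' = - inner ℝ s (a x s' u)
  smooth : ContMDiff (𝓡 4) ((𝓡 4).prod 𝓘(ℝ, Model3 →L[ℝ] Model4 →L[ℝ] Model3)) ∞
    (fun x => TotalSpace.mk' (Model3 →L[ℝ] Model4 →L[ℝ] Model3)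
      (E := fun x => E x →L[ℝ] TangentSpace (𝓡 4) x →L[ℝ] E x) x (a x))

/-- The covariant exterior derivative `d_A a ∈ Ω²(M, 𝔰𝔬(E))` of `a ∈ Ω¹(M, 𝔰𝔬(E))`:
`(d_A a)(u, v) = ∇_U (a(V)) - ∇_V (a(U)) - a([U, V])`, with the connection
`(∇_U T) σ = ∇_U (T σ) - T (∇_U σ)` on endomorphisms, where `U`, `V`, `σ` are local extensions of
`u`, `v`, `s`. -/
def extCovDeriv (A : CovariantDerivative (𝓡 4) Model3 E)
    (a : ∀ x : M, E x →L[ℝ] TangentSpace (𝓡 4) x →L[ℝ] E x)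
    (x : M) (u v : TangentSpace (𝓡 4) x) (s : E x) : E x :=
  let U : ∀ y : M, TangentSpace (𝓡 4) y := extend Model4 u
  let V : ∀ y : M, TangentSpace (𝓡 4) y := extend Model4 v
  let σ : ∀ y : M, E y := extend Model3 s
  (A (fun y => a y (σ y) (V y)) x u - a x (A σ x u) v)
    - (A (fun y => a y (σ y) (U y)) x v - a x (A σ x v) u)
    - a x s (VectorField.mlieBracket (𝓡 4) U V x)

/-- The 1-forms `a^i` of `a ∈ Ω¹(M, 𝔰𝔬(E))` in an orthonormal basis of the fibre. -/
def formComp {x : M} (e : OrthonormalBasis (Fin 3) ℝ (E x))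
    (a : ∀ x : M, E x →L[ℝ] TangentSpace (𝓡 4) x →L[ℝ] E x) (i : Fin 3) :
    TangentSpace (𝓡 4) x → ℝ :=
  fun u => soComp e (fun s => a x s u) i

/-- The 2-forms `(d_A a)^i` in an orthonormal basis of the fibre. -/
def extCovDerivComp (A : CovariantDerivative (𝓡 4) Model3 E) {x : M}
    (e : OrthonormalBasis (Fin 3) ℝ (E x))
    (a : ∀ x : M, E x →L[ℝ] TangentSpace (𝓡 4) x →L[ℝ] E x) (i : Fin 3) :
    TangentSpace (𝓡 4) x → TangentSpace (𝓡 4) x → ℝ :=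
  fun u v => soComp e (extCovDeriv A a x u v) i

/-- The curvature 2-forms `F^i` in an orthonormal basis of the fibre. -/
def curvComp (A : CovariantDerivative (𝓡 4) Model3 E) {x : M}
    (e : OrthonormalBasis (Fin 3) ℝ (E x)) (i : Fin 3) :
    TangentSpace (𝓡 4) x → TangentSpace (𝓡 4) x → ℝ :=
  fun u v => soComp e (curvature A x u v) i

/-- A connection is definite if `F_A(u, v) ≠ 0` whenever `u`, `v` are linearly independent. -/
def IsDefinite (A : CovariantDerivative (𝓡 4) Model3 E) : Prop :=
  ∀ (x : M) (u v : TangentSpace (𝓡 4) x), LinearIndependent ℝ ![u, v] → curvature A x u v ≠ 0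

variable (o : ∀ x : M, Orientation ℝ (TangentSpace (𝓡 4) x) (Fin 4))

/-- The symmetric matrix `(F^i ∧ F^j)(v)`, where `v` is a positively oriented basis. -/
def curvGram (A : CovariantDerivative (𝓡 4) Model3 E) {x : M}
    (e : OrthonormalBasis (Fin 3) ℝ (E x)) : Matrix (Fin 3) (Fin 3) ℝ :=
  Matrix.of fun i j => wedgeTwo (curvComp A e i) (curvComp A e j) (posBasis o x)

/-- The wedge product is positive definite, with respect to the given orientation of `M`, on the
span of the curvature forms: `F^i ∧ F^j = Q^ij μ` with `Q` positive definite and `μ` a positive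
4-form. -/
def InducesOrientation (A : CovariantDerivative (𝓡 4) Model3 E) : Prop :=
  ∀ (x : M) (e : OrthonormalBasis (Fin 3) ℝ (E x)), (curvGram o A e).PosDef

/-- The value of `μ_A` on the positively oriented basis `v = posBasis o x`. In terms of
`G^ij = (F^i ∧ F^j)(v)` it is the positive number `m` for which the square root `Y = ±√(G / m)`
that has the sign of `Λ` satisfies `tr Y = Λ`. -/
def volCoeff (Λ : ℝ) (A : CovariantDerivative (𝓡 4) Model3 E) {x : M}
    (e : OrthonormalBasis (Fin 3) ℝ (E x)) : ℝ :=
  ((cfc Real.sqrt (curvGram o A e)).trace / Λ) ^ 2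

/-- The 4-form `μ_A`. -/
def volForm (Λ : ℝ) (A : CovariantDerivative (𝓡 4) Model3 E) {x : M}
    (e : OrthonormalBasis (Fin 3) ℝ (E x)) : (Fin 4 → TangentSpace (𝓡 4) x) → ℝ :=
  fun v => volCoeff o Λ A e * (posBasis o x).det v

/-- The matrix `Q`, for which `F^i ∧ F^j = Q^ij μ_A`. -/
def matQ (Λ : ℝ) (A : CovariantDerivative (𝓡 4) Model3 E) {x : M}
    (e : OrthonormalBasis (Fin 3) ℝ (E x)) : Matrix (Fin 3) (Fin 3) ℝ :=
  (volCoeff o Λ A e)⁻¹ • curvGram o A e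

/-- The matrix `Y`: the definite square root of `Q` that has the sign of `Λ`. -/
def matY (Λ : ℝ) (A : CovariantDerivative (𝓡 4) Model3 E) {x : M}
    (e : OrthonormalBasis (Fin 3) ℝ (E x)) : Matrix (Fin 3) (Fin 3) ℝ :=
  ((SignType.sign Λ : SignType) : ℝ) • cfc Real.sqrt (matQ o Λ A e)

/-- The matrix `X = Y⁻¹`. -/
def matX (Λ : ℝ) (A : CovariantDerivative (𝓡 4) Model3 E) {x : M}
    (e : OrthonormalBasis (Fin 3) ℝ (E x)) : Matrix (Fin 3) (Fin 3) ℝ :=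
  (matY o Λ A e)⁻¹

/-- The 2-forms `Σ_i = X_ij F^j`. -/
def sigmaForm (Λ : ℝ) (A : CovariantDerivative (𝓡 4) Model3 E) {x : M}
    (e : OrthonormalBasis (Fin 3) ℝ (E x)) (i : Fin 3) :
    TangentSpace (𝓡 4) x → TangentSpace (𝓡 4) x → ℝ :=
  ∑ j, matX o Λ A e i j • curvComp A e j

/-- The space `Λ⁺_A` of self-dual 2-forms at `x` of the metric `g_A`: the span of the `Σ_i`. -/
def selfDualForms (Λ : ℝ) (A : CovariantDerivative (𝓡 4) Model3 E) {x : M}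
    (e : OrthonormalBasis (Fin 3) ℝ (E x)) :
    Submodule ℝ (TangentSpace (𝓡 4) x → TangentSpace (𝓡 4) x → ℝ) :=
  Submodule.span ℝ (range (sigmaForm o Λ A e))

/-- The matrix of an endomorphism in an orthonormal basis. -/
def endMatrix {x : M} (e : OrthonormalBasis (Fin 3) ℝ (E x)) (φ : E x →L[ℝ] E x) :
    Matrix (Fin 3) (Fin 3) ℝ :=
  Matrix.of fun i j => inner ℝ (e i) (φ (e j))

/-- `φ` belongs to the fibre of `S²_0 E` at `x`: it is symmetric and trace-free. -/
def IsSymTraceFree {x : M} (φ : E x →L[ℝ] E x) : Prop :=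
  (φ : E x →ₗ[ℝ] E x).IsSymmetric ∧ LinearMap.trace ℝ (E x) (φ : E x →ₗ[ℝ] E x) = 0

/-- The 2-forms `(d_A a)^i - φ^ik Σ_k` at `x`. -/
def hessianShift (Λ : ℝ) (A : CovariantDerivative (𝓡 4) Model3 E)
    (a : ∀ x : M, E x →L[ℝ] TangentSpace (𝓡 4) x →L[ℝ] E x) {x : M}
    (e : OrthonormalBasis (Fin 3) ℝ (E x)) (φ : E x →L[ℝ] E x) (i : Fin 3) :
    TangentSpace (𝓡 4) x → TangentSpace (𝓡 4) x → ℝ :=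
  extCovDerivComp A e a i - ∑ k, endMatrix e φ i k • sigmaForm o Λ A e k

/-- The 4-form
`-ε_ijk a^i ∧ a^j ∧ Σ_k + X_ij ((d_A a)^i - φ^ik Σ_k) ∧ ((d_A a)^j - φ^jk Σ_k)` at `x`. -/
def hessianIntegrand (Λ : ℝ) (A : CovariantDerivative (𝓡 4) Model3 E)
    (a : ∀ x : M, E x →L[ℝ] TangentSpace (𝓡 4) x →L[ℝ] E x) {x : M}
    (e : OrthonormalBasis (Fin 3) ℝ (E x)) (φ : E x →L[ℝ] E x) :
    (Fin 4 → TangentSpace (𝓡 4) x) → ℝ :=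
  (∑ i, ∑ j, matX o Λ A e i j •
      wedgeTwo (hessianShift o Λ A a e φ i) (hessianShift o Λ A a e φ j))
    - (∑ i, ∑ j, ∑ k, eps i j k •
      wedgeTwo (wedgeOne (formComp e a i) (formComp e a j)) (sigmaForm o Λ A e k))

variable (E) in
/-- Some orthonormal basis of the fibre at `x`. The 4-form `volForm` does not depend on it. -/
def someFrame (x : M) : OrthonormalBasis (Fin 3) ℝ (E x) :=
  haveI : FiniteDimensional ℝ (E x) := VectorBundle.finiteDimensional ℝ Model3 E x
  (stdOrthonormalBasis ℝ (E x)).reindex (finCongr (finrank_fiber E x))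

variable [CompactSpace M] [T2Space M]

/-- The pure connection action `S(A) = (Λ / 2) ∫_M μ_A`. -/
def action (Λ : ℝ) (A : CovariantDerivative (𝓡 4) Model3 E) : ℝ :=
  Λ / 2 * integral o fun x => volForm o Λ A (someFrame E x)

/-- The action along the line `A + t a`. -/
def actionAlong (Λ : ℝ) (A : CovariantDerivative (𝓡 4) Model3 E)
    (a : ∀ x : M, E x →L[ℝ] TangentSpace (𝓡 4) x →L[ℝ] E x) (t : ℝ) : ℝ :=
  action o Λ (A.addOneForm fun x => t • a x)

/-- `A` is a critical point of `S`: all directional derivatives along `Ω¹(M, 𝔰𝔬(E))` vanish. -/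
def IsCriticalPoint (Λ : ℝ) (A : CovariantDerivative (𝓡 4) Model3 E) : Prop :=
  ∀ b : ∀ x : M, E x →L[ℝ] TangentSpace (𝓡 4) x →L[ℝ] E x, IsSoOneForm b →
    HasDerivAt (actionAlong o Λ A b) 0 0

/-- `D²S(a, a)` at `A` exists and equals `h`: the function `t ↦ S(A + t a)` is twice
differentiable at `0`, with second derivative `h`. -/
def HasHessianAt (Λ : ℝ) (A : CovariantDerivative (𝓡 4) Model3 E)
    (a : ∀ x : M, E x →L[ℝ] TangentSpace (𝓡 4) x →L[ℝ] E x) (h : ℝ) : Prop :=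
  (∀ᶠ t in 𝓝 (0 : ℝ), DifferentiableAt ℝ (actionAlong o Λ A a) t) ∧
    HasDerivAt (deriv (actionAlong o Λ A a)) h 0

end Bundle

end PureConnection

end

open PureConnection

/-!
The second variation of the pure connection action is computed pointwise and then integrated.

*Pointwise.* In an orthonormal frame the curvature of `A + t a` has components
`F + t D + t² B`, where `D = d_A a` and `B` is the bracket of `a` with itself
(`curvComp_addOneForm`, `bracketComp_eq`). Evaluated on a basis of the tangent space, the Gram
matrix `G = (F^i ∧ F^j)` of the curvature is therefore a polynomial in `t` (`curvPath`). Let `m` be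
the value of the volume form and `Y` the normalised root of `G`, so that `G = m Y²` and `tr Y = Λ`;
let `X = Y⁻¹`. Two derivatives of this identity give everything:

* The first derivative reads `Y Nᵀ + N Y = φ Y + Y φ + c Y²` with `φ = Y'`. Multiplied by `X` from
  both sides it says that `X φ` and `X N` have the same trace-free symmetric part. As `X` is
  definite, a symmetric trace-free `φ` with this property is unique, because `X δ + δ X` can only be
  scalar for `δ = 0` (`eq_zero_of_symTraceFree_mul`). So the `φ` of the statement is the derivative
  of `Y` along `A + t a` (`variationEnd`).
* The second derivative, multiplied by `X` and traced, contains no second derivative of `Y`, as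
  `tr Y` is constant. It expresses `(Λ / 2) m''` through `tr (X G'')` and `m tr (X φ²)`, and this is
  the integrand (`variation_pathGram`, `variation_volCoeff`).

None of this needs integration by parts.

*Smoothness.* The square root is smooth on positive definite matrices, being a local inverse of
`Y ↦ Y²`, whose derivative is invertible (`contDiffAt_symSqrt`). The curvature is a tensor
(`curvature_eq`), so its components in smooth frames are smooth; `d_A a` is the curvature of `A + a`
minus that of `A` and the bracket, which reduces its smoothness and bilinearity to those of
curvatures. Changes of orthonormal frame act on all components by one orthogonal matrix, so that the
volume form and `φ` do not depend on the frame.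

*Integration.* In each of the finitely many charts that contribute, the density of the volume form
is a smooth function of `t` and of the coefficients of the Gram matrix, and these are continuous
(`isDerivNear_volDensity`). The support of the partition function is compact, so two derivatives may
be taken under the integral (`hasDerivAt_setIntegral`).
-/

set_option linter.unusedSectionVars false

/-! ### Square roots of positive definite matrices -/

section MatrixSqrt

variable {n : Type*} [Fintype n] [DecidableEq n]

open scoped MatrixOrder in
theorem cfc_sqrt_eq_of_mul_self {G R : Matrix n n ℝ} (hR : R.PosSemidef) (h : R * R = G) :
    cfc Real.sqrt G = R := by
  have hG : G.PosSemidef := by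
    have := Matrix.posSemidef_conjTranspose_mul_self R
    rwa [hR.1.eq, h] at this
  have h1 := CFC.sqrt_unique h (Matrix.nonneg_iff_posSemidef.2 hR)
  rw [CFC.sqrt_eq_real_sqrt G (Matrix.nonneg_iff_posSemidef.2 hG),
    cfcₙ_eq_cfc (by fun_prop) (by simp)] at h1
  exact h1

open scoped MatrixOrder in
theorem cfc_sqrt_posSemidef {G : Matrix n n ℝ} : (cfc Real.sqrt G).PosSemidef :=
  Matrix.nonneg_iff_posSemidef.1 (cfc_nonneg fun x _ => Real.sqrt_nonneg x)

open scoped MatrixOrder in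
theorem cfc_sqrt_mul_self {G : Matrix n n ℝ} (hG : G.PosDef) :
    cfc Real.sqrt G * cfc Real.sqrt G = G := by
  have h0 := Matrix.nonneg_iff_posSemidef.2 hG.posSemidef
  have := CFC.sqrt_mul_sqrt_self G h0
  rw [CFC.sqrt_eq_real_sqrt G h0, cfcₙ_eq_cfc (by fun_prop) (by simp)] at this
  exact this

theorem cfc_sqrt_posDef {G : Matrix n n ℝ} (hG : G.PosDef) : (cfc Real.sqrt G).PosDef := by
  refine (Matrix.PosSemidef.posDef_iff_det_ne_zero cfc_sqrt_posSemidef).2 fun h => ?_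
  have := congrArg Matrix.det (cfc_sqrt_mul_self hG)
  rw [Matrix.det_mul, h, zero_mul] at this
  exact hG.det_pos.ne this

theorem cfc_sqrt_smul {G : Matrix n n ℝ} (hG : G.PosDef) {c : ℝ} (hc : 0 ≤ c) :
    cfc Real.sqrt (c • G) = Real.sqrt c • cfc Real.sqrt G := by
  refine cfc_sqrt_eq_of_mul_self (cfc_sqrt_posSemidef.smul (Real.sqrt_nonneg c)) ?_
  rw [smul_mul_smul_comm, Real.mul_self_sqrt hc, cfc_sqrt_mul_self hG]

theorem cfc_sqrt_conj {G : Matrix n n ℝ} (hG : G.PosDef) {O : Matrix n n ℝ}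
    (hO : O.transpose * O = 1) :
    cfc Real.sqrt (O * G * O.transpose) = O * cfc Real.sqrt G * O.transpose := by
  refine cfc_sqrt_eq_of_mul_self ?_ ?_
  · have := (cfc_sqrt_posSemidef (G := G)).mul_mul_conjTranspose_same O
    rwa [Matrix.conjTranspose_eq_transpose_of_trivial] at this
  · calc O * cfc Real.sqrt G * O.transpose * (O * cfc Real.sqrt G * O.transpose)
        = O * cfc Real.sqrt G * (O.transpose * O) * cfc Real.sqrt G * O.transpose := by
          simp only [Matrix.mul_assoc]
      _ = O * (cfc Real.sqrt G * cfc Real.sqrt G) * O.transpose := by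
          rw [hO]; simp only [Matrix.mul_assoc, Matrix.one_mul]
      _ = _ := by rw [cfc_sqrt_mul_self hG]

theorem posDef_conj {G : Matrix n n ℝ} (hG : G.PosDef) {O : Matrix n n ℝ}
    (hO : O.transpose * O = 1) : (O * G * O.transpose).PosDef := by
  have h := hG.conjTranspose_mul_mul_same (B := O.transpose) (by
    refine Function.LeftInverse.injective (g := O.mulVec) fun x => ?_
    rw [Matrix.mulVec_mulVec, mul_eq_one_comm.1 hO, Matrix.one_mulVec])
  rwa [Matrix.conjTranspose_eq_transpose_of_trivial, Matrix.transpose_transpose] at h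

/-- The Sylvester equation `Y H + H Y = 0` has only the trivial solution if `Y` is positive
definite: the trace of its product with `Hᵀ` is a sum of two nonnegative terms. -/
theorem eq_zero_of_sylvester {Y H : Matrix n n ℝ} (hY : Y.PosDef) (h : Y * H + H * Y = 0) :
    H = 0 := by
  have p1 : (H.transpose * Y * H).PosSemidef := by
    have := hY.posSemidef.conjTranspose_mul_mul_same H
    rwa [Matrix.conjTranspose_eq_transpose_of_trivial] at this
  have p2 : (H * Y * H.transpose).PosSemidef := by
    have := hY.posSemidef.mul_mul_conjTranspose_same H
    rwa [Matrix.conjTranspose_eq_transpose_of_trivial] at this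
  have hs : (H.transpose * Y * H).trace + (H * Y * H.transpose).trace = 0 := by
    rw [Matrix.trace_mul_comm (H * Y), ← Matrix.trace_add, Matrix.mul_assoc, ← Matrix.mul_add, h,
      Matrix.mul_zero, Matrix.trace_zero]
  have h0 : H.transpose * Y * H = 0 :=
    p1.trace_eq_zero_iff.1 (by linarith [p1.trace_nonneg, p2.trace_nonneg])
  refine Matrix.ext_of_mulVec_single fun i => ?_
  rw [Matrix.zero_mulVec]
  by_contra hne
  have hpos := hY.dotProduct_mulVec_pos hne
  have hz : star (H.mulVec (Pi.single i 1)) ⬝ᵥ Y.mulVec (H.mulVec (Pi.single i 1)) = 0 := by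
    rw [star_trivial, Matrix.mulVec_mulVec, ← Matrix.vecMul_transpose, ← Matrix.dotProduct_mulVec,
      Matrix.mulVec_mulVec, ← Matrix.mul_assoc, h0, Matrix.zero_mulVec, dotProduct_zero]
  exact hpos.ne' hz

/-- Positive definiteness is an open condition on symmetric matrices: the quadratic form is
positive on the compact unit sphere. -/
theorem eventually_posDef {n : Type*} [Fintype n] {Y : Matrix n n ℝ} (hY : Y.PosDef) :
    ∀ᶠ R in 𝓝 Y, R.IsHermitian → R.PosDef := by
  have hc : Continuous fun p : Matrix n n ℝ × (n → ℝ) => p.2 ⬝ᵥ p.1.mulVec p.2 := by fun_prop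
  have key : ∀ᶠ R in 𝓝 Y, ∀ x ∈ Metric.sphere (0 : n → ℝ) 1, 0 < x ⬝ᵥ R.mulVec x := by
    refine (isCompact_sphere (0 : n → ℝ) 1).eventually_forall_of_forall_eventually fun x hx => ?_
    refine hc.continuousAt.eventually (lt_mem_nhds ?_)
    have hx0 : x ≠ 0 := by
      rintro rfl
      simp at hx
    simpa using hY.dotProduct_mulVec_pos hx0
  filter_upwards [key] with R hR hRs
  refine Matrix.PosDef.of_dotProduct_mulVec_pos hRs fun x hx => ?_
  have hn : 0 < ‖x‖ := norm_pos_iff.2 hx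
  have := hR (‖x‖⁻¹ • x) (by simp [norm_smul, hn.ne'])
  rw [Matrix.mulVec_smul, smul_dotProduct, dotProduct_smul, smul_eq_mul, smul_eq_mul] at this
  rw [star_trivial]
  have h2 := inv_pos.2 hn
  exact (mul_pos_iff_of_pos_left h2).1 ((mul_pos_iff_of_pos_left h2).1 this)

theorem isHermitian_of_symmetrization {n : Type*} (G : Matrix n n ℝ) :
    ((1 / 2 : ℝ) • (G + G.transpose)).IsHermitian := by
  rw [Matrix.IsHermitian, Matrix.conjTranspose_eq_transpose_of_trivial, Matrix.transpose_smul,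
    Matrix.transpose_add, Matrix.transpose_transpose, add_comm]

theorem symmetrization_eq {n : Type*} {G : Matrix n n ℝ} (h : G.IsHermitian) :
    (1 / 2 : ℝ) • (G + G.transpose) = G := by
  have : G.transpose = G := by
    rw [← Matrix.conjTranspose_eq_transpose_of_trivial]; exact h
  rw [this, ← two_smul ℝ G, smul_smul]; norm_num

/-- The square root of the symmetric part of a matrix. Unlike `cfc Real.sqrt`, it is smooth at
positive definite matrices as a function of all entries. -/
noncomputable def symSqrt (G : Matrix n n ℝ) : Matrix n n ℝ :=
  cfc Real.sqrt ((1 / 2 : ℝ) • (G + G.transpose))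

theorem symSqrt_eq {G : Matrix n n ℝ} (h : G.IsHermitian) : symSqrt G = cfc Real.sqrt G := by
  rw [symSqrt, symmetrization_eq h]

attribute [local instance] Matrix.normedAddCommGroup Matrix.normedSpace

/-- Matrix multiplication as a continuous bilinear map. -/
noncomputable def matMul (n : Type*) [Fintype n] [DecidableEq n] :
    Matrix n n ℝ →L[ℝ] Matrix n n ℝ →L[ℝ] Matrix n n ℝ :=
  LinearMap.toContinuousBilinearMap (LinearMap.mul ℝ (Matrix n n ℝ))

/-- Near a positive definite matrix, `symSqrt` is a local inverse of `Y ↦ Y * Y`, whose derivative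
at a positive definite matrix is invertible. -/
theorem contDiffAt_symSqrt {G : Matrix n n ℝ} (hG : G.PosDef) :
    ContDiffAt ℝ ∞ (symSqrt (n := n)) G := by
  set Y := cfc Real.sqrt G with hYdef
  have hY : Y.PosDef := cfc_sqrt_posDef hG
  have hYY : Y * Y = G := cfc_sqrt_mul_self hG
  let f : Matrix n n ℝ → Matrix n n ℝ := fun R => R * R
  have hf : ContDiff ℝ ∞ f :=
    (matMul n).isBoundedBilinearMap.contDiff.comp (contDiff_id.prodMk contDiff_id)
  let T : Matrix n n ℝ →ₗ[ℝ] Matrix n n ℝ :=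
    LinearMap.mulLeft ℝ Y + LinearMap.mulRight ℝ Y
  have hT : Function.Injective T := by
    refine (injective_iff_map_eq_zero T).2 fun H hH => eq_zero_of_sylvester hY ?_
    simpa [T] using hH
  let T' : Matrix n n ℝ ≃L[ℝ] Matrix n n ℝ :=
    (LinearEquiv.ofInjectiveEndo T hT).toContinuousLinearEquiv
  have hf' : HasFDerivAt f (T' : Matrix n n ℝ →L[ℝ] Matrix n n ℝ) Y := by
    have h := (matMul n).hasFDerivAt_of_bilinear (hasFDerivAt_id Y) (hasFDerivAt_id Y)
    refine h.congr_fderiv ?_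
    ext1 H
    rfl
  have hfY : f Y = G := hYY
  have hs := hf.contDiffAt.hasStrictFDerivAt' hf' (by simp)
  have hL := hf.contDiffAt.to_localInverse hf' (by simp)
  set L := hf.contDiffAt.localInverse hf' (by simp) with hLdef
  rw [hfY] at hL
  have hLG : L G = Y := by
    have := hf.contDiffAt.localInverse_apply_image hf' (by simp)
    rwa [hfY] at this
  have hR : ∀ᶠ S in 𝓝 G, f (L S) = S := by
    have := hs.eventually_right_inverse
    rwa [hfY] at this
  have hl : ∀ᶠ R in 𝓝 Y, L (f R) = R := hs.eventually_left_inverse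
  have hsym : ContDiff ℝ ∞ fun S : Matrix n n ℝ => (1 / 2 : ℝ) • (S + S.transpose) := by
    have : ContDiff ℝ ∞ fun S : Matrix n n ℝ => S.transpose :=
      (LinearMap.toContinuousLinearMap
        (Matrix.transposeLinearEquiv n n ℝ ℝ).toLinearMap).contDiff
    exact ContDiff.const_smul (1 / 2 : ℝ) (contDiff_id.add this)
  have hsymG : (1 / 2 : ℝ) • (G + G.transpose) = G := symmetrization_eq hG.1
  have hcomp : ContDiffAt ℝ ∞ (fun S => L ((1 / 2 : ℝ) • (S + S.transpose))) G :=
    ContDiffAt.comp G (by rw [hsymG]; exact hL) hsym.contDiffAt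
  -- The smooth function `L ∘ sym` is `symSqrt` near `G`, as its values are positive definite roots.
  refine hcomp.congr_of_eventuallyEq ?_
  have htend : Tendsto (fun S : Matrix n n ℝ => (1 / 2 : ℝ) • (S + S.transpose)) (𝓝 G) (𝓝 G) := by
    have := hsym.continuous.tendsto G
    rwa [hsymG] at this
  have hLt : Tendsto L (𝓝 G) (𝓝 Y) := by
    have := hL.continuousAt.tendsto
    rwa [hLG] at this
  have hYT : Y.transpose = Y := by
    rw [← Matrix.conjTranspose_eq_transpose_of_trivial]; exact hY.1
  have hLtT : Tendsto (fun S => (L S).transpose) (𝓝 G) (𝓝 Y) := by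
    have := (continuous_id.matrix_transpose.tendsto Y).comp hLt
    rwa [id, hYT] at this
  filter_upwards [htend.eventually hR, htend.eventually (hLt.eventually (eventually_posDef hY)),
    htend.eventually (hLtT.eventually hl)] with S h1 h2 h3
  set S' := (1 / 2 : ℝ) • (S + S.transpose) with hS'
  have hS'T : S'.transpose = S' := by
    rw [← Matrix.conjTranspose_eq_transpose_of_trivial]; exact isHermitian_of_symmetrization S
  -- `(L S')ᵀ` is another root of `S'` near `Y`, hence equal to `L S'`.
  have hLT : L S' = (L S').transpose := by
    have : f (L S').transpose = S' := by
      change (L S').transpose * (L S').transpose = S'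
      rw [← Matrix.transpose_mul]
      change (f (L S')).transpose = S'
      rw [h1, hS'T]
    rw [this] at h3
    exact h3
  have hpd := h2 (by
    rw [Matrix.IsHermitian, Matrix.conjTranspose_eq_transpose_of_trivial]; exact hLT.symm)
  exact cfc_sqrt_eq_of_mul_self hpd.posSemidef h1

end MatrixSqrt

/-! ### The normalised square root and its derivatives along a curve -/

section NormRoot

attribute [local instance] Matrix.normedAddCommGroup Matrix.normedSpace

/-- The function `G ↦ (tr √G / Λ)²`: the scale `m` for which `√(G / m)` has trace `|Λ|`. -/
noncomputable def rootVol (Λ : ℝ) (G : Matrix (Fin 3) (Fin 3) ℝ) : ℝ :=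
  ((symSqrt G).trace / Λ) ^ 2

/-- The multiple of `√G` with trace `Λ`. -/
noncomputable def normRoot (Λ : ℝ) (G : Matrix (Fin 3) (Fin 3) ℝ) : Matrix (Fin 3) (Fin 3) ℝ :=
  (Λ / (symSqrt G).trace) • symSqrt G

variable {Λ : ℝ} {G : Matrix (Fin 3) (Fin 3) ℝ}

theorem symSqrt_posDef (hG : G.PosDef) : (symSqrt G).PosDef := by
  rw [symSqrt_eq hG.1]; exact cfc_sqrt_posDef hG

theorem symSqrt_mul_self (hG : G.PosDef) : symSqrt G * symSqrt G = G := by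
  rw [symSqrt_eq hG.1]; exact cfc_sqrt_mul_self hG

theorem trace_symSqrt_pos (hG : G.PosDef) : 0 < (symSqrt G).trace := (symSqrt_posDef hG).trace_pos

theorem symSqrt_smul (hG : G.PosDef) {c : ℝ} (hc : 0 < c) :
    symSqrt (c • G) = Real.sqrt c • symSqrt G := by
  rw [symSqrt_eq hG.1, symSqrt_eq (hG.smul hc).1, cfc_sqrt_smul hG hc.le]

theorem rootVol_pos (hΛ : Λ ≠ 0) (hG : G.PosDef) : 0 < rootVol Λ G := by
  have := trace_symSqrt_pos hG
  unfold rootVol; positivity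

theorem rootVol_smul (hG : G.PosDef) {c : ℝ} (hc : 0 < c) :
    rootVol Λ (c • G) = c * rootVol Λ G := by
  rw [rootVol, symSqrt_smul hG hc, Matrix.trace_smul, smul_eq_mul, mul_div_assoc, mul_pow,
    Real.sq_sqrt hc.le, rootVol]

theorem normRoot_smul (hG : G.PosDef) {c : ℝ} (hc : 0 < c) :
    normRoot Λ (c • G) = normRoot Λ G := by
  have h1 := (Real.sqrt_pos.2 hc).ne'
  have h2 := (trace_symSqrt_pos hG).ne'
  rw [normRoot, symSqrt_smul hG hc, Matrix.trace_smul, smul_smul, normRoot, smul_eq_mul]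
  congr 1
  field_simp

theorem trace_normRoot (hG : G.PosDef) : (normRoot Λ G).trace = Λ := by
  have h2 := (trace_symSqrt_pos hG).ne'
  rw [normRoot, Matrix.trace_smul, smul_eq_mul]
  field_simp

theorem rootVol_smul_normRoot_mul_self (hΛ : Λ ≠ 0) (hG : G.PosDef) :
    rootVol Λ G • (normRoot Λ G * normRoot Λ G) = G := by
  have h2 := (trace_symSqrt_pos hG).ne'
  rw [normRoot, smul_mul_smul_comm, symSqrt_mul_self hG, smul_smul, rootVol]
  have : ((symSqrt G).trace / Λ) ^ 2 * (Λ / (symSqrt G).trace * (Λ / (symSqrt G).trace)) = 1 := by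
    field_simp
  rw [this, one_smul]

theorem symSqrt_transpose (G : Matrix (Fin 3) (Fin 3) ℝ) : (symSqrt G).transpose = symSqrt G := by
  rw [← Matrix.conjTranspose_eq_transpose_of_trivial]
  exact cfc_sqrt_posSemidef.1

theorem normRoot_transpose (G : Matrix (Fin 3) (Fin 3) ℝ) :
    (normRoot Λ G).transpose = normRoot Λ G := by
  rw [normRoot, Matrix.transpose_smul, symSqrt_transpose]

theorem det_normRoot_ne_zero (hΛ : Λ ≠ 0) (hG : G.PosDef) : (normRoot Λ G).det ≠ 0 := by
  have h2 := (trace_symSqrt_pos hG).ne'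
  rw [normRoot, Matrix.det_smul]
  exact mul_ne_zero (pow_ne_zero _ (div_ne_zero hΛ h2)) (symSqrt_posDef hG).det_pos.ne'

theorem symSqrt_conj (hG : G.PosDef) {O : Matrix (Fin 3) (Fin 3) ℝ} (hO : O.transpose * O = 1) :
    symSqrt (O * G * O.transpose) = O * symSqrt G * O.transpose := by
  rw [symSqrt_eq hG.1, symSqrt_eq (posDef_conj hG hO).1, cfc_sqrt_conj hG hO]

theorem trace_conj {O B : Matrix (Fin 3) (Fin 3) ℝ} (hO : O.transpose * O = 1) :
    (O * B * O.transpose).trace = B.trace := by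
  rw [Matrix.trace_mul_comm, ← Matrix.mul_assoc, hO, Matrix.one_mul]

theorem rootVol_conj (hG : G.PosDef) {O : Matrix (Fin 3) (Fin 3) ℝ} (hO : O.transpose * O = 1) :
    rootVol Λ (O * G * O.transpose) = rootVol Λ G := by
  rw [rootVol, symSqrt_conj hG hO, trace_conj hO, rootVol]

theorem normRoot_conj (hG : G.PosDef) {O : Matrix (Fin 3) (Fin 3) ℝ} (hO : O.transpose * O = 1) :
    normRoot Λ (O * G * O.transpose) = O * normRoot Λ G * O.transpose := by
  rw [normRoot, symSqrt_conj hG hO, trace_conj hO, normRoot, Matrix.mul_smul, Matrix.smul_mul]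

/-- The trace as a continuous linear map. -/
noncomputable def traceCLM : Matrix (Fin 3) (Fin 3) ℝ →L[ℝ] ℝ :=
  LinearMap.toContinuousLinearMap (Matrix.traceLinearMap (Fin 3) ℝ ℝ)

theorem contDiffAt_trace_symSqrt (hG : G.PosDef) :
    ContDiffAt ℝ ∞ (fun G : Matrix (Fin 3) (Fin 3) ℝ => (symSqrt G).trace) G :=
  traceCLM.contDiff.contDiffAt.comp G (contDiffAt_symSqrt hG)

theorem contDiffAt_rootVol (hG : G.PosDef) : ContDiffAt ℝ ∞ (rootVol Λ) G :=
  ((contDiffAt_trace_symSqrt hG).div_const Λ).pow 2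

theorem contDiffAt_normRoot (hG : G.PosDef) : ContDiffAt ℝ ∞ (normRoot Λ) G :=
  (contDiffAt_const.div (contDiffAt_trace_symSqrt hG) (trace_symSqrt_pos hG).ne').smul
    (contDiffAt_symSqrt hG)

theorem ContDiffAt.eventually_hasDerivAt {V : Type*} [NormedAddCommGroup V] [NormedSpace ℝ V]
    {f : ℝ → V} {t : ℝ} (hf : ContDiffAt ℝ ∞ f t) : ∀ᶠ s in 𝓝 t, HasDerivAt f (deriv f s) s := by
  have h := (hf.of_le (m := 1) (by simp)).eventually (by simp)
  filter_upwards [h] with s hs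
  exact (hs.differentiableAt (by simp)).hasDerivAt

theorem ContDiffAt.hasDerivAt_deriv {V : Type*} [NormedAddCommGroup V] [NormedSpace ℝ V]
    {f : ℝ → V} {t : ℝ} (hf : ContDiffAt ℝ ∞ f t) :
    HasDerivAt (deriv f) (deriv (deriv f) t) t := by
  have h : ContDiffAt ℝ 1 (deriv f) t := by
    have h2 : ContDiffAt ℝ 1 (fun s => fderiv ℝ f s 1) t :=
      (hf.fderiv_right (m := 1) (by norm_cast)).clm_apply contDiffAt_const
    exact h2
  exact (h.differentiableAt (by simp)).hasDerivAt

theorem HasDerivAt.matrix_mul {A B : ℝ → Matrix (Fin 3) (Fin 3) ℝ}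
    {A' B' : Matrix (Fin 3) (Fin 3) ℝ} {t : ℝ} (hA : HasDerivAt A A' t) (hB : HasDerivAt B B' t) :
    HasDerivAt (fun s => A s * B s) (A t * B' + A' * B t) t :=
  (matMul (Fin 3)).hasDerivAt_of_bilinear (fun _ => hA) (fun _ => hB)

/-- First and second derivative of `m W²` for smooth curves `m` of numbers and `W` of matrices. -/
theorem derivs_smul_mul_self {m : ℝ → ℝ} {W : ℝ → Matrix (Fin 3) (Fin 3) ℝ}
    (hm : ContDiffAt ℝ ∞ m 0) (hW : ContDiffAt ℝ ∞ W 0)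
    {G : ℝ → Matrix (Fin 3) (Fin 3) ℝ} (hG : ∀ᶠ t in 𝓝 0, G t = m t • (W t * W t)) :
    deriv G 0 = m 0 • (W 0 * deriv W 0 + deriv W 0 * W 0) + deriv m 0 • (W 0 * W 0) ∧
    deriv (deriv G) 0 =
      m 0 • (W 0 * deriv (deriv W) 0 + (2 : ℝ) • (deriv W 0 * deriv W 0)
          + deriv (deriv W) 0 * W 0)
        + (2 * deriv m 0) • (W 0 * deriv W 0 + deriv W 0 * W 0)
        + deriv (deriv m) 0 • (W 0 * W 0) := by
  have h1 : ∀ᶠ t in 𝓝 0, HasDerivAt G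
      (m t • (W t * deriv W t + deriv W t * W t) + deriv m t • (W t * W t)) t := by
    filter_upwards [hm.eventually_hasDerivAt, hW.eventually_hasDerivAt, hG.eventually_nhds]
      with t h1 h2 h3
    exact (h1.smul (h2.matrix_mul h2)).congr_of_eventuallyEq h3
  refine ⟨h1.self_of_nhds.deriv, ?_⟩
  have h2 : deriv G =ᶠ[𝓝 0] fun t =>
      m t • (W t * deriv W t + deriv W t * W t) + deriv m t • (W t * W t) :=
    h1.mono fun t ht => ht.deriv
  have dm := hm.eventually_hasDerivAt.self_of_nhds
  have dW := hW.eventually_hasDerivAt.self_of_nhds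
  have dm2 := hm.hasDerivAt_deriv
  have dW2 := hW.hasDerivAt_deriv
  have h3 := ((dm.smul ((dW.matrix_mul dW2).add (dW2.matrix_mul dW))).add
    (dm2.smul (dW.matrix_mul dW)))
  refine (h3.congr_of_eventuallyEq h2).deriv.trans ?_
  have alg (a b c : ℝ) (P Q R S T : Matrix (Fin 3) (Fin 3) ℝ) :
      a • (P + Q + (Q + R)) + b • S + (b • S + c • T) =
        a • (P + (2 : ℝ) • Q + R) + (2 * b) • S + c • T := by module
  exact alg _ _ _ _ _ _ _ _

/-- If the curve `W` has constant trace, then tracing the second derivative of `m W²` with `W⁻¹`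
removes the second derivative of `W`. -/
theorem trace_inv_mul_deriv_deriv {m : ℝ → ℝ} {W : ℝ → Matrix (Fin 3) (Fin 3) ℝ} {Λ : ℝ}
    (hm : ContDiffAt ℝ ∞ m 0) (hW : ContDiffAt ℝ ∞ W 0)
    {G : ℝ → Matrix (Fin 3) (Fin 3) ℝ} (hG : ∀ᶠ t in 𝓝 0, G t = m t • (W t * W t))
    (htr : ∀ᶠ t in 𝓝 0, (W t).trace = Λ) {X : Matrix (Fin 3) (Fin 3) ℝ} (hX : X * W 0 = 1) :
    (deriv W 0).trace = 0 ∧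
    (X * deriv (deriv G) 0).trace =
      deriv (deriv m) 0 * Λ + 2 * m 0 * (X * (deriv W 0 * deriv W 0)).trace := by
  have hX' : W 0 * X = 1 := mul_eq_one_comm.1 hX
  have t1 : ∀ᶠ t in 𝓝 0, (deriv W t).trace = 0 := by
    filter_upwards [hW.eventually_hasDerivAt, htr.eventually_nhds] with t h1 h2
    have h3 : HasDerivAt (fun s => (W s).trace) (deriv W t).trace t :=
      traceCLM.hasFDerivAt.comp_hasDerivAt t h1
    exact h3.unique ((hasDerivAt_const t Λ).congr_of_eventuallyEq h2)
  have t2 : (deriv (deriv W) 0).trace = 0 := by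
    have h3 : HasDerivAt (fun s => (deriv W s).trace) (deriv (deriv W) 0).trace 0 :=
      traceCLM.hasFDerivAt.comp_hasDerivAt 0 hW.hasDerivAt_deriv
    exact h3.unique ((hasDerivAt_const (0 : ℝ) (0 : ℝ)).congr_of_eventuallyEq t1)
  refine ⟨t1.self_of_nhds, ?_⟩
  rw [(derivs_smul_mul_self hm hW hG).2]
  have c1 (B : Matrix (Fin 3) (Fin 3) ℝ) : (X * (W 0 * B)).trace = B.trace := by
    rw [← Matrix.mul_assoc, hX, Matrix.one_mul]
  have c2 (B : Matrix (Fin 3) (Fin 3) ℝ) : (X * (B * W 0)).trace = B.trace := by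
    rw [Matrix.trace_mul_comm, Matrix.mul_assoc, hX', Matrix.mul_one]
  simp only [Matrix.mul_add, Matrix.mul_smul, Matrix.trace_add, Matrix.trace_smul, c1, c2,
    t1.self_of_nhds, t2, htr.self_of_nhds, smul_eq_mul]
  ring

end NormRoot

/-! ### Sections that are smooth near a point -/

section SmoothNear

variable {M : Type*} [TopologicalSpace M] [ChartedSpace Model4 M]
  {F : Type*} [NormedAddCommGroup F] [NormedSpace ℝ F]
  {V : M → Type*} [TopologicalSpace (TotalSpace F V)]
  [∀ x, AddCommGroup (V x)] [∀ x, Module ℝ (V x)] [∀ x, TopologicalSpace (V x)]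
  [FiberBundle F V]

variable (F) in
/-- The section `σ` is smooth at `x`. -/
abbrev SmoothSecAt (σ : ∀ x : M, V x) (x : M) : Prop :=
  ContMDiffAt (𝓡 4) ((𝓡 4).prod 𝓘(ℝ, F)) ∞ (fun y => TotalSpace.mk' F y (σ y)) x

variable (F) in
/-- The section `σ` is differentiable at `x`. -/
abbrev DiffSecAt (σ : ∀ x : M, V x) (x : M) : Prop :=
  MDifferentiableAt (𝓡 4) ((𝓡 4).prod 𝓘(ℝ, F)) (fun y => TotalSpace.mk' F y (σ y)) x

variable (F) in
/-- The section `σ` is smooth in a neighbourhood of `x`. -/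
def SmoothNear (σ : ∀ x : M, V x) (x : M) : Prop :=
  ∀ᶠ y in 𝓝 x, SmoothSecAt F σ y

/-- The function `f` is smooth in a neighbourhood of `x`. -/
def SmoothFunNear {W : Type*} [NormedAddCommGroup W] [NormedSpace ℝ W] (f : M → W) (x : M) :
    Prop :=
  ∀ᶠ y in 𝓝 x, ContMDiffAt (𝓡 4) 𝓘(ℝ, W) ∞ f y

theorem SmoothNear.contMDiffAt {σ : ∀ x : M, V x} {x : M} (h : SmoothNear F σ x) :
    SmoothSecAt F σ x := Eventually.self_of_nhds h

theorem SmoothNear.mdiffAt {σ : ∀ x : M, V x} {x : M} (h : SmoothNear F σ x) :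
    DiffSecAt F σ x := h.contMDiffAt.mdifferentiableAt (by simp)

theorem SmoothNear.eventually {σ : ∀ x : M, V x} {x : M} (h : SmoothNear F σ x) :
    ∀ᶠ y in 𝓝 x, SmoothNear F σ y := h.eventually_nhds

theorem SmoothFunNear.mdiffAt {W : Type*} [NormedAddCommGroup W] [NormedSpace ℝ W]
    {f : M → W} {x : M} (h : SmoothFunNear f x) : MDifferentiableAt (𝓡 4) 𝓘(ℝ, W) f x :=
  h.self_of_nhds.mdifferentiableAt (by simp)

theorem SmoothFunNear.eventually {W : Type*} [NormedAddCommGroup W] [NormedSpace ℝ W]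
    {f : M → W} {x : M} (h : SmoothFunNear f x) : ∀ᶠ y in 𝓝 x, SmoothFunNear f y :=
  h.eventually_nhds

theorem SmoothNear.congr {σ τ : ∀ x : M, V x} {x : M} (h : SmoothNear F σ x)
    (e : ∀ᶠ y in 𝓝 x, τ y = σ y) : SmoothNear F τ x := by
  filter_upwards [h, e.eventually_nhds] with y hy ey
  exact hy.congr_of_eventuallyEq (ey.mono fun z hz => by simp [hz])

variable [VectorBundle ℝ F V]

theorem SmoothNear.add {σ τ : ∀ x : M, V x} {x : M} (h : SmoothNear F σ x)
    (h' : SmoothNear F τ x) : SmoothNear F (σ + τ) x := by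
  filter_upwards [h, h'] with y hy hy'
  exact hy.add_section hy'

theorem SmoothNear.smul {σ : ∀ x : M, V x} {f : M → ℝ} {x : M} (hf : SmoothFunNear f x)
    (h : SmoothNear F σ x) : SmoothNear F (f • σ) x := by
  filter_upwards [h, hf] with y hy hy'
  exact hy'.smul_section hy

theorem SmoothNear.sum {ι : Type*} {s : Finset ι} {σ : ι → ∀ x : M, V x} {x : M}
    (h : ∀ i ∈ s, SmoothNear F (σ i) x) : SmoothNear F (fun y => ∑ i ∈ s, σ i y) x := by
  filter_upwards [(Filter.eventually_all_finset s).2 h] with y hy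
  exact ContMDiffAt.sum_section hy

variable [IsManifold (𝓡 4) ∞ M] [ContMDiffVectorBundle ∞ F V (𝓡 4)]

theorem smoothNear_extend {x : M} (v : V x) : SmoothNear F (extend F v) x := by
  obtain ⟨s, hs, h⟩ := exists_contMDiffOn_extend (k := ∞) (𝓡 4) F v
  filter_upwards [eventually_mem_nhds_iff.2 hs] with y hy
  exact h.contMDiffAt hy

theorem smoothNear_of_contMDiffOn {σ : ∀ x : M, V x} {x : M} {u : Set M} (hu : IsOpen u)
    (hx : x ∈ u) (h : ContMDiffOn (𝓡 4) ((𝓡 4).prod 𝓘(ℝ, F)) ∞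
      (fun y => TotalSpace.mk' F y (σ y)) u) :
    SmoothNear F σ x := by
  filter_upwards [hu.mem_nhds hx] with y hy
  exact h.contMDiffAt (hu.mem_nhds hy)

variable [FiniteDimensional ℝ F]

/-- An additive operation on sections that is linear over smooth functions depends only on the
value of a section at the point. This is the criterion `TensorialAt.pointwise` for operations that
make sense only for smooth sections. -/
theorem pointwise_of_smooth_linear {A : Type*} [AddCommGroup A] [Module ℝ A]
    {Φ : (∀ x : M, V x) → A} {x : M}
    (hsmul : ∀ {f : M → ℝ} {σ : ∀ x : M, V x}, SmoothFunNear f x → SmoothNear F σ x →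
      Φ (f • σ) = f x • Φ σ)
    (hadd : ∀ {σ τ : ∀ x : M, V x}, SmoothNear F σ x → SmoothNear F τ x → Φ (σ + τ) = Φ σ + Φ τ)
    {σ τ : ∀ x : M, V x} (hσ : SmoothNear F σ x) (hτ : SmoothNear F τ x) (h : σ x = τ x) :
    Φ σ = Φ τ := by
  classical
  have hloc : ∀ {σ τ : ∀ x : M, V x}, SmoothNear F σ x → SmoothNear F τ x →
      (∀ᶠ y in 𝓝 x, σ y = τ y) → Φ σ = Φ τ := by
    intro σ τ hσ hτ hst
    -- As `ψ` is locally constant near `x`, it need not be smooth elsewhere.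
    let ψ : M → ℝ := fun y => if σ y = τ y then 1 else 0
    have hψx : ψ x = 1 := by simp [ψ, hst.self_of_nhds]
    have hψ : SmoothFunNear ψ x := by
      filter_upwards [hst.eventually_nhds] with y hy
      exact (contMDiffAt_const (c := (1 : ℝ))).congr_of_eventuallyEq
        (hy.mono fun z hz => by simp [ψ, hz])
    have he : ψ • σ = ψ • τ := by
      funext y
      by_cases hy : σ y = τ y <;> simp [ψ, hy]
    have h1 := hsmul hψ hσ
    rw [he, hsmul hψ hτ, hψx, one_smul, one_smul] at h1
    exact h1.symm
  have hzero : Φ 0 = 0 := by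
    have hz : SmoothNear F (0 : ∀ x : M, V x) x :=
      Eventually.of_forall fun y => (contMDiff_zeroSection ℝ V).contMDiffAt
    have := hadd hz hz
    simpa using this
  have hsum : ∀ {ι : Type} (s : Finset ι) (σ : ι → ∀ x : M, V x),
      (∀ i ∈ s, SmoothNear F (σ i) x) → Φ (fun y => ∑ i ∈ s, σ i y) = ∑ i ∈ s, Φ (σ i) := by
    intro ι s σ hs
    induction s using Finset.induction_on with
    | empty => exact hzero
    | insert a s ha ih =>
      simp only [Finset.mem_insert, forall_eq_or_imp] at hs
      simp only [Finset.sum_insert ha, ← ih hs.2]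
      exact hadd hs.1 (SmoothNear.sum hs.2)
  let t := trivializationAt F V x
  have hx : x ∈ t.baseSet := mem_baseSet_trivializationAt F V x
  let b := Module.finBasis ℝ F
  have hs (i) : SmoothNear F (t.localFrame b i) x :=
    smoothNear_of_contMDiffOn t.open_baseSet hx (t.contMDiffOn_localFrame_baseSet ∞ b i)
  have hc {σ : ∀ x : M, V x} (hσ : SmoothNear F σ x) (i) :
      SmoothFunNear (fun y => t.localFrameCoeff (𝓡 4) b i y (σ y)) x := by
    filter_upwards [hσ, t.open_baseSet.mem_nhds hx] with y hy hyt
    exact contMDiffAt_localFrameCoeff b hyt hy i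
  have hexp {σ : ∀ x : M, V x} (hσ : SmoothNear F σ x) :
      Φ σ = ∑ i, t.localFrameCoeff (𝓡 4) b i x (σ x) • Φ (t.localFrame b i) := by
    rw [hloc hσ (SmoothNear.sum fun i _ => SmoothNear.smul (hc hσ i) (hs i))
      (t.eventually_eq_localFrame_sum_coeff_smul (I := 𝓡 4) b hx),
      hsum _ _ fun i _ => SmoothNear.smul (hc hσ i) (hs i)]
    exact Finset.sum_congr rfl fun i _ => hsmul (hc hσ i) (hs i)
  rw [hexp hσ, hexp hτ, h]

end SmoothNear

section LieBracket

variable {M : Type*} [TopologicalSpace M] [ChartedSpace Model4 M] [IsManifold (𝓡 4) ∞ M]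

theorem SmoothFunNear.mvfderiv_apply {f : M → ℝ} {U : ∀ x : M, TangentSpace (𝓡 4) x} {x : M}
    (hf : SmoothFunNear f x) (hU : SmoothNear Model4 U x) :
    SmoothFunNear (fun y => mvfderiv (𝓡 4) f y (U y)) x := by
  filter_upwards [hf, hU] with y hf hU
  have h1 := hf.mfderiv_const (m := ∞) (by simp)
  have h2 := h1.clm_apply_of_inCoordinates (E₁ := TangentSpace (𝓡 4)) (b₁ := id)
    (E₂ := TangentSpace 𝓘(ℝ, ℝ)) (b₂ := f) (v := U) hU hf
  have h3 := (contMDiff_snd_tangentBundle_modelSpace ℝ 𝓘(ℝ, ℝ) (n := ∞)).contMDiffAt.comp y h2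
  exact h3

theorem SmoothNear.mlieBracket {U V : ∀ x : M, TangentSpace (𝓡 4) x} {x : M}
    (hU : SmoothNear Model4 U x) (hV : SmoothNear Model4 V x) :
    SmoothNear Model4 (VectorField.mlieBracket (𝓡 4) U V) x := by
  have : IsManifold (𝓡 4) (minSmoothness ℝ 2) M := by simp; infer_instance
  have : IsManifold (𝓡 4) (∞ + 1) M := inferInstanceAs (IsManifold (𝓡 4) ∞ M)
  filter_upwards [hU, hV] with y hU hV
  exact ContMDiffAt.mlieBracket_vectorField (n := ⊤) (m := ⊤) hU hV (by simp)

end LieBracket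

section Commutator

variable {M : Type*} [TopologicalSpace M] [ChartedSpace Model4 M] [IsManifold (𝓡 4) ∞ M]

/-- `U V f - V U f = [U, V] f`. Comparing the coefficients of `W` in the Jacobi identity for
`U`, `V`, `f W` gives this formula. -/
theorem mvfderiv_mlieBracket {f : M → ℝ} {U V : ∀ x : M, TangentSpace (𝓡 4) x} {x : M}
    (hf : SmoothFunNear f x) (hU : SmoothNear Model4 U x) (hV : SmoothNear Model4 V x) :
    mvfderiv (𝓡 4) (fun y => mvfderiv (𝓡 4) f y (V y)) x (U x)
      - mvfderiv (𝓡 4) (fun y => mvfderiv (𝓡 4) f y (U y)) x (V x)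
      = mvfderiv (𝓡 4) f x (VectorField.mlieBracket (𝓡 4) U V x) := by
  have : IsManifold (𝓡 4) (minSmoothness ℝ 3) M := by simp; infer_instance
  obtain ⟨w, hw⟩ : ∃ w : TangentSpace (𝓡 4) x, w ≠ 0 :=
    exists_ne (α := Model4) 0
  let W : ∀ y : M, TangentSpace (𝓡 4) y := extend Model4 w
  have hW : SmoothNear Model4 W x := smoothNear_extend w
  have hWx : W x = w := extend_apply_self _ w
  have key (Z : ∀ x : M, TangentSpace (𝓡 4) x) : ∀ᶠ y in 𝓝 x,
      VectorField.mlieBracket (𝓡 4) Z (f • W) y =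
        ((fun y => mvfderiv (𝓡 4) f y (Z y)) • W
          + f • VectorField.mlieBracket (𝓡 4) Z W) y := by
    filter_upwards [hf.eventually, hW.eventually] with y h1 h2
    exact VectorField.mlieBracket_smul_right h1.mdiffAt h2.mdiffAt
  have key2 (Y Z : ∀ x : M, TangentSpace (𝓡 4) x) (hZ : SmoothNear Model4 Z x) :
      VectorField.mlieBracket (𝓡 4) Y (VectorField.mlieBracket (𝓡 4) Z (f • W)) x =
        mvfderiv (𝓡 4) (fun y => mvfderiv (𝓡 4) f y (Z y)) x (Y x) • W x
          + mvfderiv (𝓡 4) f x (Z x) • VectorField.mlieBracket (𝓡 4) Y W x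
          + (mvfderiv (𝓡 4) f x (Y x) • VectorField.mlieBracket (𝓡 4) Z W x
          + f x • VectorField.mlieBracket (𝓡 4) Y (VectorField.mlieBracket (𝓡 4) Z W) x) := by
    have hdf := hf.mvfderiv_apply hZ
    rw [(Filter.EventuallyEq.refl _ Y).mlieBracket_vectorField_eq (key Z),
      VectorField.mlieBracket_add_right (hdf.mdiffAt.smul_section hW.mdiffAt)
        (hf.mdiffAt.smul_section (hZ.mlieBracket hW).mdiffAt),
      VectorField.mlieBracket_smul_right hdf.mdiffAt hW.mdiffAt,
      VectorField.mlieBracket_smul_right hf.mdiffAt (hZ.mlieBracket hW).mdiffAt]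
  have le2 : minSmoothness ℝ 2 ≤ (∞ : ℕ∞ω) := by simpa using ENat.LEInfty.out (m := 2)
  have J1 := VectorField.leibniz_identity_mlieBracket_apply (hU.contMDiffAt.of_le le2)
    (hV.contMDiffAt.of_le le2) ((SmoothNear.smul hf hW).contMDiffAt.of_le le2)
  have J2 := VectorField.leibniz_identity_mlieBracket_apply (hU.contMDiffAt.of_le le2)
    (hV.contMDiffAt.of_le le2) (hW.contMDiffAt.of_le le2)
  rw [key2 U V hV, key2 V U hU, (key (VectorField.mlieBracket (𝓡 4) U V)).self_of_nhds, J2] at J1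
  simp only [Pi.add_apply, Pi.smul_apply'] at J1
  rw [hWx] at J1
  have h0 : (mvfderiv (𝓡 4) (fun y => mvfderiv (𝓡 4) f y (V y)) x (U x)
      - mvfderiv (𝓡 4) (fun y => mvfderiv (𝓡 4) f y (U y)) x (V x)
      - mvfderiv (𝓡 4) f x (VectorField.mlieBracket (𝓡 4) U V x)) • w = 0 := by
    rw [← sub_eq_zero.2 J1]
    module
  -- The tangent space has dimension four, so that a vector `w ≠ 0` is available.
  rcases smul_eq_zero.1 h0 with h | h
  · linarith
  · exact absurd h hw

end Commutator

/-! ### Curvature as a tensor -/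

section Curvature

variable {M : Type*} [TopologicalSpace M] [ChartedSpace Model4 M] [IsManifold (𝓡 4) ∞ M]
  {E : M → Type*} [TopologicalSpace (TotalSpace Model3 E)]
  [∀ x, NormedAddCommGroup (E x)] [∀ x, InnerProductSpace ℝ (E x)]
  [FiberBundle Model3 E] [VectorBundle ℝ Model3 E] [ContMDiffVectorBundle ∞ Model3 E (𝓡 4)]

/-- `A` maps sections that are smooth near a point to sections of `Hom(TM, E)` that are smooth near
it: the section can be multiplied by a bump function. -/
theorem smoothNear_covariantDerivative [T2Space M] {A : CovariantDerivative (𝓡 4) Model3 E}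
    (hA : CovariantDerivative.ContMDiffCovariantDerivative A ∞) {σ : ∀ x : M, E x} {x : M}
    (hσ : SmoothNear Model3 σ x) :
    SmoothNear (V := fun x => TangentSpace (𝓡 4) x →L[ℝ] E x) (Model4 →L[ℝ] Model3) (A σ) x := by
  obtain ⟨u, hu, huo, hxu⟩ := eventually_nhds_iff.1 hσ
  obtain ⟨f, -, hf⟩ :=
    (SmoothBumpFunction.nhds_basis_tsupport (I := 𝓡 4) x).mem_iff.1 (huo.mem_nhds hxu)
  have hg : ContMDiff (𝓡 4) ((𝓡 4).prod 𝓘(ℝ, Model3)) ∞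
      (fun y => TotalSpace.mk' Model3 y (((f : M → ℝ) • σ) y)) :=
    ContMDiffOn.smul_section_of_tsupport f.contMDiff.contMDiffOn huo hf
      fun y hy => (hu y hy).contMDiffWithinAt
  have h1 := hA.contMDiff.contMDiff (σ := (f : M → ℝ) • σ) hg.contMDiffOn
  filter_upwards [f.eventuallyEq_one.eventually_nhds, hσ.eventually_nhds] with y hy hσy
  have hloc : ∀ᶠ z in 𝓝 y, ((f : M → ℝ) • σ) z = σ z := by
    filter_upwards [hy] with z hz
    simp [hz]
  have h2 : ∀ᶠ z in 𝓝 y, A ((f : M → ℝ) • σ) z = A σ z := by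
    filter_upwards [hloc.eventually_nhds, hσy] with z hz hz'
    exact A.isCovariantDerivativeOnUniv.congr_of_eventuallyEq
      (hg.contMDiffAt.mdifferentiableAt (by simp)) (hz'.mdifferentiableAt (by simp)) univ_mem hz
  exact (h1.contMDiffAt univ_mem).congr_of_eventuallyEq (h2.mono fun z hz => by simp [hz])

end Curvature

section CurvatureTensor

variable {M : Type*} [TopologicalSpace M] [ChartedSpace Model4 M] [IsManifold (𝓡 4) ∞ M]
  {E : M → Type*} [TopologicalSpace (TotalSpace Model3 E)]
  [∀ x, NormedAddCommGroup (E x)] [∀ x, InnerProductSpace ℝ (E x)]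
  [FiberBundle Model3 E] [VectorBundle ℝ Model3 E] [ContMDiffVectorBundle ∞ Model3 E (𝓡 4)]

/-- The curvature operator `∇_U ∇_V σ - ∇_V ∇_U σ - ∇_[U, V] σ` on vector fields and sections. -/
noncomputable def curvatureOp (A : CovariantDerivative (𝓡 4) Model3 E)
    (U V : ∀ y : M, TangentSpace (𝓡 4) y) (σ : ∀ y : M, E y) (x : M) : E x :=
  A (fun y => A σ y (V y)) x (U x) - A (fun y => A σ y (U y)) x (V x)
    - A σ x (VectorField.mlieBracket (𝓡 4) U V x)

variable {A : CovariantDerivative (𝓡 4) Model3 E} {U V : ∀ y : M, TangentSpace (𝓡 4) y}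
  {σ : ∀ y : M, E y} {x : M}

theorem SmoothNear.hom_apply {T : ∀ y : M, TangentSpace (𝓡 4) y →L[ℝ] E y}
    (hT : SmoothNear (V := fun x => TangentSpace (𝓡 4) x →L[ℝ] E x) (Model4 →L[ℝ] Model3) T x)
    (hU : SmoothNear Model4 U x) : SmoothNear Model3 (fun y => T y (U y)) x := by
  filter_upwards [hT, hU] with y h1 h2
  exact h1.clm_bundle_apply h2

theorem curvatureOp_swap : curvatureOp A V U σ x = - curvatureOp A U V σ x := by
  rw [curvatureOp, curvatureOp, VectorField.mlieBracket_swap_apply, map_neg]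
  abel

variable [T2Space M]

theorem curvatureOp_smul_left (hA : CovariantDerivative.ContMDiffCovariantDerivative A ∞)
    {f : M → ℝ} (hf : SmoothFunNear f x) (hU : SmoothNear Model4 U x)
    (hσ : SmoothNear Model3 σ x) :
    curvatureOp A (f • U) V σ x = f x • curvatureOp A U V σ x := by
  have hAσ := smoothNear_covariantDerivative hA hσ
  have e : (fun y => A σ y ((f • U) y)) = f • fun y => A σ y (U y) := by
    funext y; simp
  rw [curvatureOp, curvatureOp, e,
    A.isCovariantDerivativeOnUniv.leibniz (hAσ.hom_apply hU).mdiffAt hf.mdiffAt,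
    VectorField.mlieBracket_smul_left hf.mdiffAt hU.mdiffAt]
  simp only [Pi.smul_apply', map_smul, add_apply,
    smul_apply, ContinuousLinearMap.smulRight_apply, map_add, map_neg, neg_smul]
  module

theorem curvatureOp_add_left (hA : CovariantDerivative.ContMDiffCovariantDerivative A ∞)
    {U' : ∀ y : M, TangentSpace (𝓡 4) y} (hU : SmoothNear Model4 U x)
    (hU' : SmoothNear Model4 U' x) (hσ : SmoothNear Model3 σ x) :
    curvatureOp A (U + U') V σ x = curvatureOp A U V σ x + curvatureOp A U' V σ x := by
  have hAσ := smoothNear_covariantDerivative hA hσ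
  have e : (fun y => A σ y ((U + U') y)) = (fun y => A σ y (U y)) + fun y => A σ y (U' y) := by
    funext y; simp
  rw [curvatureOp, curvatureOp, curvatureOp, e,
    A.isCovariantDerivativeOnUniv.add (hAσ.hom_apply hU).mdiffAt (hAσ.hom_apply hU').mdiffAt,
    VectorField.mlieBracket_add_left hU.mdiffAt hU'.mdiffAt]
  simp only [Pi.add_apply, map_add, add_apply]
  module

theorem curvatureOp_add_section (hA : CovariantDerivative.ContMDiffCovariantDerivative A ∞)
    {σ' : ∀ y : M, E y} (hU : SmoothNear Model4 U x) (hV : SmoothNear Model4 V x)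
    (hσ : SmoothNear Model3 σ x) (hσ' : SmoothNear Model3 σ' x) :
    curvatureOp A U V (σ + σ') x = curvatureOp A U V σ x + curvatureOp A U V σ' x := by
  have hAσ := smoothNear_covariantDerivative hA hσ
  have hAσ' := smoothNear_covariantDerivative hA hσ'
  have hAs := smoothNear_covariantDerivative hA (hσ.add hσ')
  have hadd : ∀ᶠ y in 𝓝 x, A (σ + σ') y = A σ y + A σ' y := by
    filter_upwards [hσ.eventually, hσ'.eventually] with y h h'
    exact A.isCovariantDerivativeOnUniv.add h.mdiffAt h'.mdiffAt
  have key {Z : ∀ y : M, TangentSpace (𝓡 4) y} (hZ : SmoothNear Model4 Z x) :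
      A (fun y => A (σ + σ') y (Z y)) x
        = A (fun y => A σ y (Z y)) x + A (fun y => A σ' y (Z y)) x := by
    rw [← A.isCovariantDerivativeOnUniv.add (hAσ.hom_apply hZ).mdiffAt (hAσ'.hom_apply hZ).mdiffAt]
    refine A.isCovariantDerivativeOnUniv.congr_of_eventuallyEq (hAs.hom_apply hZ).mdiffAt
      ((hAσ.hom_apply hZ).add (hAσ'.hom_apply hZ)).mdiffAt univ_mem ?_
    filter_upwards [hadd] with y hy
    simp [hy]
  rw [curvatureOp, curvatureOp, curvatureOp, key hU, key hV, hadd.self_of_nhds]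
  simp only [add_apply]
  module

/-- Linearity of the curvature over functions in the section. The second derivatives of `f` enter
through `U V f - V U f - [U, V] f`, which vanishes. -/
theorem curvatureOp_smul_section (hA : CovariantDerivative.ContMDiffCovariantDerivative A ∞)
    {f : M → ℝ} (hf : SmoothFunNear f x) (hU : SmoothNear Model4 U x) (hV : SmoothNear Model4 V x)
    (hσ : SmoothNear Model3 σ x) :
    curvatureOp A U V (f • σ) x = f x • curvatureOp A U V σ x := by
  have hAσ := smoothNear_covariantDerivative hA hσ
  have hAs := smoothNear_covariantDerivative hA (SmoothNear.smul hf hσ)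
  have hsm : ∀ᶠ y in 𝓝 x, A (f • σ) y = f y • A σ y + (mvfderiv (𝓡 4) f y).smulRight (σ y) := by
    filter_upwards [hσ.eventually, hf.eventually] with y h h'
    exact A.isCovariantDerivativeOnUniv.leibniz h.mdiffAt h'.mdiffAt
  have key {Z : ∀ y : M, TangentSpace (𝓡 4) y} (hZ : SmoothNear Model4 Z x) :
      A (fun y => A (f • σ) y (Z y)) x
        = (f x • A (fun y => A σ y (Z y)) x
            + (mvfderiv (𝓡 4) f x).smulRight (A σ x (Z x)))
          + (mvfderiv (𝓡 4) f x (Z x) • A σ x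
            + (mvfderiv (𝓡 4) (fun y => mvfderiv (𝓡 4) f y (Z y)) x).smulRight (σ x)) := by
    have hdf := hf.mvfderiv_apply hZ
    have hAZ := hAσ.hom_apply hZ
    rw [← A.isCovariantDerivativeOnUniv.leibniz hAZ.mdiffAt hf.mdiffAt,
      ← A.isCovariantDerivativeOnUniv.leibniz hσ.mdiffAt hdf.mdiffAt,
      ← A.isCovariantDerivativeOnUniv.add (SmoothNear.smul hf hAZ).mdiffAt
        (SmoothNear.smul hdf hσ).mdiffAt]
    refine A.isCovariantDerivativeOnUniv.congr_of_eventuallyEq (hAs.hom_apply hZ).mdiffAt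
      ((SmoothNear.smul hf hAZ).add (SmoothNear.smul hdf hσ)).mdiffAt univ_mem ?_
    filter_upwards [hsm] with y hy
    simp [hy]
  rw [curvatureOp, curvatureOp, key hU, key hV, hsm.self_of_nhds]
  simp only [add_apply, smul_apply,
    ContinuousLinearMap.smulRight_apply, ← mvfderiv_mlieBracket hf hU hV]
  module

/-- The curvature can be computed with arbitrary smooth local extensions. -/
theorem curvature_eq (hA : CovariantDerivative.ContMDiffCovariantDerivative A ∞)
    (hU : SmoothNear Model4 U x) (hV : SmoothNear Model4 V x) (hσ : SmoothNear Model3 σ x) :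
    curvature A x (U x) (V x) (σ x) = curvatureOp A U V σ x := by
  have hU' : SmoothNear Model4 (extend Model4 (U x)) x := smoothNear_extend (U x)
  have hV' : SmoothNear Model4 (extend Model4 (V x)) x := smoothNear_extend (V x)
  have hσ' : SmoothNear Model3 (extend Model3 (σ x)) x := smoothNear_extend (σ x)
  have left {V : ∀ y : M, TangentSpace (𝓡 4) y} {σ : ∀ y : M, E y} (hσ : SmoothNear Model3 σ x)
      {U U' : ∀ y : M, TangentSpace (𝓡 4) y} (hU : SmoothNear Model4 U x)
      (hU' : SmoothNear Model4 U' x) (h : U x = U' x) :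
      curvatureOp A U V σ x = curvatureOp A U' V σ x :=
    pointwise_of_smooth_linear (Φ := fun U => curvatureOp A U V σ x)
      (fun hf hU => curvatureOp_smul_left hA hf hU hσ)
      (fun hU hU' => curvatureOp_add_left hA hU hU' hσ) hU hU' h
  have h1 : curvature A x (U x) (V x) (σ x)
      = curvatureOp A (extend Model4 (U x)) (extend Model4 (V x)) (extend Model3 (σ x)) x := by
    simp only [curvature, curvatureOp, extend_apply_self]
  rw [h1, left hσ' hU' hU (extend_apply_self _ _), ← neg_neg (curvatureOp A U _ _ x),
    ← curvatureOp_swap, left hσ' hV' hV (extend_apply_self _ _), ← curvatureOp_swap]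
  exact pointwise_of_smooth_linear (Φ := fun σ => curvatureOp A U V σ x)
    (fun hf hσ => curvatureOp_smul_section hA hf hU hV hσ)
    (fun hσ hσ' => curvatureOp_add_section hA hU hV hσ hσ') hσ' hσ (extend_apply_self _ _)

theorem smoothNear_curvature (hA : CovariantDerivative.ContMDiffCovariantDerivative A ∞)
    (hU : SmoothNear Model4 U x) (hV : SmoothNear Model4 V x) (hσ : SmoothNear Model3 σ x) :
    SmoothNear Model3 (fun y => curvature A y (U y) (V y) (σ y)) x := by
  have hop : SmoothNear Model3 (curvatureOp A U V σ) x := by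
    have hAσ := smoothNear_covariantDerivative hA hσ
    have h1 := (smoothNear_covariantDerivative hA (hAσ.hom_apply hV)).hom_apply hU
    have h2 := (smoothNear_covariantDerivative hA (hAσ.hom_apply hU)).hom_apply hV
    have h3 := hAσ.hom_apply (hU.mlieBracket hV)
    filter_upwards [h1, h2, h3] with y h1 h2 h3
    exact (h1.sub_section h2).sub_section h3
  refine hop.congr ?_
  filter_upwards [hU.eventually, hV.eventually, hσ.eventually] with y hU hV hσ
  exact curvature_eq hA hU hV hσ

theorem curvature_add₁ (hA : CovariantDerivative.ContMDiffCovariantDerivative A ∞)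
    (u u' v : TangentSpace (𝓡 4) x) (s : E x) :
    curvature A x (u + u') v s = curvature A x u v s + curvature A x u' v s := by
  have hu : SmoothNear Model4 (extend Model4 u) x := smoothNear_extend u
  have hu' : SmoothNear Model4 (extend Model4 u') x := smoothNear_extend u'
  have hv : SmoothNear Model4 (extend Model4 v) x := smoothNear_extend v
  have hs : SmoothNear Model3 (extend Model3 s) x := smoothNear_extend s
  have h := curvature_eq hA (hu.add hu') hv hs
  rw [curvatureOp_add_left hA hu hu' hs, ← curvature_eq hA hu hv hs,
    ← curvature_eq hA hu' hv hs] at h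
  simpa only [Pi.add_apply, extend_apply_self] using h

theorem curvature_smul₁ (hA : CovariantDerivative.ContMDiffCovariantDerivative A ∞) (c : ℝ)
    (u v : TangentSpace (𝓡 4) x) (s : E x) :
    curvature A x (c • u) v s = c • curvature A x u v s := by
  have hu : SmoothNear Model4 (extend Model4 u) x := smoothNear_extend u
  have hv : SmoothNear Model4 (extend Model4 v) x := smoothNear_extend v
  have hs : SmoothNear Model3 (extend Model3 s) x := smoothNear_extend s
  have hc : SmoothFunNear (fun _ : M => c) x := Eventually.of_forall fun _ => contMDiffAt_const
  have h := curvature_eq hA (SmoothNear.smul hc hu) hv hs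
  rw [curvatureOp_smul_left hA hc hu hs, ← curvature_eq hA hu hv hs] at h
  simpa only [Pi.smul_apply', extend_apply_self] using h

theorem curvature_swap (u v : TangentSpace (𝓡 4) x) (s : E x) :
    curvature A x v u s = - curvature A x u v s := by
  have h := curvatureOp_swap (A := A) (U := extend Model4 u) (V := extend Model4 v)
    (σ := extend Model3 s) (x := x)
  simp only [curvatureOp, extend_apply_self] at h
  exact h

theorem curvature_add₃ (hA : CovariantDerivative.ContMDiffCovariantDerivative A ∞)
    (u v : TangentSpace (𝓡 4) x) (s s' : E x) :
    curvature A x u v (s + s') = curvature A x u v s + curvature A x u v s' := by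
  have hu : SmoothNear Model4 (extend Model4 u) x := smoothNear_extend u
  have hv : SmoothNear Model4 (extend Model4 v) x := smoothNear_extend v
  have hs : SmoothNear Model3 (extend Model3 s) x := smoothNear_extend s
  have hs' : SmoothNear Model3 (extend Model3 s') x := smoothNear_extend s'
  have h := curvature_eq hA hu hv (hs.add hs')
  rw [curvatureOp_add_section hA hu hv hs hs', ← curvature_eq hA hu hv hs,
    ← curvature_eq hA hu hv hs'] at h
  simpa only [Pi.add_apply, extend_apply_self] using h

theorem curvature_smul₃ (hA : CovariantDerivative.ContMDiffCovariantDerivative A ∞) (c : ℝ)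
    (u v : TangentSpace (𝓡 4) x) (s : E x) :
    curvature A x u v (c • s) = c • curvature A x u v s := by
  have hu : SmoothNear Model4 (extend Model4 u) x := smoothNear_extend u
  have hv : SmoothNear Model4 (extend Model4 v) x := smoothNear_extend v
  have hs : SmoothNear Model3 (extend Model3 s) x := smoothNear_extend s
  have hc : SmoothFunNear (fun _ : M => c) x := Eventually.of_forall fun _ => contMDiffAt_const
  have h := curvature_eq hA hu hv (SmoothNear.smul hc hs)
  rw [curvatureOp_smul_section hA hc hu hv hs, ← curvature_eq hA hu hv hs] at h
  simpa only [Pi.smul_apply', extend_apply_self] using h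

/-- The curvature at `x` as a multilinear map. -/
noncomputable def curvatureTensor (hA : CovariantDerivative.ContMDiffCovariantDerivative A ∞)
    (x : M) : TangentSpace (𝓡 4) x →ₗ[ℝ] TangentSpace (𝓡 4) x →ₗ[ℝ] E x →ₗ[ℝ] E x :=
  LinearMap.mk₂ ℝ
    (fun u v =>
      { toFun := curvature A x u v
        map_add' := curvature_add₃ hA u v
        map_smul' := fun c s => curvature_smul₃ hA c u v s })
    (fun u u' v => LinearMap.ext fun s => curvature_add₁ hA u u' v s)
    (fun c u v => LinearMap.ext fun s => curvature_smul₁ hA c u v s)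
    (fun u v v' => LinearMap.ext fun s => by
      change curvature A x u (v + v') s = curvature A x u v s + curvature A x u v' s
      rw [curvature_swap, curvature_add₁ hA, curvature_swap u v, curvature_swap u v']
      abel)
    (fun c u v => LinearMap.ext fun s => by
      change curvature A x u (c • v) s = c • curvature A x u v s
      rw [curvature_swap, curvature_smul₁ hA, curvature_swap u v, smul_neg, neg_neg])

end CurvatureTensor

section AddOneForm

variable {M : Type*} [TopologicalSpace M] [ChartedSpace Model4 M] [IsManifold (𝓡 4) ∞ M]
  [T2Space M] {E : M → Type*} [TopologicalSpace (TotalSpace Model3 E)]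
  [∀ x, NormedAddCommGroup (E x)] [∀ x, InnerProductSpace ℝ (E x)]
  [FiberBundle Model3 E] [VectorBundle ℝ Model3 E] [ContMDiffVectorBundle ∞ Model3 E (𝓡 4)]
  {A : CovariantDerivative (𝓡 4) Model3 E}
  {a : ∀ x : M, E x →L[ℝ] TangentSpace (𝓡 4) x →L[ℝ] E x}

theorem PureConnection.IsSoOneForm.smoothNear_apply (ha : IsSoOneForm a) {σ : ∀ x : M, E x} {x : M}
    (hσ : SmoothNear Model3 σ x) :
    SmoothNear (V := fun x => TangentSpace (𝓡 4) x →L[ℝ] E x) (Model4 →L[ℝ] Model3)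
      (fun y => a y (σ y)) x := by
  filter_upwards [hσ] with y hy
  exact (ha.smooth y).clm_bundle_apply hy

theorem contMDiff_addOneForm (hA : CovariantDerivative.ContMDiffCovariantDerivative A ∞)
    (ha : IsSoOneForm a) :
    CovariantDerivative.ContMDiffCovariantDerivative (A.addOneForm a) ∞ where
  contMDiff :=
    { contMDiff := fun {σ} hσ => by
        have h1 := hA.contMDiff.contMDiff hσ
        have h2 : ContMDiffOn (𝓡 4) ((𝓡 4).prod 𝓘(ℝ, Model4 →L[ℝ] Model3)) ∞
            (fun y => TotalSpace.mk' (Model4 →L[ℝ] Model3)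
              (E := fun x => TangentSpace (𝓡 4) x →L[ℝ] E x) y (a y (σ y))) univ :=
          ha.smooth.contMDiffOn.clm_bundle_apply hσ
        exact h1.add_section h2 }

/-- The curvature of `A + t a` is `F_A + t d_A a + t² a ∧ a`. -/
theorem curvature_addOneForm (hA : CovariantDerivative.ContMDiffCovariantDerivative A ∞)
    (ha : IsSoOneForm a) (t : ℝ) (x : M) (u v : TangentSpace (𝓡 4) x) (s : E x) :
    curvature (A.addOneForm fun x => t • a x) x u v s =
      curvature A x u v s + t • extCovDeriv A a x u v s
        + t ^ 2 • (a x (a x s v) u - a x (a x s u) v) := by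
  have hu : SmoothNear Model4 (extend Model4 u) x := smoothNear_extend u
  have hv : SmoothNear Model4 (extend Model4 v) x := smoothNear_extend v
  have hs : SmoothNear Model3 (extend Model3 s) x := smoothNear_extend s
  have hAσ := smoothNear_covariantDerivative hA hs
  have haσ := ha.smoothNear_apply hs
  have key {w : TangentSpace (𝓡 4) x} (hw : SmoothNear Model4 (extend Model4 w) x) :
      (A fun y => A (extend Model3 s) y (extend Model4 w y)
        + (t • a y) (extend Model3 s y) (extend Model4 w y)) x
        = A (fun y => A (extend Model3 s) y (extend Model4 w y)) x
          + t • A (fun y => a y (extend Model3 s y) (extend Model4 w y)) x := by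
    have h1 := (hAσ.hom_apply hw).mdiffAt
    have h2 := (haσ.hom_apply hw).mdiffAt
    rw [← A.isCovariantDerivativeOnUniv.smul_const t h2]
    exact A.isCovariantDerivativeOnUniv.add h1 (mdifferentiableAt_const.smul_section h2)
  have app (s' : E x) (w : TangentSpace (𝓡 4) x) : (t • a x) s' w = t • a x s' w := rfl
  have app₁ (T : TangentSpace (𝓡 4) x →L[ℝ] E x) (w : TangentSpace (𝓡 4) x) :
      (t • T) w = t • T w := rfl
  have lin (p q : E x) (w : TangentSpace (𝓡 4) x) :
      a x (p + t • q) w = a x p w + t • a x q w := by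
    rw [(a x).map_add, (a x).map_smul]; rfl
  simp only [curvature, extCovDeriv, CovariantDerivative.addOneForm,
    add_apply, key hu, key hv, extend_apply_self, app, app₁, lin]
  module

end AddOneForm

/-! ### Algebra of 2-forms -/

section Forms

variable {V : Type*}

/-- The wedge product of 2-forms as a bilinear map. -/
noncomputable def wedgeTwoBilin (V : Type*) :
    (V → V → ℝ) →ₗ[ℝ] (V → V → ℝ) →ₗ[ℝ] ((Fin 4 → V) → ℝ) :=
  LinearMap.mk₂ ℝ wedgeTwo
    (fun α α' β => by
      funext v
      simp only [wedgeTwo, Pi.add_apply, add_mul, mul_add, Finset.sum_add_distrib])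
    (fun c α β => by
      funext v
      simp only [wedgeTwo, Pi.smul_apply, smul_eq_mul, Finset.mul_sum]
      exact Finset.sum_congr rfl fun σ _ => by ring)
    (fun α β β' => by
      funext v
      simp only [wedgeTwo, Pi.add_apply, mul_add, Finset.sum_add_distrib])
    (fun c α β => by
      funext v
      simp only [wedgeTwo, Pi.smul_apply, smul_eq_mul, Finset.mul_sum]
      exact Finset.sum_congr rfl fun σ _ => by ring)

theorem wedgeTwoBilin_apply (α β : V → V → ℝ) : wedgeTwoBilin V α β = wedgeTwo α β := rfl

theorem wedgeTwo_comm (α β : V → V → ℝ) : wedgeTwo α β = wedgeTwo β α := by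
  funext v
  simp only [wedgeTwo]
  congr 1
  -- The permutation exchanging the two pairs of arguments is even.
  let τ : Equiv.Perm (Fin 4) := Equiv.swap 0 2 * Equiv.swap 1 3
  refine Fintype.sum_equiv (Equiv.mulRight τ) _ _ fun σ => ?_
  have hs : Equiv.Perm.sign τ = 1 := by decide
  have h0 : τ 0 = 2 := by decide
  have h1 : τ 1 = 3 := by decide
  have h2 : τ 2 = 0 := by decide
  have h3 : τ 3 = 1 := by decide
  simp only [Equiv.coe_mulRight, Equiv.Perm.sign_mul, hs, mul_one, Equiv.Perm.mul_apply, h0, h1,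
    h2, h3]
  ring

variable [AddCommGroup V] [Module ℝ V]

variable (V) in
/-- The space of functions `V → V → ℝ` that are bilinear. -/
def bilinForms : Submodule ℝ (V → V → ℝ) where
  carrier := {α | ∃ B : V →ₗ[ℝ] V →ₗ[ℝ] ℝ, ∀ u v, α u v = B u v}
  add_mem' := by
    rintro α β ⟨A, hA⟩ ⟨B, hB⟩
    exact ⟨A + B, fun u v => by simp [hA, hB]⟩
  zero_mem' := ⟨0, fun u v => by simp⟩
  smul_mem' := by
    rintro c α ⟨A, hA⟩
    exact ⟨c • A, fun u v => by simp [hA]⟩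

/-- The wedge product of bilinear functions is an alternating 4-linear form, hence a multiple of
the determinant. -/
theorem wedgeTwo_eq_det {α β : V → V → ℝ} (hα : α ∈ bilinForms V) (hβ : β ∈ bilinForms V)
    (b : Module.Basis (Fin 4) ℝ V) (v : Fin 4 → V) :
    wedgeTwo α β v = wedgeTwo α β b * b.det v := by
  obtain ⟨A, hA⟩ := hα
  obtain ⟨B, hB⟩ := hβ
  let m : MultilinearMap ℝ (fun _ : Fin 4 => V) ℝ :=
    { toFun := fun w => A (w 0) (w 1) * B (w 2) (w 3)
      map_update_add' := by
        intro inst w i x y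
        obtain rfl : inst = instDecidableEqFin 4 := Subsingleton.elim _ _
        fin_cases i <;> simp <;> ring
      map_update_smul' := by
        intro inst w i c x
        obtain rfl : inst = instDecidableEqFin 4 := Subsingleton.elim _ _
        fin_cases i <;> simp <;> ring }
  let g : V [⋀^Fin 4]→ₗ[ℝ] ℝ := (1 / 4 : ℝ) • MultilinearMap.alternatization m
  have hg : ∀ w, wedgeTwo α β w = g w := by
    intro w
    simp only [wedgeTwo, g, AlternatingMap.smul_apply, MultilinearMap.alternatization_apply,
      smul_eq_mul, hA, hB]
    congr 1
    refine Finset.sum_congr rfl fun σ _ => ?_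
    rw [Units.smul_def, zsmul_eq_mul]
    rfl
  rw [hg, hg, g.eq_smul_basis_det b]
  simp [b.det_self]

end Forms

section SoComp

variable {V : Type*} [NormedAddCommGroup V] [InnerProductSpace ℝ V]

theorem soComp_add (e : OrthonormalBasis (Fin 3) ℝ V) (S T : V → V) (j : Fin 3) :
    soComp e (S + T) j = soComp e S j + soComp e T j := by
  simp only [soComp, Pi.add_apply, inner_add_left, mul_add, Finset.sum_add_distrib]

theorem soComp_smul (e : OrthonormalBasis (Fin 3) ℝ V) (c : ℝ) (T : V → V) (j : Fin 3) :
    soComp e (c • T) j = c * soComp e T j := by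
  simp only [soComp, Pi.smul_apply, inner_smul_left, Finset.mul_sum, conj_trivial]
  exact Finset.sum_congr rfl fun i _ => Finset.sum_congr rfl fun k _ => by ring

/-- The orthogonal matrix expressing one orthonormal basis in another. -/
noncomputable def changeMatrix (e e' : OrthonormalBasis (Fin 3) ℝ V) : Matrix (Fin 3) (Fin 3) ℝ :=
  Matrix.of fun j k => inner ℝ (e k) (e' j)

theorem changeMatrix_sum (e e' : OrthonormalBasis (Fin 3) ℝ V) (j : Fin 3) :
    ∑ k, changeMatrix e e' j k • e k = e' j := e.sum_repr' (e' j)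

theorem changeMatrix_mul_transpose (e e' : OrthonormalBasis (Fin 3) ℝ V) :
    changeMatrix e e' * (changeMatrix e e').transpose = 1 := by
  ext i j
  have h := orthonormal_iff_ite.1 e'.orthonormal i j
  rw [Matrix.one_apply, ← h, Matrix.mul_apply, ← e.sum_inner_mul_inner (e' i) (e' j)]
  simp only [changeMatrix, Matrix.of_apply, Matrix.transpose_apply]
  exact Finset.sum_congr rfl fun k _ => by rw [real_inner_comm]

theorem changeMatrix_transpose_mul (e e' : OrthonormalBasis (Fin 3) ℝ V) :
    (changeMatrix e e').transpose * changeMatrix e e' = 1 :=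
  mul_eq_one_comm.1 (changeMatrix_mul_transpose e e')

theorem changeMatrix_det_mul_self (e e' : OrthonormalBasis (Fin 3) ℝ V) :
    (changeMatrix e e').det * (changeMatrix e e').det = 1 := by
  have := congrArg Matrix.det (changeMatrix_mul_transpose e e')
  rwa [Matrix.det_mul, Matrix.det_transpose, Matrix.det_one] at this

/-- The components of an endomorphism form a pseudovector: they transform by the orthogonal matrix
of the change of basis times its determinant, since the cofactor matrix of an orthogonal matrix `O`
is `det O • O`. -/
theorem soComp_change (e e' : OrthonormalBasis (Fin 3) ℝ V) {T : V → V}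
    (hT : ∃ L : V →ₗ[ℝ] V, ∀ s, T s = L s) (j : Fin 3) :
    soComp e' T j = (changeMatrix e e').det * ∑ k, changeMatrix e e' j k * soComp e T k := by
  obtain ⟨L, hL⟩ := hT
  set O := changeMatrix e e' with hO
  have hadj : O.adjugate = O.det • O.transpose := by
    have h1 : O.adjugate * (O * O.transpose) = O.adjugate := by
      rw [hO, changeMatrix_mul_transpose, Matrix.mul_one]
    rw [← h1, ← Matrix.mul_assoc, Matrix.adjugate_mul, Matrix.smul_mul, Matrix.one_mul]
  have hin (i k : Fin 3) : inner ℝ (T (e' i)) (e' k) =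
      ∑ p, ∑ q, O i p * O k q * inner ℝ (T (e p)) (e q) := by
    rw [← changeMatrix_sum e e' i, ← changeMatrix_sum e e' k, hL, map_sum, sum_inner]
    refine Finset.sum_congr rfl fun p _ => ?_
    rw [inner_sum]
    refine Finset.sum_congr rfl fun q _ => ?_
    rw [map_smul, inner_smul_left, inner_smul_right, hL, conj_trivial, mul_assoc]
  have hc (r : Fin 3) : O.det * O j r = O.adjugate r j := by
    rw [hadj, Matrix.smul_apply, Matrix.transpose_apply, smul_eq_mul]
  have hR : O.det * ∑ k, O j k * soComp e T k = ∑ k, O.adjugate k j * soComp e T k := by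
    rw [Finset.mul_sum]
    exact Finset.sum_congr rfl fun k _ => by rw [← hc, mul_assoc]
  rw [hR]
  obtain ⟨t, ht⟩ : ∃ t : Fin 3 → Fin 3 → ℝ, ∀ p q, inner ℝ (T (e p)) (e q) = t p q :=
    ⟨_, fun _ _ => rfl⟩
  simp only [soComp, hin, ht]
  generalize O = P
  rw [Matrix.adjugate_fin_three]
  fin_cases j <;> simp [Fin.sum_univ_three, eps] <;> ring

/-- A skew endomorphism is determined by its components. -/
theorem inner_eq_sum_soComp (e : OrthonormalBasis (Fin 3) ℝ V) {T : V → V}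
    (hT : ∀ s s', inner ℝ (T s) s' = - inner ℝ s (T s')) (i k : Fin 3) :
    inner ℝ (T (e i)) (e k) = ∑ j, eps i j k * soComp e T j := by
  have h (i k : Fin 3) : inner ℝ (T (e i)) (e k) = - inner ℝ (T (e k)) (e i) := by
    rw [hT, real_inner_comm]
  obtain ⟨t, ht⟩ : ∃ t : Fin 3 → Fin 3 → ℝ, ∀ p q, inner ℝ (T (e p)) (e q) = t p q :=
    ⟨_, fun _ _ => rfl⟩
  simp only [soComp, ht] at h ⊢
  have h00 := h 0 0
  have h11 := h 1 1
  have h22 := h 2 2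
  have h01 := h 0 1
  have h02 := h 0 2
  have h12 := h 1 2
  fin_cases i <;> fin_cases k <;> simp [Fin.sum_univ_three, eps] <;> linarith

/-- The components of a commutator of skew endomorphisms. -/
theorem soComp_commutator (e : OrthonormalBasis (Fin 3) ℝ V) {S T : V → V}
    (hS : ∀ s s', inner ℝ (S s) s' = - inner ℝ s (S s'))
    (hT : ∀ s s', inner ℝ (T s) s' = - inner ℝ s (T s')) (k : Fin 3) :
    soComp e (fun s => S (T s) - T (S s)) k =
      -(1 / 2) * ∑ i, ∑ j, eps i j k * (soComp e S i * soComp e T j - soComp e T i * soComp e S j)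
      := by
  have h (i k : Fin 3) : inner ℝ (S (T (e i)) - T (S (e i))) (e k) =
      ∑ p, (inner ℝ (S (e i)) (e p) * inner ℝ (T (e k)) (e p)
        - inner ℝ (T (e i)) (e p) * inner ℝ (S (e k)) (e p)) := by
    rw [inner_sub_left, hS (T (e i)) (e k), hT (S (e i)) (e k), Finset.sum_sub_distrib,
      ← e.sum_inner_mul_inner (T (e i)), ← e.sum_inner_mul_inner (S (e i))]
    simp only [real_inner_comm _ (S (e k)), real_inner_comm _ (T (e k))]
    ring
  have key : soComp e (fun s => S (T s) - T (S s)) k =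
      (1 / 2) * ∑ i, ∑ m, eps i k m * ∑ p,
        ((∑ j, eps i j p * soComp e S j) * (∑ j, eps m j p * soComp e T j)
          - (∑ j, eps i j p * soComp e T j) * (∑ j, eps m j p * soComp e S j)) := by
    rw [soComp]
    simp only [h, inner_eq_sum_soComp e hS, inner_eq_sum_soComp e hT]
  rw [key]
  generalize soComp e S = x
  generalize soComp e T = y
  fin_cases k <;> simp [Fin.sum_univ_three, eps] <;> ring

end SoComp

/-! ### The second variation of the volume at a point -/

section Variation

attribute [local instance] Matrix.normedAddCommGroup Matrix.normedSpace

variable {Λ : ℝ}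

/-- The derivative of `normRoot Λ` at `G` in the direction `G₁`. -/
noncomputable def rootDeriv (Λ : ℝ) (G G₁ : Matrix (Fin 3) (Fin 3) ℝ) :
    Matrix (Fin 3) (Fin 3) ℝ :=
  fderiv ℝ (normRoot Λ) G G₁

/-- A curve of matrices that is polynomial of degree four. -/
noncomputable def quarticCurve (G : Fin 5 → Matrix (Fin 3) (Fin 3) ℝ) (t : ℝ) :
    Matrix (Fin 3) (Fin 3) ℝ :=
  ∑ k : Fin 5, t ^ (k : ℕ) • G k

theorem quarticCurve_zero (G : Fin 5 → Matrix (Fin 3) (Fin 3) ℝ) : quarticCurve G 0 = G 0 := by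
  simp [quarticCurve, Fin.sum_univ_succ]

theorem contDiff_quarticCurve (G : Fin 5 → Matrix (Fin 3) (Fin 3) ℝ) :
    ContDiff ℝ ∞ (quarticCurve G) :=
  ContDiff.sum fun _ _ => (contDiff_id.pow _).smul contDiff_const

theorem deriv_quarticCurve (G : Fin 5 → Matrix (Fin 3) (Fin 3) ℝ) :
    deriv (quarticCurve G) 0 = G 1 ∧ deriv (deriv (quarticCurve G)) 0 = (2 : ℝ) • G 2 := by
  have h1 (t : ℝ) : HasDerivAt (quarticCurve G) (∑ k : Fin 5, ((k : ℕ) * t ^ ((k : ℕ) - 1)) • G k)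
      t :=
    HasDerivAt.fun_sum fun k _ => (hasDerivAt_pow (k : ℕ) t).smul_const (G k)
  have h2 : HasDerivAt (fun t : ℝ => ∑ k : Fin 5, (((k : ℕ) : ℝ) * t ^ ((k : ℕ) - 1)) • G k)
      (∑ k : Fin 5, (((k : ℕ) : ℝ) * ((((k : ℕ) - 1 : ℕ) : ℝ) * 0 ^ ((k : ℕ) - 1 - 1))) • G k) 0 :=
    HasDerivAt.fun_sum fun k _ => ((hasDerivAt_pow ((k : ℕ) - 1) (0 : ℝ)).const_mul _).smul_const _
  refine ⟨(h1 0).deriv.trans ?_, ?_⟩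
  · simp [Fin.sum_univ_succ]
  · have h3 : deriv (quarticCurve G) = _ := funext fun t => (h1 t).deriv
    refine (congrArg (fun f => deriv f 0) h3).trans (h2.deriv.trans ?_)
    simp [Fin.sum_univ_succ, one_add_one_eq_two]

theorem eventually_quarticCurve_posDef {G : Fin 5 → Matrix (Fin 3) (Fin 3) ℝ} (hG : (G 0).PosDef)
    (hs : ∀ k, (G k).transpose = G k) : ∀ᶠ t in 𝓝 0, (quarticCurve G t).PosDef := by
  have h := (contDiff_quarticCurve G).continuous.tendsto 0
  rw [quarticCurve_zero] at h
  filter_upwards [h.eventually (eventually_posDef hG)] with t ht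
  refine ht ?_
  rw [Matrix.IsHermitian, Matrix.conjTranspose_eq_transpose_of_trivial, quarticCurve,
    Matrix.transpose_sum]
  exact Finset.sum_congr rfl fun k _ => by rw [Matrix.transpose_smul, hs]

theorem contDiffAt_rootVol_quarticCurve {G : Fin 5 → Matrix (Fin 3) (Fin 3) ℝ}
    (hG : (G 0).PosDef) : ContDiffAt ℝ ∞ (fun t => rootVol Λ (quarticCurve G t)) 0 := by
  refine ContDiffAt.comp (g := rootVol Λ) 0 ?_ (contDiff_quarticCurve G).contDiffAt
  rw [quarticCurve_zero]
  exact contDiffAt_rootVol hG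

theorem contDiffAt_normRoot_quarticCurve {G : Fin 5 → Matrix (Fin 3) (Fin 3) ℝ}
    (hG : (G 0).PosDef) : ContDiffAt ℝ ∞ (fun t => normRoot Λ (quarticCurve G t)) 0 := by
  refine ContDiffAt.comp (g := normRoot Λ) 0 ?_ (contDiff_quarticCurve G).contDiffAt
  rw [quarticCurve_zero]
  exact contDiffAt_normRoot hG

theorem hasDerivAt_normRoot_quarticCurve {G : Fin 5 → Matrix (Fin 3) (Fin 3) ℝ}
    (hG : (G 0).PosDef) :
    HasDerivAt (fun t => normRoot Λ (quarticCurve G t)) (rootDeriv Λ (G 0) (G 1)) 0 := by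
  have h1 : HasDerivAt (quarticCurve G) (G 1) 0 := by
    have h := ((contDiff_quarticCurve G).contDiffAt (x := 0)).eventually_hasDerivAt.self_of_nhds
    have h' := (deriv_quarticCurve G).1
    exact h' ▸ h
  have h2 : HasFDerivAt (normRoot Λ) (fderiv ℝ (normRoot Λ) (G 0)) (quarticCurve G 0) := by
    rw [quarticCurve_zero]
    exact ((contDiffAt_normRoot hG).differentiableAt (by simp)).hasFDerivAt
  exact h2.comp_hasDerivAt 0 h1

/-- First and second variation of `rootVol Λ` and `normRoot Λ` along a curve, obtained by
differentiating `G = m W²`, `tr W = Λ` twice. -/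
theorem variation_quarticCurve (hΛ : Λ ≠ 0) {G : Fin 5 → Matrix (Fin 3) (Fin 3) ℝ}
    (hG : (G 0).PosDef) (hs : ∀ k, (G k).transpose = G k) :
    (rootDeriv Λ (G 0) (G 1)).trace = 0 ∧
    (∃ c : ℝ, G 1 = rootVol Λ (G 0) • (normRoot Λ (G 0) * rootDeriv Λ (G 0) (G 1)
        + rootDeriv Λ (G 0) (G 1) * normRoot Λ (G 0))
      + c • (normRoot Λ (G 0) * normRoot Λ (G 0))) ∧
    Λ / 2 * deriv (deriv fun t => rootVol Λ (quarticCurve G t)) 0 =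
      ((normRoot Λ (G 0))⁻¹ * G 2).trace - rootVol Λ (G 0) * ((normRoot Λ (G 0))⁻¹ *
        (rootDeriv Λ (G 0) (G 1) * rootDeriv Λ (G 0) (G 1))).trace := by
  have hm := contDiffAt_rootVol_quarticCurve (Λ := Λ) hG
  have hW := contDiffAt_normRoot_quarticCurve (Λ := Λ) hG
  have hpd := eventually_quarticCurve_posDef hG hs
  have hGm : ∀ᶠ t in 𝓝 0, quarticCurve G t = rootVol Λ (quarticCurve G t) •
      (normRoot Λ (quarticCurve G t) * normRoot Λ (quarticCurve G t)) :=
    hpd.mono fun t ht => (rootVol_smul_normRoot_mul_self hΛ ht).symm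
  have htr : ∀ᶠ t in 𝓝 0, (normRoot Λ (quarticCurve G t)).trace = Λ :=
    hpd.mono fun t ht => trace_normRoot ht
  have hX : (normRoot Λ (G 0))⁻¹ * normRoot Λ (quarticCurve G 0) = 1 := by
    rw [quarticCurve_zero]
    exact Matrix.nonsing_inv_mul _ (isUnit_iff_ne_zero.2 (det_normRoot_ne_zero hΛ hG))
  have hd : deriv (fun t => normRoot Λ (quarticCurve G t)) 0 = rootDeriv Λ (G 0) (G 1) :=
    (hasDerivAt_normRoot_quarticCurve hG).deriv
  have h1 := derivs_smul_mul_self hm hW hGm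
  have h2 := trace_inv_mul_deriv_deriv hm hW hGm htr hX
  have e1 := (deriv_quarticCurve G).1
  have e2 := (deriv_quarticCurve G).2
  have h11 := e1.symm.trans h1.1
  have h20 := (congrArg Matrix.trace hd).symm.trans h2.1
  refine ⟨h20, ⟨deriv (fun t => rootVol Λ (quarticCurve G t)) 0, ?_⟩, ?_⟩
  · rw [quarticCurve_zero, hd] at h11
    exact h11
  · have h22 := h2.2
    rw [quarticCurve_zero, hd] at h22
    have h3 : ((normRoot Λ (G 0))⁻¹ * deriv (deriv (quarticCurve G)) 0).trace =
        2 * ((normRoot Λ (G 0))⁻¹ * G 2).trace := by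
      refine (congrArg (fun B => ((normRoot Λ (G 0))⁻¹ * B).trace) e2).trans ?_
      rw [Matrix.mul_smul, Matrix.trace_smul, smul_eq_mul]
    have h4 := h3.symm.trans h22
    linarith

theorem rootDeriv_transpose {G G₁ : Matrix (Fin 3) (Fin 3) ℝ} (hG : G.PosDef) :
    (rootDeriv Λ G G₁).transpose = rootDeriv Λ G G₁ := by
  have h := hasDerivAt_normRoot_quarticCurve (Λ := Λ) (G := ![G, G₁, 0, 0, 0]) hG
  have h2 := (LinearMap.toContinuousLinearMap (Matrix.transposeLinearEquiv (Fin 3) (Fin 3) ℝ ℝ :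
    Matrix (Fin 3) (Fin 3) ℝ →ₗ[ℝ] Matrix (Fin 3) (Fin 3) ℝ)).hasFDerivAt.comp_hasDerivAt 0 h
  refine (h2.congr_of_eventuallyEq (Eventually.of_forall fun t => ?_)).unique h
  exact (normRoot_transpose _).symm

theorem quarticCurve_conj (O : Matrix (Fin 3) (Fin 3) ℝ) (G : Fin 5 → Matrix (Fin 3) (Fin 3) ℝ)
    (t : ℝ) : quarticCurve (fun k => O * G k * O.transpose) t =
      O * quarticCurve G t * O.transpose := by
  simp only [quarticCurve, Finset.mul_sum, Finset.sum_mul, Matrix.mul_smul, Matrix.smul_mul]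

theorem quarticCurve_smul (c : ℝ) (G : Fin 5 → Matrix (Fin 3) (Fin 3) ℝ)
    (t : ℝ) : quarticCurve (fun k => c • G k) t = c • quarticCurve G t := by
  simp only [quarticCurve, Finset.smul_sum, smul_comm c]

/-- The derivative of the normalised root commutes with orthogonal changes of frame. -/
theorem rootDeriv_conj {G G₁ O : Matrix (Fin 3) (Fin 3) ℝ} (hG : G.PosDef)
    (hG₁ : G₁.transpose = G₁) (hO : O.transpose * O = 1) :
    rootDeriv Λ (O * G * O.transpose) (O * G₁ * O.transpose) =
      O * rootDeriv Λ G G₁ * O.transpose := by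
  let g : Fin 5 → Matrix (Fin 3) (Fin 3) ℝ := ![G, G₁, 0, 0, 0]
  have hg : ∀ᶠ t in 𝓝 0, (quarticCurve g t).PosDef := by
    refine eventually_quarticCurve_posDef hG fun k => ?_
    have := hG.1
    rw [Matrix.IsHermitian, Matrix.conjTranspose_eq_transpose_of_trivial] at this
    fin_cases k <;> simp [g, hG₁, this]
  have h := hasDerivAt_normRoot_quarticCurve (Λ := Λ) (G := g) hG
  have h' := hasDerivAt_normRoot_quarticCurve (Λ := Λ) (G := fun k => O * g k * O.transpose)
    (posDef_conj hG hO)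
  have h2 := (((matMul (Fin 3)).flip O.transpose).comp
    (matMul (Fin 3) O)).hasFDerivAt.comp_hasDerivAt 0 h
  refine h'.unique (h2.congr_of_eventuallyEq ?_)
  filter_upwards [hg] with t ht
  rw [quarticCurve_conj, normRoot_conj ht hO]
  rfl

/-- The normalised root is homogeneous of degree zero, so that its derivative does not depend on the
scale, that is, on the basis in which the 4-forms `F^i ∧ F^j` are evaluated. -/
theorem rootDeriv_smul {G G₁ : Matrix (Fin 3) (Fin 3) ℝ} (hG : G.PosDef)
    (hG₁ : G₁.transpose = G₁) {c : ℝ} (hc : 0 < c) :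
    rootDeriv Λ (c • G) (c • G₁) = rootDeriv Λ G G₁ := by
  let g : Fin 5 → Matrix (Fin 3) (Fin 3) ℝ := ![G, G₁, 0, 0, 0]
  have hg : ∀ᶠ t in 𝓝 0, (quarticCurve g t).PosDef := by
    refine eventually_quarticCurve_posDef hG fun k => ?_
    have := hG.1
    rw [Matrix.IsHermitian, Matrix.conjTranspose_eq_transpose_of_trivial] at this
    fin_cases k <;> simp [g, hG₁, this]
  have h := hasDerivAt_normRoot_quarticCurve (Λ := Λ) (G := g) hG
  have h' := hasDerivAt_normRoot_quarticCurve (Λ := Λ) (G := fun k => c • g k) (hG.smul hc)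
  refine h'.unique (h.congr_of_eventuallyEq ?_)
  filter_upwards [hg] with t ht
  rw [quarticCurve_smul, normRoot_smul ht hc]

end Variation

section SymTraceFree

theorem symTraceFree_sub (B C : Matrix (Fin 3) (Fin 3) ℝ) :
    symTraceFree (B - C) = symTraceFree B - symTraceFree C := by
  simp only [symTraceFree, Matrix.transpose_sub, Matrix.trace_sub, sub_div]
  module

/-- If the trace-free symmetric part of `X δ` vanishes, where `X` is definite and `δ` is symmetric
and trace-free, then `X δ + δ X` is scalar, so that `tr (δ X δ) = 0` and `δ = 0`. -/
theorem eq_zero_of_symTraceFree_mul {P δ : Matrix (Fin 3) (Fin 3) ℝ} (hP : P.PosDef) {r : ℝ}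
    (hr : r ≠ 0) (hδ : δ.transpose = δ) (htr : δ.trace = 0)
    (h : symTraceFree ((r • P) * δ) = 0) : δ = 0 := by
  have hPt : P.transpose = P := by
    rw [← Matrix.conjTranspose_eq_transpose_of_trivial]; exact hP.1
  set s := ((r • P) * δ).trace with hs
  have h1 : r • (P * δ + δ * P) = (2 * s / 3) • (1 : Matrix (Fin 3) (Fin 3) ℝ) := by
    have h2 : (2 : ℝ) • symTraceFree ((r • P) * δ) = 0 := by rw [h, smul_zero]
    rw [symTraceFree, Matrix.transpose_mul, Matrix.transpose_smul, hPt, hδ, ← hs,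
      Matrix.mul_smul, Matrix.smul_mul, smul_sub, smul_smul, smul_smul, sub_eq_zero] at h2
    rw [smul_add]
    norm_num at h2
    rw [h2]
    congr 1
    ring
  have h3 : (δ.transpose * P * δ).trace = 0 := by
    have h4 := congrArg (fun B => (B * δ).trace) h1
    simp only [Matrix.smul_mul, Matrix.one_mul, Matrix.trace_smul, htr, smul_zero, Matrix.add_mul,
      Matrix.trace_add] at h4
    rw [Matrix.mul_assoc P, Matrix.trace_mul_comm P] at h4
    rw [hδ]
    have : (δ * δ * P).trace = (δ * P * δ).trace := by
      rw [Matrix.mul_assoc, Matrix.trace_mul_comm]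
    rw [this, smul_eq_mul] at h4
    rcases mul_eq_zero.1 h4 with h5 | h5
    · exact absurd h5 hr
    · linarith
  have hps : (δ.conjTranspose * P * δ).PosSemidef := hP.posSemidef.conjTranspose_mul_mul_same δ
  rw [Matrix.conjTranspose_eq_transpose_of_trivial] at hps
  have h0 := hps.trace_eq_zero_iff.1 h3
  ext i j
  by_contra hne
  have hv : δ.mulVec (Pi.single j 1) ≠ 0 := by
    intro h
    refine hne ?_
    have := congrFun h i
    simpa using this
  have h6 := hP.dotProduct_mulVec_pos hv
  have h7 := congrArg (fun B => (Pi.single j (1 : ℝ)) ⬝ᵥ B.mulVec (Pi.single j 1)) h0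
  simp only [Matrix.zero_mulVec, dotProduct_zero] at h7
  rw [← Matrix.mulVec_mulVec, ← Matrix.mulVec_mulVec, Matrix.dotProduct_mulVec,
    Matrix.vecMul_transpose] at h7
  rw [star_trivial, h7] at h6
  exact h6.false

/-- The first variation equation `W Nᵀ + N W = φ W + W φ + c W²`, multiplied by `X = W⁻¹` from both
sides. -/
theorem mul_add_transpose_eq {W X N φ : Matrix (Fin 3) (Fin 3) ℝ} (hW : W.transpose = W)
    (hφ : φ.transpose = φ) (hX : X * W = 1) {c : ℝ}
    (h : W * N.transpose + N * W = W * φ + φ * W + c • (W * W)) :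
    X * N + (X * N).transpose = X * φ + (X * φ).transpose + c • 1 := by
  have hX' : W * X = 1 := mul_eq_one_comm.1 hX
  have hXt : X.transpose = X := by
    have h1 : X.transpose * W = 1 := by
      have := congrArg Matrix.transpose hX'
      rwa [Matrix.transpose_mul, hW, Matrix.transpose_one] at this
    calc X.transpose = X.transpose * (W * X) := by rw [hX', Matrix.mul_one]
      _ = X := by rw [← Matrix.mul_assoc, h1, Matrix.one_mul]
  have h2 := congrArg (fun B => X * B * X) h
  simp only [Matrix.mul_add, Matrix.add_mul, Matrix.mul_smul, Matrix.smul_mul] at h2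
  have e1 (B : Matrix (Fin 3) (Fin 3) ℝ) : X * (W * B) * X = B * X := by
    rw [← Matrix.mul_assoc, hX, Matrix.one_mul]
  have e2 (B : Matrix (Fin 3) (Fin 3) ℝ) : X * (B * W) * X = X * B := by
    rw [Matrix.mul_assoc, Matrix.mul_assoc, hX', Matrix.mul_one]
  rw [e1, e1, e1, e2, e2, hX'] at h2
  rw [Matrix.transpose_mul, Matrix.transpose_mul, hXt, hφ, add_comm, h2]
  abel

theorem symTraceFree_eq_of_add_transpose {B C : Matrix (Fin 3) (Fin 3) ℝ} {c : ℝ}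
    (h : B + B.transpose = C + C.transpose + c • 1) : symTraceFree B = symTraceFree C := by
  have ht := congrArg Matrix.trace h
  simp only [Matrix.trace_add, Matrix.trace_transpose, Matrix.trace_smul, Matrix.trace_one,
    Fintype.card_fin, smul_eq_mul, Nat.cast_ofNat] at ht
  have h2 : B.trace / 3 = C.trace / 3 + c / 2 := by linarith
  rw [symTraceFree, symTraceFree, h, h2]
  module

/-- Multiplying with `φ` and taking traces. -/
theorem trace_transpose_mul_mul {X N φ : Matrix (Fin 3) (Fin 3) ℝ} (hX : X.transpose = X)
    (hφ : φ.transpose = φ) (htr : φ.trace = 0) {c : ℝ}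
    (h : X * N + (X * N).transpose = X * φ + (X * φ).transpose + c • 1) :
    (N.transpose * X * φ).trace = (X * (φ * φ)).trace := by
  have h2 := congrArg (fun B => (B * φ).trace) h
  simp only [Matrix.add_mul, Matrix.trace_add, Matrix.smul_mul, Matrix.one_mul, Matrix.trace_smul,
    htr, smul_zero, add_zero, Matrix.transpose_mul, hX, hφ] at h2
  have e1 : (X * N * φ).trace = (N.transpose * X * φ).trace := by
    rw [← Matrix.trace_transpose, Matrix.transpose_mul, Matrix.transpose_mul, hX, hφ,
      Matrix.trace_mul_comm]
  have e2 : (φ * X * φ).trace = (X * (φ * φ)).trace := by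
    rw [Matrix.mul_assoc, Matrix.trace_mul_comm, Matrix.mul_assoc]
  rw [e1, e2, Matrix.mul_assoc X] at h2
  linarith

end SymTraceFree

/-! ### The second variation in terms of 2-forms -/

section Gram

variable {V : Type*}

/-- The matrix `(F^i ∧ D^j)(v)`. -/
noncomputable def gram (F D : Fin 3 → V → V → ℝ) (v : Fin 4 → V) : Matrix (Fin 3) (Fin 3) ℝ :=
  Matrix.of fun i j => wedgeTwo (F i) (D j) v

theorem gram_transpose (F D : Fin 3 → V → V → ℝ) (v : Fin 4 → V) :
    (gram F D v).transpose = gram D F v := by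
  ext i j
  simp only [gram, Matrix.transpose_apply, Matrix.of_apply, wedgeTwo_comm (F j)]

theorem gram_matrix_left (B : Matrix (Fin 3) (Fin 3) ℝ) (F D : Fin 3 → V → V → ℝ)
    (v : Fin 4 → V) : gram (fun i => ∑ j, B i j • F j) D v = B * gram F D v := by
  ext i j
  simp only [gram, Matrix.mul_apply, Matrix.of_apply, ← wedgeTwoBilin_apply, map_sum, map_smul,
    LinearMap.sum_apply, LinearMap.smul_apply, Finset.sum_apply, Pi.smul_apply, smul_eq_mul]

theorem gram_matrix_right (B : Matrix (Fin 3) (Fin 3) ℝ) (F D : Fin 3 → V → V → ℝ)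
    (v : Fin 4 → V) :
    gram F (fun i => ∑ j, B i j • D j) v = gram F D v * B.transpose := by
  rw [← gram_transpose, gram_matrix_left, Matrix.transpose_mul, gram_transpose]

theorem gram_sub_left (F F' D : Fin 3 → V → V → ℝ) (v : Fin 4 → V) :
    gram (F - F') D v = gram F D v - gram F' D v := by
  ext i j
  simp only [gram, Matrix.of_apply, Matrix.sub_apply, ← wedgeTwoBilin_apply, Pi.sub_apply, map_sub,
    LinearMap.sub_apply]

theorem gram_sub_right (F D D' : Fin 3 → V → V → ℝ) (v : Fin 4 → V) :
    gram F (D - D') v = gram F D v - gram F D' v := by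
  rw [← gram_transpose, gram_sub_left, Matrix.transpose_sub, gram_transpose, gram_transpose]

/-- The coefficients of the Gram matrix of the 2-forms `F^i + t D^i + t² B^i`. -/
noncomputable def pathGram (F D B : Fin 3 → V → V → ℝ) (v : Fin 4 → V) :
    Fin 5 → Matrix (Fin 3) (Fin 3) ℝ :=
  ![gram F F v, gram F D v + gram D F v, gram D D v + (gram F B v + gram B F v),
    gram D B v + gram B D v, gram B B v]

theorem pathGram_transpose (F D B : Fin 3 → V → V → ℝ) (v : Fin 4 → V) (k : Fin 5) :
    (pathGram F D B v k).transpose = pathGram F D B v k := by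
  fin_cases k <;>
    simp [pathGram, gram_transpose, add_comm (gram F D v), add_comm (gram F B v),
      add_comm (gram D B v)]

theorem gram_path (F D B : Fin 3 → V → V → ℝ) (v : Fin 4 → V) (t : ℝ) :
    gram (F + t • D + t ^ 2 • B) (F + t • D + t ^ 2 • B) v = quarticCurve (pathGram F D B v) t := by
  ext i j
  simp [gram, ← wedgeTwoBilin_apply, quarticCurve, Fin.sum_univ_succ, pathGram]
  ring

/-- The second variation of the volume at a point: `φ` is the derivative of the normalised square
root of the Gram matrix, `N` is the matrix of the self-dual parts of the `D^i`. -/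
theorem variation_pathGram {Λ : ℝ} (hΛ : Λ ≠ 0) {F D B : Fin 3 → V → V → ℝ} {v : Fin 4 → V}
    (hG : (gram F F v).PosDef) {X φ N : Matrix (Fin 3) (Fin 3) ℝ} {S : Fin 3 → V → V → ℝ}
    (hX : X = (normRoot Λ (gram F F v))⁻¹) (hS : S = fun i => ∑ j, X i j • F j)
    (hN : N = (rootVol Λ (gram F F v))⁻¹ • gram D S v)
    (hφ : φ = rootDeriv Λ (gram F F v) (gram F D v + gram D F v)) :
    gram S S v = rootVol Λ (gram F F v) • 1 ∧ φ.trace = 0 ∧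
    symTraceFree (X * N) = symTraceFree (X * φ) ∧
    Λ / 2 * deriv (deriv fun t => rootVol Λ (quarticCurve (pathGram F D B v) t)) 0 =
      (X * gram (D - fun i => ∑ k, φ i k • S k) (D - fun i => ∑ k, φ i k • S k) v).trace
        + 2 * (gram B S v).trace := by
  have hm := (rootVol_pos hΛ hG).ne'
  have hu : IsUnit (normRoot Λ (gram F F v)).det :=
    isUnit_iff_ne_zero.2 (det_normRoot_ne_zero hΛ hG)
  have hWt := normRoot_transpose (Λ := Λ) (gram F F v)
  have hWW := rootVol_smul_normRoot_mul_self hΛ hG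
  have hXW : X * normRoot Λ (gram F F v) = 1 := by rw [hX, Matrix.nonsing_inv_mul _ hu]
  have hWX := mul_eq_one_comm.1 hXW
  have hXt : X.transpose = X := by rw [hX, Matrix.transpose_nonsing_inv, hWt]
  have hφt : φ.transpose = φ := by rw [hφ, rootDeriv_transpose hG]
  have hvar := variation_quarticCurve hΛ (G := pathGram F D B v) hG (pathGram_transpose F D B v)
  change (rootDeriv Λ (gram F F v) (gram F D v + gram D F v)).trace = 0 ∧
    (∃ c : ℝ, gram F D v + gram D F v = rootVol Λ (gram F F v) •
      (normRoot Λ (gram F F v) * rootDeriv Λ (gram F F v) (gram F D v + gram D F v)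
        + rootDeriv Λ (gram F F v) (gram F D v + gram D F v) * normRoot Λ (gram F F v))
      + c • (normRoot Λ (gram F F v) * normRoot Λ (gram F F v))) ∧
    Λ / 2 * deriv (deriv fun t => rootVol Λ (quarticCurve (pathGram F D B v) t)) 0 =
      ((normRoot Λ (gram F F v))⁻¹ * (gram D D v + (gram F B v + gram B F v))).trace
      - rootVol Λ (gram F F v) * ((normRoot Λ (gram F F v))⁻¹ *
        (rootDeriv Λ (gram F F v) (gram F D v + gram D F v) *
          rootDeriv Λ (gram F F v) (gram F D v + gram D F v))).trace at hvar
  rw [← hφ, ← hX] at hvar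
  set m := rootVol Λ (gram F F v) with hmdef
  set W := normRoot Λ (gram F F v) with hWdef
  obtain ⟨h1, ⟨c, h2⟩, h3⟩ := hvar
  have hSS : gram S S v = m • 1 := by
    rw [hS, gram_matrix_left, gram_matrix_right, hXt, ← hWW, Matrix.smul_mul, Matrix.mul_smul,
      ← Matrix.mul_assoc, ← Matrix.mul_assoc, hXW, Matrix.one_mul, hWX]
  have hDS : gram D S v = m • N := by rw [hN, smul_smul, mul_inv_cancel₀ hm, one_smul]
  have hDF : gram D F v = m • (N * W) := by
    have : gram D F v * X = m • N := by
      rw [← hDS, hS, gram_matrix_right, hXt]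
    rw [← Matrix.smul_mul, ← this, Matrix.mul_assoc, hXW, Matrix.mul_one]
  have hFD : gram F D v = m • (W * N.transpose) := by
    rw [← gram_transpose, hDF, Matrix.transpose_smul, Matrix.transpose_mul, hWt]
  -- The first variation equation, divided by `m`.
  have key : X * N + (X * N).transpose = X * φ + (X * φ).transpose + (m⁻¹ * c) • 1 := by
    refine mul_add_transpose_eq hWt hφt hXW ?_
    have h4 := congrArg (fun Q => m⁻¹ • Q) h2
    simp only [hDF, hFD, smul_add, smul_smul, inv_mul_cancel₀ hm, one_smul] at h4
    exact h4
  refine ⟨hSS, h1, symTraceFree_eq_of_add_transpose key, ?_⟩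
  have htr := trace_transpose_mul_mul hXt hφt h1 key
  rw [h3, gram_sub_left, gram_sub_right, gram_sub_right, gram_matrix_left, gram_matrix_left,
    gram_matrix_right, gram_matrix_right, hSS, hφt, hDS, ← gram_transpose D S, hDS]
  have e1 : (X * gram F B v).trace = (gram B S v).trace := by
    rw [← Matrix.trace_transpose (gram B S v), gram_transpose, hS, gram_matrix_left]
  have e2 : (X * gram B F v).trace = (gram B S v).trace := by
    rw [hS, gram_matrix_right, hXt, Matrix.trace_mul_comm]
  have e3 : (X * (N * φ)).trace = (N.transpose * X * φ).trace := by
    rw [← Matrix.trace_transpose, Matrix.transpose_mul, Matrix.transpose_mul, hXt, hφt,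
      Matrix.mul_assoc, Matrix.trace_mul_comm]
  have e4 : (X * (φ * N.transpose)).trace = (N.transpose * X * φ).trace := by
    rw [← Matrix.mul_assoc, Matrix.trace_mul_comm, ← Matrix.mul_assoc]
  simp only [Matrix.mul_add, Matrix.mul_sub, Matrix.trace_add, Matrix.trace_sub, Matrix.mul_smul,
    Matrix.smul_mul, Matrix.trace_smul, Matrix.transpose_smul, Matrix.one_mul,
    smul_eq_mul, e1, e2, e3, e4, htr]
  ring

end Gram

/-! ### Components in an orthonormal frame -/

section Components

variable {M : Type*} [TopologicalSpace M] [ChartedSpace Model4 M] [IsManifold (𝓡 4) ∞ M]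
  [T2Space M] {E : M → Type*} [TopologicalSpace (TotalSpace Model3 E)]
  [∀ x, NormedAddCommGroup (E x)] [∀ x, InnerProductSpace ℝ (E x)]
  [FiberBundle Model3 E] [VectorBundle ℝ Model3 E] [ContMDiffVectorBundle ∞ Model3 E (𝓡 4)]
  {A : CovariantDerivative (𝓡 4) Model3 E}
  {a : ∀ x : M, E x →L[ℝ] TangentSpace (𝓡 4) x →L[ℝ] E x}
  {x : M} (e e' : OrthonormalBasis (Fin 3) ℝ (E x))

/-- The components of the 2-form `[a(u), a(v)]`, the part of the curvature of `A + a` that is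
quadratic in `a`. -/
noncomputable def bracketComp (e : OrthonormalBasis (Fin 3) ℝ (E x))
    (a : ∀ x : M, E x →L[ℝ] TangentSpace (𝓡 4) x →L[ℝ] E x) (k : Fin 3) :
    TangentSpace (𝓡 4) x → TangentSpace (𝓡 4) x → ℝ :=
  fun u v => soComp e (fun s => a x (a x s v) u - a x (a x s u) v) k

/-- The quadratic part of the curvature accounts for the term `-ε_ijk a^i ∧ a^j ∧ Σ_k` of the
integrand. -/
theorem bracketComp_eq (ha : IsSoOneForm a) (k : Fin 3) :
    bracketComp e a k =
      -(1 / 2 : ℝ) • ∑ i, ∑ j, eps i j k • wedgeOne (formComp e a i) (formComp e a j) := by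
  funext u v
  have h := soComp_commutator e (S := fun s => a x s u) (T := fun s => a x s v)
    (fun s s' => ha.skew x u s s') (fun s s' => ha.skew x v s s') k
  rw [bracketComp, h]
  simp only [Pi.smul_apply, Finset.sum_apply, smul_eq_mul, wedgeOne, formComp]

theorem curvComp_addOneForm (hA : CovariantDerivative.ContMDiffCovariantDerivative A ∞)
    (ha : IsSoOneForm a) (t : ℝ) :
    curvComp (A.addOneForm fun x => t • a x) e =
      curvComp A e + t • extCovDerivComp A e a + t ^ 2 • bracketComp e a := by
  funext i u v
  have h : curvature (A.addOneForm fun x => t • a x) x u v = curvature A x u v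
      + t • extCovDeriv A a x u v + t ^ 2 • fun s => a x (a x s v) u - a x (a x s u) v :=
    funext fun s => curvature_addOneForm hA ha t x u v s
  simp only [curvComp, h, soComp_add, soComp_smul]
  rfl

/-- Expresses `d_A a` through two curvatures and a bracket. Its bilinearity, its smoothness and its
behaviour under a change of frame follow from those of curvatures. -/
theorem extCovDerivComp_eq (hA : CovariantDerivative.ContMDiffCovariantDerivative A ∞)
    (ha : IsSoOneForm a) :
    extCovDerivComp A e a = curvComp (A.addOneForm a) e - curvComp A e - bracketComp e a := by
  have h := curvComp_addOneForm e hA ha 1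
  simp only [one_smul, one_pow] at h
  rw [h]
  abel

/-- The components of linear families of linear endomorphisms are bilinear. -/
theorem soComp_mem_bilinForms {V W : Type*} [AddCommGroup W] [Module ℝ W]
    [NormedAddCommGroup V] [InnerProductSpace ℝ V] (e : OrthonormalBasis (Fin 3) ℝ V)
    (T : W →ₗ[ℝ] W →ₗ[ℝ] V →ₗ[ℝ] V) (i : Fin 3) :
    (fun u v => soComp e (T u v) i) ∈ bilinForms W := by
  refine ⟨LinearMap.mk₂ ℝ (fun u v => soComp e (T u v) i) ?_ ?_ ?_ ?_, fun u v => rfl⟩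
  · intro u u' v
    rw [← soComp_add, map_add]; rfl
  · intro c u v
    rw [smul_eq_mul, ← soComp_smul, map_smul]; rfl
  · intro u v v'
    rw [← soComp_add, map_add]; rfl
  · intro c u v
    rw [smul_eq_mul, ← soComp_smul, map_smul]; rfl

theorem curvComp_mem_bilinForms (hA : CovariantDerivative.ContMDiffCovariantDerivative A ∞)
    (i : Fin 3) : curvComp A e i ∈ bilinForms (TangentSpace (𝓡 4) x) :=
  soComp_mem_bilinForms e (curvatureTensor hA x) i

theorem wedgeOne_mem_bilinForms (i j : Fin 3) :
    wedgeOne (formComp e a i) (formComp e a j) ∈ bilinForms (TangentSpace (𝓡 4) x) := by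
  have hadd (i : Fin 3) (u u' : TangentSpace (𝓡 4) x) :
      formComp e a i (u + u') = formComp e a i u + formComp e a i u' := by
    simp only [formComp, ← soComp_add]
    congr 1
    funext s
    exact map_add _ _ _
  have hsmul (i : Fin 3) (c : ℝ) (u : TangentSpace (𝓡 4) x) :
      formComp e a i (c • u) = c * formComp e a i u := by
    simp only [formComp, ← soComp_smul]
    congr 1
    funext s
    exact map_smul _ _ _
  refine ⟨LinearMap.mk₂ ℝ (wedgeOne (formComp e a i) (formComp e a j)) ?_ ?_ ?_ ?_,
    fun u v => rfl⟩ <;> intros <;> simp only [wedgeOne, hadd, hsmul, smul_eq_mul] <;> ring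

theorem bracketComp_mem_bilinForms (ha : IsSoOneForm a) (k : Fin 3) :
    bracketComp e a k ∈ bilinForms (TangentSpace (𝓡 4) x) := by
  rw [bracketComp_eq e ha]
  exact Submodule.smul_mem _ _ (Submodule.sum_mem _ fun i _ => Submodule.sum_mem _ fun j _ =>
    Submodule.smul_mem _ _ (wedgeOne_mem_bilinForms e i j))

theorem extCovDerivComp_mem_bilinForms
    (hA : CovariantDerivative.ContMDiffCovariantDerivative A ∞) (ha : IsSoOneForm a) (i : Fin 3) :
    extCovDerivComp A e a i ∈ bilinForms (TangentSpace (𝓡 4) x) := by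
  rw [extCovDerivComp_eq e hA ha]
  exact Submodule.sub_mem _ (Submodule.sub_mem _
    (curvComp_mem_bilinForms e (contMDiff_addOneForm hA ha) i) (curvComp_mem_bilinForms e hA i))
    (bracketComp_mem_bilinForms e ha i)

/-- The matrix by which components change: an orthogonal matrix times its determinant. -/
noncomputable def compMatrix {V : Type*} [NormedAddCommGroup V] [InnerProductSpace ℝ V]
    (e e' : OrthonormalBasis (Fin 3) ℝ V) : Matrix (Fin 3) (Fin 3) ℝ :=
  (changeMatrix e e').det • changeMatrix e e'

theorem compMatrix_conj {V : Type*} [NormedAddCommGroup V] [InnerProductSpace ℝ V]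
    (e e' : OrthonormalBasis (Fin 3) ℝ V) (G : Matrix (Fin 3) (Fin 3) ℝ) :
    compMatrix e e' * G * (compMatrix e e').transpose =
      changeMatrix e e' * G * (changeMatrix e e').transpose := by
  simp only [compMatrix, Matrix.transpose_smul, Matrix.smul_mul, Matrix.mul_smul, smul_smul,
    changeMatrix_det_mul_self, one_smul]

/-- The components in two frames differ by an orthogonal matrix times its determinant. The
determinant drops out of all expressions that are quadratic in the components. -/
theorem curvComp_change (hA : CovariantDerivative.ContMDiffCovariantDerivative A ∞) :
    curvComp A e' = fun j => ∑ k, compMatrix e e' j k • curvComp A e k := by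
  funext j u v
  rw [curvComp, soComp_change e e' (T := curvature A x u v)
    ⟨curvatureTensor hA x u v, fun s => rfl⟩]
  simp only [Finset.sum_apply, Pi.smul_apply, compMatrix, Matrix.smul_apply, smul_eq_mul,
    Finset.mul_sum, mul_assoc]
  rfl

theorem bracketComp_change : bracketComp e' a = fun j => ∑ k, compMatrix e e' j k •
    bracketComp e a k := by
  funext j u v
  let L (w : TangentSpace (𝓡 4) x) : E x →ₗ[ℝ] E x :=
    { toFun := fun s => a x s w
      map_add' := fun s s' => by rw [(a x).map_add]; rfl
      map_smul' := fun c s => by rw [(a x).map_smul]; rfl }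
  have hL : ∃ L : E x →ₗ[ℝ] E x, ∀ s, a x (a x s v) u - a x (a x s u) v = L s :=
    ⟨L u ∘ₗ L v - L v ∘ₗ L u, fun s => rfl⟩
  rw [bracketComp, soComp_change e e' hL]
  simp only [Finset.sum_apply, Pi.smul_apply, compMatrix, Matrix.smul_apply, smul_eq_mul,
    Finset.mul_sum, mul_assoc]
  rfl

theorem extCovDerivComp_change (hA : CovariantDerivative.ContMDiffCovariantDerivative A ∞)
    (ha : IsSoOneForm a) :
    extCovDerivComp A e' a = fun j => ∑ k, compMatrix e e' j k • extCovDerivComp A e a k := by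
  rw [extCovDerivComp_eq e hA ha, extCovDerivComp_eq e' hA ha,
    curvComp_change e e' (contMDiff_addOneForm hA ha), curvComp_change e e' hA,
    bracketComp_change e e']
  funext j
  simp only [Pi.sub_apply, smul_sub, Finset.sum_sub_distrib]

theorem gram_change {V : Type*} [NormedAddCommGroup V] [InnerProductSpace ℝ V] {W : Type*}
    (e e' : OrthonormalBasis (Fin 3) ℝ V) (F D : Fin 3 → W → W → ℝ) (v : Fin 4 → W) :
    gram (fun j => ∑ k, compMatrix e e' j k • F k) (fun j => ∑ k, compMatrix e e' j k • D k) v =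
      changeMatrix e e' * gram F D v * (changeMatrix e e').transpose := by
  rw [gram_matrix_left, gram_matrix_right, ← Matrix.mul_assoc, compMatrix_conj]

/-- The coefficients of the polynomial `t ↦ (F^i ∧ F^j)(v)` for the connections `A + t a`. -/
noncomputable def curvPath (A : CovariantDerivative (𝓡 4) Model3 E)
    (a : ∀ x : M, E x →L[ℝ] TangentSpace (𝓡 4) x →L[ℝ] E x) {x : M}
    (e : OrthonormalBasis (Fin 3) ℝ (E x)) (v : Fin 4 → TangentSpace (𝓡 4) x) :
    Fin 5 → Matrix (Fin 3) (Fin 3) ℝ :=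
  pathGram (curvComp A e) (extCovDerivComp A e a) (bracketComp e a) v

theorem gram_curvComp_addOneForm (hA : CovariantDerivative.ContMDiffCovariantDerivative A ∞)
    (ha : IsSoOneForm a) (t : ℝ) (v : Fin 4 → TangentSpace (𝓡 4) x) :
    gram (curvComp (A.addOneForm fun x => t • a x) e) (curvComp (A.addOneForm fun x => t • a x) e)
      v = quarticCurve (curvPath A a e v) t := by
  rw [curvComp_addOneForm e hA ha, gram_path, curvPath]

theorem curvPath_change (hA : CovariantDerivative.ContMDiffCovariantDerivative A ∞)
    (ha : IsSoOneForm a) (v : Fin 4 → TangentSpace (𝓡 4) x) (k : Fin 5) :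
    curvPath A a e' v k =
      changeMatrix e e' * curvPath A a e v k * (changeMatrix e e').transpose := by
  rw [curvPath, curvPath, curvComp_change e e' hA, extCovDerivComp_change e e' hA ha,
    bracketComp_change e e']
  fin_cases k <;> simp [pathGram, gram_change, Matrix.mul_add, Matrix.add_mul]

/-- The forms `F^i ∧ F^j` along `A + t a` are multiples of the determinant. -/
theorem curvPath_det (hA : CovariantDerivative.ContMDiffCovariantDerivative A ∞)
    (ha : IsSoOneForm a) (b : Module.Basis (Fin 4) ℝ (TangentSpace (𝓡 4) x))
    (v : Fin 4 → TangentSpace (𝓡 4) x) (k : Fin 5) :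
    curvPath A a e v k = b.det v • curvPath A a e b k := by
  have h1 {F D : Fin 3 → TangentSpace (𝓡 4) x → TangentSpace (𝓡 4) x → ℝ}
      (hF : ∀ i, F i ∈ bilinForms (TangentSpace (𝓡 4) x))
      (hD : ∀ i, D i ∈ bilinForms (TangentSpace (𝓡 4) x)) :
      gram F D v = b.det v • gram F D b := by
    ext i j
    simp only [gram, Matrix.of_apply, Matrix.smul_apply, smul_eq_mul]
    rw [wedgeTwo_eq_det (hF i) (hD j) b v, mul_comm]
  have hF := curvComp_mem_bilinForms e hA
  have hD := extCovDerivComp_mem_bilinForms e hA ha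
  have hB := bracketComp_mem_bilinForms e ha
  fin_cases k <;>
    simp [curvPath, pathGram, smul_add, h1 hF hF, h1 hF hD, h1 hD hF, h1 hD hD, h1 hF hB, h1 hB hF,
      h1 hD hB, h1 hB hD, h1 hB hB]

end Components

/-! ### Endomorphisms and their matrices -/

section EndMatrix

variable {V : Type*} [NormedAddCommGroup V] [InnerProductSpace ℝ V]

/-- The endomorphism with a given matrix in an orthonormal basis. -/
noncomputable def endOfMatrix (e : OrthonormalBasis (Fin 3) ℝ V)
    (P : Matrix (Fin 3) (Fin 3) ℝ) : V →L[ℝ] V :=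
  ∑ i, ∑ j, P i j • (innerSL ℝ (e j)).smulRight (e i)

theorem endOfMatrix_apply (e : OrthonormalBasis (Fin 3) ℝ V) (P : Matrix (Fin 3) (Fin 3) ℝ)
    (s : V) : endOfMatrix e P s = ∑ i, ∑ j, (P i j * inner ℝ (e j) s) • e i := by
  simp [endOfMatrix, smul_smul]

theorem inner_endOfMatrix (e : OrthonormalBasis (Fin 3) ℝ V) (P : Matrix (Fin 3) (Fin 3) ℝ)
    (i j : Fin 3) : inner ℝ (e i) (endOfMatrix e P (e j)) = P i j := by
  simp [endOfMatrix_apply, inner_sum, inner_smul_right, OrthonormalBasis.inner_eq_ite]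

theorem ext_inner_basis (e : OrthonormalBasis (Fin 3) ℝ V) {S T : V →L[ℝ] V}
    (h : ∀ i j, inner ℝ (e i) (S (e j)) = inner ℝ (e i) (T (e j))) : S = T := by
  have h1 : (S : V →ₗ[ℝ] V) = T := by
    refine e.toBasis.ext fun j => ?_
    rw [OrthonormalBasis.coe_toBasis]
    exact InnerProductSpace.ext_inner_left_basis e.toBasis fun i => by simpa using h i j
  exact ContinuousLinearMap.coe_injective h1

theorem inner_change (e e' : OrthonormalBasis (Fin 3) ℝ V) (T : V →L[ℝ] V) (i j : Fin 3) :
    inner ℝ (e' i) (T (e' j)) = (changeMatrix e e' * (Matrix.of fun i j => inner ℝ (e i) (T (e j)))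
      * (changeMatrix e e').transpose) i j := by
  rw [← changeMatrix_sum e e' i, ← changeMatrix_sum e e' j, map_sum, inner_sum, Matrix.mul_apply]
  refine Finset.sum_congr rfl fun q _ => ?_
  rw [map_smul, inner_smul_right, sum_inner, Matrix.mul_apply, Matrix.transpose_apply, mul_comm]
  congr 1
  refine Finset.sum_congr rfl fun p _ => ?_
  rw [inner_smul_left, conj_trivial, Matrix.of_apply]

theorem endOfMatrix_change (e e' : OrthonormalBasis (Fin 3) ℝ V) (P : Matrix (Fin 3) (Fin 3) ℝ) :
    endOfMatrix e' (changeMatrix e e' * P * (changeMatrix e e').transpose) = endOfMatrix e P := by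
  refine ext_inner_basis e' fun i j => ?_
  have h : (Matrix.of fun i j => inner ℝ (e i) (endOfMatrix e P (e j))) = P := by
    ext p q
    exact inner_endOfMatrix e P p q
  rw [inner_endOfMatrix, inner_change e e', h]

end EndMatrix

section Pointwise

variable {M : Type*} [TopologicalSpace M] [ChartedSpace Model4 M] [IsManifold (𝓡 4) ∞ M]
  [T2Space M] {E : M → Type*} [TopologicalSpace (TotalSpace Model3 E)]
  [∀ x, NormedAddCommGroup (E x)] [∀ x, InnerProductSpace ℝ (E x)]
  [FiberBundle Model3 E] [VectorBundle ℝ Model3 E] [ContMDiffVectorBundle ∞ Model3 E (𝓡 4)]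
  {A : CovariantDerivative (𝓡 4) Model3 E}
  {a : ∀ x : M, E x →L[ℝ] TangentSpace (𝓡 4) x →L[ℝ] E x}
  {o : ∀ x : M, Orientation ℝ (TangentSpace (𝓡 4) x) (Fin 4)} {Λ : ℝ}
  {x : M} (e e' : OrthonormalBasis (Fin 3) ℝ (E x))

theorem endMatrix_endOfMatrix (P : Matrix (Fin 3) (Fin 3) ℝ) :
    endMatrix e (endOfMatrix e P) = P := by
  ext i j
  exact inner_endOfMatrix e P i j

theorem endMatrix_injective : Function.Injective (endMatrix e) := fun _ _ h =>
  ext_inner_basis e fun i j => congrFun (congrFun h i) j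

theorem isSymTraceFree_iff (φ : E x →L[ℝ] E x) :
    IsSymTraceFree φ ↔ (endMatrix e φ).transpose = endMatrix e φ ∧ (endMatrix e φ).trace = 0 := by
  have htr : LinearMap.trace ℝ (E x) (φ : E x →ₗ[ℝ] E x) = (endMatrix e φ).trace := by
    rw [LinearMap.trace_eq_sum_inner _ e]; rfl
  rw [IsSymTraceFree, htr]
  refine and_congr_left fun _ => ⟨fun h => ?_, fun h => ?_⟩
  · ext i j
    exact (real_inner_comm _ _).trans (h (e i) (e j))
  · have h1 (i j : Fin 3) : inner ℝ (φ (e i)) (e j) = inner ℝ (e i) (φ (e j)) :=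
      (real_inner_comm _ _).trans (congrFun (congrFun h i) j)
    intro s s'
    change inner ℝ (φ s) s' = inner ℝ s (φ s')
    rw [← e.sum_repr' s, ← e.sum_repr' s']
    simp only [map_sum, map_smul, sum_inner, inner_sum, inner_smul_left, inner_smul_right, h1]

/-- The matrix `F^i ∧ F^j` is symmetric, so that `symSqrt` agrees with the square root. -/
theorem volCoeff_eq : volCoeff o Λ A e = rootVol Λ (curvGram o A e) := by
  have h : (curvGram o A e).IsHermitian := by
    rw [Matrix.IsHermitian, Matrix.conjTranspose_eq_transpose_of_trivial]
    exact gram_transpose _ _ _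
  rw [volCoeff, rootVol, symSqrt_eq h]

/-- The square root of `G / m` has trace `|Λ|`, since `m = (tr √G / Λ)²`; the sign of
`Y` is that of `Λ`. -/
theorem matY_eq (hG : (curvGram o A e).PosDef) : matY o Λ A e = normRoot Λ (curvGram o A e) := by
  have htr := trace_symSqrt_pos hG
  rw [matY, matQ, volCoeff_eq,
    cfc_sqrt_smul hG (c := (rootVol Λ (curvGram o A e))⁻¹) (inv_nonneg.2 (sq_nonneg _)),
    smul_smul, normRoot, ← symSqrt_eq hG.1, rootVol, Real.sqrt_inv, Real.sqrt_sq_eq_abs,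
    abs_div, abs_of_pos htr]
  congr 1
  rw [inv_div, ← mul_div_assoc, sign_mul_abs]

theorem matX_eq (hG : (curvGram o A e).PosDef) :
    matX o Λ A e = (normRoot Λ (curvGram o A e))⁻¹ := by
  rw [matX, matY_eq e hG]

theorem volCoeff_addOneForm (hA : CovariantDerivative.ContMDiffCovariantDerivative A ∞)
    (ha : IsSoOneForm a) (t : ℝ) : volCoeff o Λ (A.addOneForm fun x => t • a x) e =
      rootVol Λ (quarticCurve (curvPath A a e (posBasis o x)) t) := by
  rw [volCoeff_eq, ← gram_curvComp_addOneForm e hA ha]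
  rfl

variable (o Λ A a) in
/-- The derivative of `Y` along `A + t a`, as an endomorphism of the fibre. -/
noncomputable def variationEnd (e : OrthonormalBasis (Fin 3) ℝ (E x)) : E x →L[ℝ] E x :=
  endOfMatrix e (rootDeriv Λ (curvPath A a e (posBasis o x) 0) (curvPath A a e (posBasis o x) 1))

/-- The endomorphism `variationEnd` does not depend on the orthonormal frame. -/
theorem variationEnd_change (hA : CovariantDerivative.ContMDiffCovariantDerivative A ∞)
    (ha : IsSoOneForm a) (hG : (curvGram o A e).PosDef) :
    variationEnd A a o Λ e' = variationEnd A a o Λ e := by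
  have h0 : (curvPath A a e (posBasis o x) 0).PosDef := hG
  have h1 : (curvPath A a e (posBasis o x) 1).transpose = curvPath A a e (posBasis o x) 1 :=
    pathGram_transpose _ _ _ _ 1
  rw [variationEnd, curvPath_change e e' hA ha, curvPath_change e e' hA ha,
    rootDeriv_conj h0 h1 (changeMatrix_transpose_mul e e'),
    endOfMatrix_change, variationEnd]

variable (o Λ A a) in
/-- The matrix `N` of the self-dual part of `d_A a`. -/
noncomputable def selfDualMatrix (e : OrthonormalBasis (Fin 3) ℝ (E x)) :
    Matrix (Fin 3) (Fin 3) ℝ :=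
  (rootVol Λ (curvGram o A e))⁻¹ • gram (extCovDerivComp A e a) (sigmaForm o Λ A e) (posBasis o x)

/-- The integrand as a trace of Gram matrices. -/
theorem hessianIntegrand_eq (ha : IsSoOneForm a)
    (φ : E x →L[ℝ] E x) (v : Fin 4 → TangentSpace (𝓡 4) x) :
    hessianIntegrand o Λ A a e φ v =
      (matX o Λ A e * gram (hessianShift o Λ A a e φ) (hessianShift o Λ A a e φ) v).trace
        + 2 * (gram (bracketComp e a) (sigmaForm o Λ A e) v).trace := by
  have hB : 2 * (gram (bracketComp e a) (sigmaForm o Λ A e) v).trace =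
      - ∑ i, ∑ j, ∑ k, eps i j k *
        wedgeTwo (wedgeOne (formComp e a i) (formComp e a j)) (sigmaForm o Λ A e k) v := by
    have h1 (k : Fin 3) : wedgeTwo (bracketComp e a k) (sigmaForm o Λ A e k) v =
        -(1 / 2 : ℝ) * ∑ i, ∑ j, eps i j k *
          wedgeTwo (wedgeOne (formComp e a i) (formComp e a j)) (sigmaForm o Λ A e k) v := by
      rw [bracketComp_eq e ha]
      simp only [← wedgeTwoBilin_apply, map_sum, map_smul, LinearMap.sum_apply,
        LinearMap.smul_apply, Finset.sum_apply, Pi.smul_apply, smul_eq_mul]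
    simp only [Matrix.trace, Matrix.diag, gram, Matrix.of_apply, h1, ← Finset.mul_sum]
    rw [Finset.sum_comm]
    simp only [Finset.sum_comm (s := (Finset.univ : Finset (Fin 3))) (t := Finset.univ)
      (f := fun k j => eps _ j k * _)]
    ring
  rw [hB, ← sub_eq_add_neg, hessianIntegrand]
  simp only [Pi.sub_apply, Finset.sum_apply, Pi.smul_apply, smul_eq_mul]
  congr 1
  simp only [Matrix.trace, Matrix.diag, Matrix.mul_apply, gram, Matrix.of_apply]
  exact Finset.sum_congr rfl fun i _ => Finset.sum_congr rfl fun j _ => by rw [wedgeTwo_comm]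

/-- The pointwise second variation for the connections `A + t a`. -/
theorem variation_volCoeff (hΛ : Λ ≠ 0)
    (hA : CovariantDerivative.ContMDiffCovariantDerivative A ∞)
    (ha : IsSoOneForm a) (hG : (curvGram o A e).PosDef) :
    gram (sigmaForm o Λ A e) (sigmaForm o Λ A e) (posBasis o x) =
      rootVol Λ (curvGram o A e) • 1 ∧
    (endMatrix e (variationEnd A a o Λ e)).trace = 0 ∧
    symTraceFree (matX o Λ A e * selfDualMatrix A a o Λ e) =
      symTraceFree (matX o Λ A e * endMatrix e (variationEnd A a o Λ e)) ∧
    Λ / 2 * deriv (deriv fun t : ℝ => volCoeff o Λ (A.addOneForm fun x => t • a x) e) 0 =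
      hessianIntegrand o Λ A a e (variationEnd A a o Λ e) (posBasis o x) := by
  have h := variation_pathGram hΛ (F := curvComp A e) (D := extCovDerivComp A e a)
    (B := bracketComp e a) (v := posBasis o x) (X := matX o Λ A e)
    (φ := endMatrix e (variationEnd A a o Λ e)) (N := selfDualMatrix A a o Λ e)
    (S := sigmaForm o Λ A e) hG (matX_eq e hG) rfl rfl (endMatrix_endOfMatrix e _)
  rw [hessianIntegrand_eq e ha]
  refine ⟨h.1, h.2.1, h.2.2.1, ?_⟩
  simp only [volCoeff_addOneForm e hA ha]
  exact h.2.2.2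

/-- The self-dual part of `d_A a` is `N^ij Σ_j`, since `Σ_i ∧ Σ_j = δ_ij μ_A`. -/
theorem isSelfDualPart_selfDualMatrix (hΛ : Λ ≠ 0)
    (hA : CovariantDerivative.ContMDiffCovariantDerivative A ∞)
    (ha : IsSoOneForm a) (hG : (curvGram o A e).PosDef) (i : Fin 3) :
    IsSelfDualPart (selfDualForms o Λ A e) (extCovDerivComp A e a i)
      (∑ j, selfDualMatrix A a o Λ e i j • sigmaForm o Λ A e j) := by
  refine ⟨Submodule.sum_mem _ fun j _ => Submodule.smul_mem _ _
    (Submodule.subset_span ⟨j, rfl⟩), fun γ hγ => ?_⟩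
  have hS (k : Fin 3) : sigmaForm o Λ A e k ∈ bilinForms (TangentSpace (𝓡 4) x) :=
    Submodule.sum_mem _ fun j _ => Submodule.smul_mem _ _ (curvComp_mem_bilinForms e hA j)
  rw [← wedgeTwoBilin_apply]
  induction hγ using Submodule.span_induction with
  | mem γ h =>
    obtain ⟨k, rfl⟩ := h
    funext v
    rw [wedgeTwoBilin_apply, wedgeTwo_eq_det (Submodule.sub_mem _
      (extCovDerivComp_mem_bilinForms e hA ha i) (Submodule.sum_mem _ fun j _ =>
        Submodule.smul_mem _ _ (hS j))) (hS k) (posBasis o x)]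
    have h1 (j : Fin 3) := congrFun (congrFun (variation_volCoeff e hΛ hA ha hG).1 j) k
    simp only [gram, Matrix.of_apply, Matrix.smul_apply, smul_eq_mul, Matrix.one_apply] at h1
    rw [← wedgeTwoBilin_apply]
    simp only [map_sub, map_sum, map_smul, LinearMap.sub_apply, LinearMap.sum_apply,
      LinearMap.smul_apply, Pi.sub_apply, Finset.sum_apply, Pi.smul_apply, wedgeTwoBilin_apply, h1,
      smul_eq_mul, mul_ite, mul_one, mul_zero, Finset.sum_ite_eq', Finset.mem_univ, if_true]
    rw [selfDualMatrix, Matrix.smul_apply, smul_eq_mul, mul_comm _⁻¹,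
      inv_mul_cancel_right₀ (rootVol_pos hΛ hG).ne']
    simp [gram]
  | zero => rw [map_zero]
  | add γ γ' _ _ h h' => rw [map_add, h, h', add_zero]
  | smul c γ _ h => rw [map_smul, h, smul_zero]

/-- Existence and uniqueness of the trace-free symmetric `φ` for which `X φ` and `X N` have the same
trace-free symmetric part. -/
theorem eq_variationEnd_iff (hΛ : Λ ≠ 0)
    (hA : CovariantDerivative.ContMDiffCovariantDerivative A ∞)
    (ha : IsSoOneForm a) (hG : (curvGram o A e).PosDef) (ψ : E x →L[ℝ] E x) :
    (IsSymTraceFree ψ ∧ symTraceFree (matX o Λ A e * endMatrix e ψ) =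
      symTraceFree (matX o Λ A e * selfDualMatrix A a o Λ e)) ↔ ψ = variationEnd A a o Λ e := by
  obtain ⟨-, h1, h2, -⟩ := variation_volCoeff e hΛ hA ha hG
  have hsym : (endMatrix e (variationEnd A a o Λ e)).transpose =
      endMatrix e (variationEnd A a o Λ e) := by
    have h0 : (curvPath A a e (posBasis o x) 0).PosDef := hG
    rw [variationEnd, endMatrix_endOfMatrix, rootDeriv_transpose h0]
  constructor
  · rintro ⟨hψ, h3⟩
    obtain ⟨h4, h5⟩ := (isSymTraceFree_iff e ψ).1 hψ
    refine endMatrix_injective e (sub_eq_zero.1 ?_)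
    have htr := trace_symSqrt_pos hG
    have hX : matX o Λ A e =
        (Λ / (symSqrt (curvGram o A e)).trace)⁻¹ • (symSqrt (curvGram o A e))⁻¹ := by
      have hu : Λ / (symSqrt (curvGram o A e)).trace ≠ 0 := div_ne_zero hΛ htr.ne'
      rw [matX_eq e hG, normRoot]
      refine Matrix.inv_eq_left_inv ?_
      rw [smul_mul_smul_comm, inv_mul_cancel₀ hu, one_smul,
        Matrix.nonsing_inv_mul _ (isUnit_iff_ne_zero.2 (symSqrt_posDef hG).det_pos.ne')]
    refine eq_zero_of_symTraceFree_mul (symSqrt_posDef hG).inv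
      (inv_ne_zero (div_ne_zero hΛ htr.ne')) ?_ ?_ ?_
    · rw [Matrix.transpose_sub, h4, hsym]
    · rw [Matrix.trace_sub, h5, h1, sub_zero]
    · rw [← hX, Matrix.mul_sub, symTraceFree_sub, h3, h2, sub_self]
  · rintro rfl
    exact ⟨(isSymTraceFree_iff e _).2 ⟨hsym, h1⟩, h2.symm⟩

/-- The integrand is a 4-form: it is determined by its value on one positive basis. -/
theorem hessianIntegrand_det (hA : CovariantDerivative.ContMDiffCovariantDerivative A ∞)
    (ha : IsSoOneForm a) (φ : E x →L[ℝ] E x) (v : Fin 4 → TangentSpace (𝓡 4) x) :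
    hessianIntegrand o Λ A a e φ v =
      hessianIntegrand o Λ A a e φ (posBasis o x) * (posBasis o x).det v := by
  have hS (k : Fin 3) : sigmaForm o Λ A e k ∈ bilinForms (TangentSpace (𝓡 4) x) :=
    Submodule.sum_mem _ fun j _ => Submodule.smul_mem _ _ (curvComp_mem_bilinForms e hA j)
  have hH (k : Fin 3) : hessianShift o Λ A a e φ k ∈ bilinForms (TangentSpace (𝓡 4) x) :=
    Submodule.sub_mem _ (extCovDerivComp_mem_bilinForms e hA ha k)
      (Submodule.sum_mem _ fun j _ => Submodule.smul_mem _ _ (hS j))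
  simp only [hessianIntegrand, Pi.sub_apply, Finset.sum_apply, Pi.smul_apply, smul_eq_mul,
    sub_mul, Finset.sum_mul]
  congr 1
  · refine Finset.sum_congr rfl fun i _ => Finset.sum_congr rfl fun j _ => ?_
    rw [wedgeTwo_eq_det (hH i) (hH j) (posBasis o x) v, mul_assoc]
  · refine Finset.sum_congr rfl fun i _ => Finset.sum_congr rfl fun j _ =>
      Finset.sum_congr rfl fun k _ => ?_
    rw [wedgeTwo_eq_det (wedgeOne_mem_bilinForms e i j) (hS k) (posBasis o x) v, mul_assoc]

end Pointwise

/-! ### Smooth orthonormal frames and smoothness of components -/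

section SmoothFun

variable {M : Type*} [TopologicalSpace M] [ChartedSpace Model4 M] {x : M}

theorem SmoothFunNear.add {f g : M → ℝ} (hf : SmoothFunNear f x) (hg : SmoothFunNear g x) :
    SmoothFunNear (fun y => f y + g y) x := by
  filter_upwards [hf, hg] with y hf hg
  exact hf.add hg

theorem SmoothFunNear.sub {f g : M → ℝ} (hf : SmoothFunNear f x) (hg : SmoothFunNear g x) :
    SmoothFunNear (fun y => f y - g y) x := by
  filter_upwards [hf, hg] with y hf hg
  exact hf.sub hg

theorem SmoothFunNear.mul {f g : M → ℝ} (hf : SmoothFunNear f x) (hg : SmoothFunNear g x) :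
    SmoothFunNear (fun y => f y * g y) x := by
  filter_upwards [hf, hg] with y hf hg
  exact hf.mul hg

theorem SmoothFunNear.const (c : ℝ) : SmoothFunNear (fun _ : M => c) x :=
  Eventually.of_forall fun _ => contMDiffAt_const

theorem SmoothFunNear.sum {ι : Type*} {s : Finset ι} {f : ι → M → ℝ}
    (hf : ∀ i, SmoothFunNear (f i) x) : SmoothFunNear (fun y => ∑ i ∈ s, f i y) x := by
  filter_upwards [(Filter.eventually_all_finset s).2 fun i _ => hf i] with y hy
  exact ContMDiffAt.sum hy

end SmoothFun

section Frame

variable {M : Type*} [TopologicalSpace M] [ChartedSpace Model4 M] [IsManifold (𝓡 4) ∞ M]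
  {E : M → Type*} [TopologicalSpace (TotalSpace Model3 E)]
  [∀ x, NormedAddCommGroup (E x)] [∀ x, InnerProductSpace ℝ (E x)]
  [FiberBundle Model3 E] [VectorBundle ℝ Model3 E] [ContMDiffVectorBundle ∞ Model3 E (𝓡 4)]
  [IsContMDiffRiemannianBundle (𝓡 4) ∞ Model3 E] {x : M}

theorem SmoothNear.inner {σ τ : ∀ y : M, E y} (hσ : SmoothNear Model3 σ x)
    (hτ : SmoothNear Model3 τ x) : SmoothFunNear (fun y => inner ℝ (σ y) (τ y)) x := by
  filter_upwards [hσ, hτ] with y h1 h2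
  exact h1.inner_bundle h2

/-- The Gram-Schmidt process applied to a local frame yields a smooth orthonormal frame. -/
theorem exists_smooth_orthonormal_frame (x : M) :
    ∃ b : ∀ y : M, OrthonormalBasis (Fin 3) ℝ (E y), ∀ i, SmoothNear Model3 (fun y => b y i) x := by
  have hfin (y : M) : FiniteDimensional ℝ (E y) := VectorBundle.finiteDimensional ℝ Model3 E y
  set T := trivializationAt Model3 E x
  let s (i : Fin 3) (y : M) : E y := T.localFrame (EuclideanSpace.basisFun (Fin 3) ℝ).toBasis i y
  have hx : x ∈ T.baseSet := mem_baseSet_trivializationAt Model3 E x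
  have hli : ∀ y ∈ T.baseSet, LinearIndependent ℝ fun i => s i y := fun y hy =>
    (T.isLocalFrameOn_localFrame_baseSet (𝓡 4) ∞
      (EuclideanSpace.basisFun (Fin 3) ℝ).toBasis).linearIndependent hy
  have hs (i : Fin 3) : SmoothNear Model3 (s i) x :=
    smoothNear_of_contMDiffOn T.open_baseSet hx
      (T.contMDiffOn_localFrame_baseSet ∞ (EuclideanSpace.basisFun (Fin 3) ℝ).toBasis i)
  let g (i : Fin 3) (y : M) : E y := InnerProductSpace.gramSchmidt ℝ (fun i => s i y) i
  have hnorm {i : Fin 3} (hg : SmoothNear Model3 (g i) x) :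
      SmoothFunNear (fun y => ‖g i y‖⁻¹) x := by
    filter_upwards [hg.inner hg, T.open_baseSet.mem_nhds hx] with y h1 hy
    have h2 : g i y ≠ 0 := InnerProductSpace.gramSchmidt_ne_zero i (hli y hy)
    have h3 : ContDiffAt ℝ ∞ (fun r : ℝ => (Real.sqrt r)⁻¹) (inner ℝ (g i y) (g i y)) := by
      have h4 : inner ℝ (g i y) (g i y) ≠ 0 := inner_self_ne_zero.2 h2
      refine (contDiffAt_id.sqrt h4).inv ?_
      rw [id, real_inner_self_eq_norm_sq, Real.sqrt_sq (norm_nonneg _)]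
      exact norm_ne_zero_iff.2 h2
    have h5 := h3.contMDiffAt.comp y h1
    refine h5.congr_of_eventuallyEq (Eventually.of_forall fun z => ?_)
    simp only [Function.comp, real_inner_self_eq_norm_sq, Real.sqrt_sq (norm_nonneg _)]
  have hg (i : Fin 3) : SmoothNear Model3 (g i) x := by
    induction i using WellFoundedLT.induction with
    | ind i ih =>
      have hsum : SmoothNear Model3 (fun y => ∑ j ∈ Finset.Iio i,
          (fun y => -(inner ℝ (g j y) (s i y) * (‖g j y‖⁻¹ * ‖g j y‖⁻¹)) : M → ℝ) y • g j y) x := by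
        refine SmoothNear.sum fun j hj => ?_
        have hj' := ih j (Finset.mem_Iio.1 hj)
        have h1 : SmoothFunNear
            (fun y => -(inner ℝ (g j y) (s i y) * (‖g j y‖⁻¹ * ‖g j y‖⁻¹))) x := by
          have h2 := (SmoothFunNear.const (-1)).mul
            ((hj'.inner (hs i)).mul ((hnorm hj').mul (hnorm hj')))
          simpa only [neg_one_mul] using h2
        exact SmoothNear.smul h1 hj'
      refine ((hs i).add hsum).congr (Eventually.of_forall fun y => ?_)
      have h1 := InnerProductSpace.gramSchmidt_def'' ℝ (fun i => s i y) i
      change s i y = g i y + ∑ j ∈ Finset.Iio i, (inner ℝ (g j y) (s i y) / (‖g j y‖ : ℝ) ^ 2) •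
        g j y at h1
      rw [Pi.add_apply]
      simp only [neg_smul, Finset.sum_neg_distrib]
      rw [← sub_eq_add_neg, eq_sub_iff_add_eq, h1]
      congr 1
      refine Finset.sum_congr rfl fun j _ => ?_
      congr 1
      rw [← h1, div_eq_mul_inv, sq, mul_inv]
  refine ⟨fun y => InnerProductSpace.gramSchmidtOrthonormalBasis
    (by rw [finrank_fiber E y, Fintype.card_fin]) fun i => s i y, fun i => ?_⟩
  refine (SmoothNear.smul (hnorm (hg i)) (hg i)).congr ?_
  filter_upwards [T.open_baseSet.mem_nhds hx] with y hy
  have h2 : g i y ≠ 0 := InnerProductSpace.gramSchmidt_ne_zero i (hli y hy)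
  rw [InnerProductSpace.gramSchmidtOrthonormalBasis_apply]
  · rfl
  · exact smul_ne_zero (inv_ne_zero (norm_ne_zero_iff.2 h2)) h2

theorem smoothNear_coordFrame {c : M} (hx : x ∈ (chartAt Model4 c).source) (k : Fin 4) :
    SmoothNear Model4 (fun y => coordFrame c y k) x := by
  set T := trivializationAt Model4 (TangentSpace (𝓡 4) : M → Type) c
  have hx' : x ∈ T.baseSet := by rwa [TangentBundle.trivializationAt_baseSet]
  exact smoothNear_of_contMDiffOn T.open_baseSet hx'
      (T.contMDiffOn_localFrame_baseSet ∞ (EuclideanSpace.basisFun (Fin 4) ℝ).toBasis k)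

variable {b : ∀ y : M, OrthonormalBasis (Fin 3) ℝ (E y)}

theorem smoothFunNear_soComp (hb : ∀ i, SmoothNear Model3 (fun y => b y i) x)
    {T : ∀ y : M, E y → E y} (hT : ∀ i, SmoothNear Model3 (fun y => T y (b y i)) x) (j : Fin 3) :
    SmoothFunNear (fun y => soComp (b y) (T y) j) x :=
  (SmoothFunNear.const _).mul (SmoothFunNear.sum fun i => SmoothFunNear.sum fun k =>
    (SmoothFunNear.const _).mul ((hT i).inner (hb k)))

variable [T2Space M] {A : CovariantDerivative (𝓡 4) Model3 E}
  {a : ∀ x : M, E x →L[ℝ] TangentSpace (𝓡 4) x →L[ℝ] E x}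
  {U V : ∀ y : M, TangentSpace (𝓡 4) y}

theorem smoothFunNear_curvComp (hA : CovariantDerivative.ContMDiffCovariantDerivative A ∞)
    (hb : ∀ i, SmoothNear Model3 (fun y => b y i) x) (hU : SmoothNear Model4 U x)
    (hV : SmoothNear Model4 V x) (i : Fin 3) :
    SmoothFunNear (fun y => curvComp A (b y) i (U y) (V y)) x :=
  smoothFunNear_soComp hb (fun i => smoothNear_curvature hA hU hV (hb i)) i

theorem smoothFunNear_bracketComp (ha : IsSoOneForm a)
    (hb : ∀ i, SmoothNear Model3 (fun y => b y i) x) (hU : SmoothNear Model4 U x)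
    (hV : SmoothNear Model4 V x) (i : Fin 3) :
    SmoothFunNear (fun y => bracketComp (b y) a i (U y) (V y)) x := by
  refine smoothFunNear_soComp hb (T := fun y s => a y (a y s (V y)) (U y) - a y (a y s (U y)) (V y))
    (fun i => ?_) i
  have h1 := (ha.smoothNear_apply ((ha.smoothNear_apply (hb i)).hom_apply hV)).hom_apply hU
  have h2 := (ha.smoothNear_apply ((ha.smoothNear_apply (hb i)).hom_apply hU)).hom_apply hV
  have h3 : SmoothFunNear (fun _ : M => (-1 : ℝ)) x := SmoothFunNear.const _
  refine (h1.add (SmoothNear.smul h3 h2)).congr (Eventually.of_forall fun y => ?_)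
  simp [sub_eq_add_neg]

theorem smoothFunNear_extCovDerivComp
    (hA : CovariantDerivative.ContMDiffCovariantDerivative A ∞) (ha : IsSoOneForm a)
    (hb : ∀ i, SmoothNear Model3 (fun y => b y i) x) (hU : SmoothNear Model4 U x)
    (hV : SmoothNear Model4 V x) (i : Fin 3) :
    SmoothFunNear (fun y => extCovDerivComp A (b y) a i (U y) (V y)) x := by
  simp only [extCovDerivComp_eq _ hA ha]
  exact ((smoothFunNear_curvComp (contMDiff_addOneForm hA ha) hb hU hV i).sub
    (smoothFunNear_curvComp hA hb hU hV i)).sub (smoothFunNear_bracketComp ha hb hU hV i)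

theorem smoothFunNear_curvPath (hA : CovariantDerivative.ContMDiffCovariantDerivative A ∞)
    (ha : IsSoOneForm a) (hb : ∀ i, SmoothNear Model3 (fun y => b y i) x)
    {v : ∀ y : M, Fin 4 → TangentSpace (𝓡 4) y}
    (hv : ∀ k, SmoothNear Model4 (fun y => v y k) x) (k : Fin 5) (i j : Fin 3) :
    SmoothFunNear (fun y => curvPath A a (b y) (v y) k i j) x := by
  have hw {F D : ∀ y : M, TangentSpace (𝓡 4) y → TangentSpace (𝓡 4) y → ℝ}
      (hF : ∀ k l, SmoothFunNear (fun y => F y (v y k) (v y l)) x)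
      (hD : ∀ k l, SmoothFunNear (fun y => D y (v y k) (v y l)) x) :
      SmoothFunNear (fun y => wedgeTwo (F y) (D y) (v y)) x :=
    (SmoothFunNear.const _).mul (SmoothFunNear.sum fun σ =>
      (SmoothFunNear.const _).mul ((hF _ _).mul (hD _ _)))
  have hF (i : Fin 3) (k l : Fin 4) := smoothFunNear_curvComp hA hb (hv k) (hv l) i
  have hD (i : Fin 3) (k l : Fin 4) := smoothFunNear_extCovDerivComp hA ha hb (hv k) (hv l) i
  have hB (i : Fin 3) (k l : Fin 4) := smoothFunNear_bracketComp ha hb (hv k) (hv l) i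
  fin_cases k
  · exact hw (hF i) (hF j)
  · exact (hw (hF i) (hD j)).add (hw (hD i) (hF j))
  · exact (hw (hD i) (hD j)).add ((hw (hF i) (hB j)).add (hw (hB i) (hF j)))
  · exact (hw (hD i) (hB j)).add (hw (hB i) (hD j))
  · exact hw (hB i) (hB j)

/-- An endomorphism is smooth if its matrix in a smooth orthonormal frame is. -/
theorem contMDiffAt_endOfMatrix (hb : ∀ i, SmoothNear Model3 (fun y => b y i) x)
    {P : M → Matrix (Fin 3) (Fin 3) ℝ} (hP : ∀ i j, SmoothFunNear (fun y => P y i j) x) :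
    ContMDiffAt (𝓡 4) ((𝓡 4).prod 𝓘(ℝ, Model3 →L[ℝ] Model3)) ∞
      (fun y => TotalSpace.mk' (Model3 →L[ℝ] Model3) (E := fun y => E y →L[ℝ] E y) y
        (endOfMatrix (b y) (P y))) x := by
  rw [contMDiffAt_hom_bundle]
  refine ⟨contMDiffAt_id, ?_⟩
  set T := trivializationAt Model3 E x
  have hx : x ∈ T.baseSet := mem_baseSet_trivializationAt Model3 E x
  let s (i : Fin 3) (y : M) : E y := T.localFrame (EuclideanSpace.basisFun (Fin 3) ℝ).toBasis i y
  have hs (i : Fin 3) : SmoothNear Model3 (s i) x :=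
    smoothNear_of_contMDiffOn T.open_baseSet hx
      (T.contMDiffOn_localFrame_baseSet ∞ (EuclideanSpace.basisFun (Fin 3) ℝ).toBasis i)
  have hsec (k : Fin 3) : SmoothNear Model3 (fun y => endOfMatrix (b y) (P y) (s k y)) x := by
    simp only [endOfMatrix_apply]
    exact SmoothNear.sum fun i _ => SmoothNear.sum fun j _ =>
      SmoothNear.smul ((hP i j).mul ((hb j).inner (hs k))) (hb i)
  have hcoord (k : Fin 3) : ContMDiffAt (𝓡 4) 𝓘(ℝ, Model3) ∞
      (fun y => (T ⟨y, endOfMatrix (b y) (P y) (s k y)⟩).2) x :=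
    (contMDiffAt_section x).1 (hsec k).contMDiffAt
  have hsum : ContMDiffAt (𝓡 4) 𝓘(ℝ, Model3 →L[ℝ] Model3) ∞ (fun y => ∑ k,
      ContinuousLinearMap.smulRightL ℝ Model3 Model3 (EuclideanSpace.proj k)
        ((T ⟨y, endOfMatrix (b y) (P y) (s k y)⟩).2)) x :=
    ContMDiffAt.sum fun k _ =>
      (ContinuousLinearMap.contDiff _).contDiffAt.contMDiffAt.comp x (hcoord k)
  refine hsum.congr_of_eventuallyEq ?_
  filter_upwards [T.open_baseSet.mem_nhds hx] with y hy
  rw [ContinuousLinearMap.inCoordinates_eq hy hy]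
  ext1 w
  have hsk (k : Fin 3) : s k y = (T.continuousLinearEquivAt ℝ y hy).symm
      (EuclideanSpace.basisFun (Fin 3) ℝ k) := by
    simp only [s, T.localFrame_apply_of_mem_baseSet _ hy]
    simp [Trivialization.basisAt]
  have hw : w = ∑ k, w k • EuclideanSpace.basisFun (Fin 3) ℝ k :=
    ((EuclideanSpace.basisFun (Fin 3) ℝ).sum_repr w).symm
  conv_lhs => rw [hw]
  simp only [ContinuousLinearMap.comp_apply, map_sum, map_smul, sum_apply, hsk]
  rfl

end Frame

/-! ### The density of the volume form in a chart -/

section OrientSign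

/-- Up to a positive factor, the alternating form that represents the orientation of a basis is its
determinant. -/
theorem orientSign_mul_det {V : Type*} [AddCommGroup V] [Module ℝ V]
    (b : Module.Basis (Fin 4) ℝ V) (v : Fin 4 → V) :
    orientSign b.orientation v = ((SignType.sign (b.det v) : SignType) : ℝ) := by
  have h : SameRay ℝ b.orientation.someVector b.det := by
    rw [← ray_eq_iff (b.orientation.someVector_ne_zero) b.det_ne_zero, Module.Ray.someVector_ray]
    rfl
  obtain ⟨r, s, hr, hs, h1⟩ := h.exists_pos (b.orientation.someVector_ne_zero) b.det_ne_zero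
  have h2 : b.orientation.someVector v = (r⁻¹ * s) * b.det v := by
    have h3 := congrArg (fun f => f v) h1
    simp only [AlternatingMap.smul_apply, smul_eq_mul] at h3
    rw [mul_assoc, ← h3, inv_mul_cancel_left₀ hr.ne']
  rw [orientSign, h2, sign_mul, sign_pos (mul_pos (inv_pos.2 hr) hs), one_mul]

variable {M : Type*} [TopologicalSpace M] [ChartedSpace Model4 M] [IsManifold (𝓡 4) ∞ M]
  {o : ∀ x : M, Orientation ℝ (TangentSpace (𝓡 4) x) (Fin 4)} {c x : M}

theorem orientation_posBasis : (posBasis o x).orientation = o x :=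
  Module.Basis.orientation_adjustToOrientation _ _

theorem orientSign_eq (v : Fin 4 → TangentSpace (𝓡 4) x) :
    orientSign (o x) v = ((SignType.sign ((posBasis o x).det v) : SignType) : ℝ) := by
  rw [← orientSign_mul_det, orientation_posBasis]

theorem det_coordFrame_ne_zero (hx : x ∈ (chartAt Model4 c).source) :
    (posBasis o x).det (coordFrame c x) ≠ 0 := by
  set T := trivializationAt Model4 (TangentSpace (𝓡 4) : M → Type) c with hT
  have hx' : x ∈ T.baseSet := by rwa [TangentBundle.trivializationAt_baseSet]
  have h : coordFrame c x = T.basisAt (EuclideanSpace.basisFun (Fin 4) ℝ).toBasis hx' := by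
    funext k
    exact T.localFrame_apply_of_mem_baseSet _ hx'
  rw [h]
  exact (Module.Basis.isUnit_det _ _).ne_zero

/-- A continuous orientation has constant sign relative to a chart near each point of its domain. -/
theorem orientSign_eventually_eq (ho : IsOrientation o) (hx : x ∈ (chartAt Model4 c).source) :
    ∀ᶠ y in 𝓝 x, orientSign (o y) (coordFrame c y) = orientSign (o x) (coordFrame c x) := by
  have hsrc := (chartAt Model4 c).open_source.mem_nhds hx
  have hval {y : M} (hy : y ∈ (chartAt Model4 c).source) :
      orientSign (o y) (coordFrame c y) = 1 ∨ orientSign (o y) (coordFrame c y) = -1 := by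
    rw [orientSign_eq]
    rcases lt_or_gt_of_ne (det_coordFrame_ne_zero (o := o) hy) with h | h
    · right; rw [sign_neg h]; simp
    · left; rw [sign_pos h]; simp
  have hc := (ho c).continuousAt hsrc
  filter_upwards [hsrc, Metric.continuousAt_iff'.1 hc 1 one_pos] with y hy hd
  rw [Real.dist_eq, abs_lt] at hd
  rcases hval hy with h | h <;> rcases hval hx with h' | h' <;> rw [h, h'] at hd ⊢ <;>
    norm_num at hd

end OrientSign

section Density

variable {M : Type*} [TopologicalSpace M] [ChartedSpace Model4 M] [IsManifold (𝓡 4) ∞ M]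
  [T2Space M] {E : M → Type*} [TopologicalSpace (TotalSpace Model3 E)]
  [∀ x, NormedAddCommGroup (E x)] [∀ x, InnerProductSpace ℝ (E x)]
  [FiberBundle Model3 E] [VectorBundle ℝ Model3 E] [ContMDiffVectorBundle ∞ Model3 E (𝓡 4)]
  {A : CovariantDerivative (𝓡 4) Model3 E}
  {a : ∀ x : M, E x →L[ℝ] TangentSpace (𝓡 4) x →L[ℝ] E x}
  {o : ∀ x : M, Orientation ℝ (TangentSpace (𝓡 4) x) (Fin 4)} {Λ : ℝ} {c x : M}

variable (A a o) in
/-- The coefficients of `(F^i ∧ F^j)(∂_1, …, ∂_4)` along `A + t a`, with the sign of the chart. -/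
noncomputable def chartPath (c : M) {x : M} (e : OrthonormalBasis (Fin 3) ℝ (E x)) (k : Fin 5) :
    Matrix (Fin 3) (Fin 3) ℝ :=
  orientSign (o x) (coordFrame c x) • curvPath A a e (coordFrame c x) k

theorem chartPath_transpose (e : OrthonormalBasis (Fin 3) ℝ (E x)) (k : Fin 5) :
    (chartPath A a o c e k).transpose = chartPath A a o c e k := by
  rw [chartPath, Matrix.transpose_smul]
  exact congrArg _ (pathGram_transpose _ _ _ _ k)

theorem chartPath_eq (hA : CovariantDerivative.ContMDiffCovariantDerivative A ∞)
    (ha : IsSoOneForm a) (e : OrthonormalBasis (Fin 3) ℝ (E x)) (k : Fin 5) :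
    chartPath A a o c e k =
      |(posBasis o x).det (coordFrame c x)| • curvPath A a e (posBasis o x) k := by
  rw [chartPath, curvPath_det e hA ha (posBasis o x), smul_smul, orientSign_eq, sign_mul_self]

theorem chartPath_zero_posDef (hA : CovariantDerivative.ContMDiffCovariantDerivative A ∞)
    (ha : IsSoOneForm a) (hAor : InducesOrientation o A) (hx : x ∈ (chartAt Model4 c).source)
    (e : OrthonormalBasis (Fin 3) ℝ (E x)) : (chartPath A a o c e 0).PosDef := by
  rw [chartPath_eq hA ha]
  exact (hAor x e).smul (abs_pos.2 (det_coordFrame_ne_zero hx))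

theorem variationEnd_eq_chartPath (hA : CovariantDerivative.ContMDiffCovariantDerivative A ∞)
    (ha : IsSoOneForm a) (hAor : InducesOrientation o A) (hx : x ∈ (chartAt Model4 c).source)
    (e : OrthonormalBasis (Fin 3) ℝ (E x)) :
    variationEnd A a o Λ e =
      endOfMatrix e (rootDeriv Λ (chartPath A a o c e 0) (chartPath A a o c e 1)) := by
  have h0 : (curvPath A a e (posBasis o x) 0).PosDef := hAor x e
  have h1 : (curvPath A a e (posBasis o x) 1).transpose = curvPath A a e (posBasis o x) 1 :=
    pathGram_transpose _ _ _ _ 1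
  rw [chartPath_eq hA ha, chartPath_eq hA ha,
    rootDeriv_smul h0 h1 (abs_pos.2 (det_coordFrame_ne_zero hx)), variationEnd]

/-- The density of the volume form of `A + t a` may be computed in an orthonormal frame `e` other
than the one, `e'`, in which it is defined. In this way a smooth frame can be used. -/
theorem volForm_coordFrame (hA : CovariantDerivative.ContMDiffCovariantDerivative A ∞)
    (ha : IsSoOneForm a) (hx : x ∈ (chartAt Model4 c).source)
    (e e' : OrthonormalBasis (Fin 3) ℝ (E x)) {t : ℝ}
    (ht : (quarticCurve (chartPath A a o c e) t).PosDef) :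
    orientSign (o x) (coordFrame c x) *
        volForm o Λ (A.addOneForm fun x => t • a x) e' (coordFrame c x) =
      rootVol Λ (quarticCurve (chartPath A a o c e) t) := by
  have hd := abs_pos.2 (det_coordFrame_ne_zero (o := o) hx)
  set d := (posBasis o x).det (coordFrame c x) with hd_def
  have h1 : quarticCurve (chartPath A a o c e) t =
      |d| • quarticCurve (curvPath A a e (posBasis o x)) t := by
    rw [← quarticCurve_smul]
    congr 1
    exact funext fun k => chartPath_eq hA ha e k
  have h2 : (quarticCurve (curvPath A a e (posBasis o x)) t).PosDef := by
    have h3 := ht.smul (inv_pos.2 hd)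
    rwa [h1, smul_smul, inv_mul_cancel₀ hd.ne', one_smul] at h3
  have h4 : curvPath A a e' (posBasis o x) =
      fun k => changeMatrix e e' * curvPath A a e (posBasis o x) k *
        (changeMatrix e e').transpose :=
    funext fun k => curvPath_change e e' hA ha _ k
  rw [volForm, volCoeff_addOneForm e' hA ha, h1, rootVol_smul h2 hd, h4, quarticCurve_conj,
    rootVol_conj h2 (changeMatrix_transpose_mul e e'), orientSign_eq, ← hd_def,
    ← sign_mul_self d]
  ring

variable [IsContMDiffRiemannianBundle (𝓡 4) ∞ Model3 E]

theorem smoothFunNear_chartPath (hA : CovariantDerivative.ContMDiffCovariantDerivative A ∞)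
    (ha : IsSoOneForm a) (ho : IsOrientation o) (hx : x ∈ (chartAt Model4 c).source)
    {b : ∀ y : M, OrthonormalBasis (Fin 3) ℝ (E y)}
    (hb : ∀ i, SmoothNear Model3 (fun y => b y i) x) (k : Fin 5) (i j : Fin 3) :
    SmoothFunNear (fun y => chartPath A a o c (b y) k i j) x := by
  have h1 : SmoothFunNear (fun y => orientSign (o x) (coordFrame c x) *
      curvPath A a (b y) (coordFrame c y) k i j) x :=
    (SmoothFunNear.const _).mul
      (smoothFunNear_curvPath hA ha hb (fun k => smoothNear_coordFrame hx k) k i j)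
  filter_upwards [h1, (orientSign_eventually_eq ho hx).eventually_nhds] with y h2 h3
  refine h2.congr_of_eventuallyEq (h3.mono fun z hz => ?_)
  simp only [chartPath, hz, Matrix.smul_apply, smul_eq_mul]

/-- `rootDeriv` as a function of the entries of its arguments. -/
theorem contDiffAt_rootDeriv {p : (Fin 3 → Fin 3 → ℝ) × (Fin 3 → Fin 3 → ℝ)}
    (hp : (Matrix.of p.1).PosDef) (i j : Fin 3) :
    ContDiffAt ℝ ∞ (fun p : (Fin 3 → Fin 3 → ℝ) × (Fin 3 → Fin 3 → ℝ) =>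
      rootDeriv Λ (Matrix.of p.1) (Matrix.of p.2) i j) p := by
  let f : (Fin 3 → Fin 3 → ℝ) → Fin 3 → Fin 3 → ℝ := normRoot Λ
  have hf : ContDiffAt ℝ ∞ f p.1 := contDiffAt_normRoot hp
  have h1 : ContDiffAt ℝ ∞ (fun p : (Fin 3 → Fin 3 → ℝ) × (Fin 3 → Fin 3 → ℝ) =>
      fderiv ℝ f p.1 p.2) p :=
    ((hf.fderiv_right (m := ∞) (by simp)).comp p contDiffAt_fst).clm_apply contDiffAt_snd
  exact contDiffAt_pi.1 (contDiffAt_pi.1 h1 i) j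

theorem smoothFunNear_rootDeriv {P Q : M → Matrix (Fin 3) (Fin 3) ℝ}
    (hP : ∀ i j, SmoothFunNear (fun y => P y i j) x)
    (hQ : ∀ i j, SmoothFunNear (fun y => Q y i j) x)
    (hpd : ∀ᶠ y in 𝓝 x, (P y).PosDef) (i j : Fin 3) :
    SmoothFunNear (fun y => rootDeriv Λ (P y) (Q y) i j) x := by
  have hmat {P : M → Matrix (Fin 3) (Fin 3) ℝ} (hP : ∀ i j, SmoothFunNear (fun y => P y i j) x) :
      ∀ᶠ y in 𝓝 x, ContMDiffAt (𝓡 4) 𝓘(ℝ, Fin 3 → Fin 3 → ℝ) ∞ (fun y i j => P y i j) y := by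
    have h : ∀ᶠ y in 𝓝 x, ∀ i j, ContMDiffAt (𝓡 4) 𝓘(ℝ, ℝ) ∞ (fun y => P y i j) y :=
      eventually_all.2 fun i => eventually_all.2 fun j => hP i j
    exact h.mono fun y hy => contMDiffAt_pi_space.2 fun i => contMDiffAt_pi_space.2 fun j => hy i j
  filter_upwards [hmat hP, hmat hQ, hpd] with y h1 h2 h3
  have h4 := contDiffAt_rootDeriv (p := (fun i j => P y i j, fun i j => Q y i j)) (Λ := Λ) h3 i j
  exact h4.contMDiffAt.comp y (h1.prodMk_space h2)

/-- Smoothness is read off in smooth orthonormal frames, which is possible because `variationEnd`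
does not depend on the frame. -/
theorem contMDiff_variationEnd (hA : CovariantDerivative.ContMDiffCovariantDerivative A ∞)
    (ha : IsSoOneForm a) (ho : IsOrientation o) (hAor : InducesOrientation o A)
    (e : ∀ y : M, OrthonormalBasis (Fin 3) ℝ (E y)) :
    ContMDiff (𝓡 4) ((𝓡 4).prod 𝓘(ℝ, Model3 →L[ℝ] Model3)) ∞
      (fun y => TotalSpace.mk' (Model3 →L[ℝ] Model3) (E := fun y => E y →L[ℝ] E y) y
        (variationEnd A a o Λ (e y))) := by
  intro x
  obtain ⟨b, hb⟩ := exists_smooth_orthonormal_frame (E := E) x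
  have hx : x ∈ (chartAt Model4 x).source := mem_chart_source _ x
  have hsrc := (chartAt Model4 x).open_source.mem_nhds hx
  have h1 := contMDiffAt_endOfMatrix hb (smoothFunNear_rootDeriv (Λ := Λ)
    (smoothFunNear_chartPath hA ha ho hx hb 0) (smoothFunNear_chartPath hA ha ho hx hb 1)
    (by filter_upwards [hsrc] with y hy using chartPath_zero_posDef hA ha hAor hy (b y)))
  refine h1.congr_of_eventuallyEq ?_
  filter_upwards [hsrc] with y hy
  rw [variationEnd_change (b y) (e y) hA ha (hAor y (b y)),
    variationEnd_eq_chartPath hA ha hAor hy (b y)]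

end Density

/-! ### Differentiation under the integral sign -/

section Parameter

variable {X : Type*} [TopologicalSpace X]

/-- Near `(0, y)`, the function `k'` is the derivative of `k` in the first variable, and both are
continuous. -/
def IsDerivNear (k k' : ℝ → X → ℝ) (y : X) : Prop :=
  ∀ᶠ p : ℝ × X in 𝓝 (0, y), HasDerivAt (fun t => k t p.2) (k' p.1 p.2) p.1 ∧
    ContinuousAt (fun q : ℝ × X => k q.1 q.2) p ∧ ContinuousAt (fun q : ℝ × X => k' q.1 q.2) p

/-- The derivative of a parameter-dependent function in the parameter. -/
noncomputable def paramDeriv (k : ℝ → X → ℝ) (t : ℝ) (y : X) : ℝ := deriv (fun s => k s y) t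

/-- Differentiation of a function of the form `Ψ (t, g y)` with `Ψ` differentiable and `g`
continuous. -/
theorem isDerivNear_of_eq_comp {W : Type*} [NormedAddCommGroup W] [NormedSpace ℝ W]
    {Ψ : ℝ × W → ℝ} {g : X → W} {k : ℝ → X → ℝ} {y : X} (hΨ : ContDiffAt ℝ 1 Ψ (0, g y))
    (hg : ∀ᶠ z in 𝓝 y, ContinuousAt g z)
    (hk : ∀ᶠ p : ℝ × X in 𝓝 (0, y), k p.1 p.2 = Ψ (p.1, g p.2)) :
    IsDerivNear k (paramDeriv k) y ∧ ∀ᶠ p : ℝ × X in 𝓝 (0, y),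
      paramDeriv k p.1 p.2 = (fun q => fderiv ℝ Ψ q (1, 0)) (p.1, g p.2) := by
  have hcont : ContinuousAt (fun p : ℝ × X => (p.1, g p.2)) (0, y) :=
    continuousAt_fst.prodMk (hg.self_of_nhds.comp continuousAt_snd)
  have h1 : ∀ᶠ p : ℝ × X in 𝓝 (0, y), ContDiffAt ℝ 1 Ψ (p.1, g p.2) :=
    hcont.eventually (hΨ.eventually (by simp))
  have hg' : ∀ᶠ p : ℝ × X in 𝓝 (0, y), ContinuousAt (fun p : ℝ × X => (p.1, g p.2)) p := by
    have h2 : Tendsto (fun p : ℝ × X => p.2) (𝓝 (0, y)) (𝓝 y) := continuousAt_snd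
    filter_upwards [h2.eventually hg] with p hp
    exact continuousAt_fst.prodMk (hp.comp continuousAt_snd)
  have hder : ∀ᶠ p : ℝ × X in 𝓝 (0, y),
      HasDerivAt (fun t => k t p.2) (fderiv ℝ Ψ (p.1, g p.2) (1, 0)) p.1 := by
    filter_upwards [h1, hk.eventually_nhds] with p hp hkp
    have h2 : HasDerivAt (fun t : ℝ => (t, g p.2)) ((1 : ℝ), (0 : W)) p.1 :=
      (hasDerivAt_id p.1).prodMk (hasDerivAt_const p.1 _)
    have h3 := (hp.differentiableAt (by simp)).hasFDerivAt.comp_hasDerivAt p.1 h2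
    have h4 : ContinuousAt (fun t : ℝ => (t, p.2)) p.1 := by fun_prop
    exact h3.congr_of_eventuallyEq (h4.eventually hkp)
  have heq : ∀ᶠ p : ℝ × X in 𝓝 (0, y),
      paramDeriv k p.1 p.2 = fderiv ℝ Ψ (p.1, g p.2) (1, 0) := hder.mono fun p hp => hp.deriv
  refine ⟨?_, heq⟩
  filter_upwards [hder, heq, heq.eventually_nhds, hk.eventually_nhds, h1, hg']
    with p p1 p2 p3 p4 p5 p6
  refine ⟨p2 ▸ p1, ?_, ?_⟩
  · exact (ContinuousAt.comp (f := fun p : ℝ × X => (p.1, g p.2)) p5.continuousAt p6).congr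
      (p4.mono fun q hq => hq.symm)
  · have h5 : ContinuousAt (fun q => fderiv ℝ Ψ q (1, 0)) (p.1, g p.2) :=
      ((p5.fderiv_right (m := 0) (by simp)).clm_apply contDiffAt_const).continuousAt
    exact (ContinuousAt.comp (f := fun p : ℝ × X => (p.1, g p.2)) h5 p6).congr
      (p3.mono fun q hq => hq.symm)

/-- Two derivatives in the parameter of a function of the form `Ψ (t, g y)`. -/
theorem isDerivNear_twice {W : Type*} [NormedAddCommGroup W] [NormedSpace ℝ W]
    {Ψ : ℝ × W → ℝ} {g : X → W} {k : ℝ → X → ℝ} {y : X} (hΨ : ContDiffAt ℝ ∞ Ψ (0, g y))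
    (hg : ∀ᶠ z in 𝓝 y, ContinuousAt g z)
    (hk : ∀ᶠ p : ℝ × X in 𝓝 (0, y), k p.1 p.2 = Ψ (p.1, g p.2)) :
    IsDerivNear k (paramDeriv k) y ∧ IsDerivNear (paramDeriv k) (paramDeriv (paramDeriv k)) y := by
  have h := isDerivNear_of_eq_comp (hΨ.of_le (by simp)) hg hk
  have hΨ' : ContDiffAt ℝ 1 (fun q => fderiv ℝ Ψ q (1, 0)) (0, g y) :=
    (hΨ.fderiv_right (m := 1) (by norm_cast)).clm_apply contDiffAt_const
  exact ⟨h.1, (isDerivNear_of_eq_comp hΨ' hg h.2).1⟩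

open MeasureTheory in
/-- By compactness of `K`, the hypothesis at the points of `K` holds for all `y ∈ K` and all `t` in
one interval around `0`, and `k'` is bounded there. -/
theorem hasDerivAt_setIntegral [T2Space X] [MeasurableSpace X] [OpensMeasurableSpace X]
    {μ : Measure X} [IsFiniteMeasureOnCompacts μ] {K : Set X} (hK : IsCompact K) {r : X → ℝ}
    (hr : ContinuousOn r K) {k k' : ℝ → X → ℝ} (h : ∀ y ∈ K, IsDerivNear k k' y) :
    ∀ᶠ t in 𝓝 (0 : ℝ), HasDerivAt (fun t => ∫ y in K, r y * k t y ∂μ)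
      (∫ y in K, r y * k' t y ∂μ) t := by
  have h1 := hK.eventually_forall_of_forall_eventually (x₀ := (0 : ℝ))
    (P := fun t y => HasDerivAt (fun t => k t y) (k' t y) t ∧
      ContinuousAt (fun q : ℝ × X => k q.1 q.2) (t, y) ∧
      ContinuousAt (fun q : ℝ × X => k' q.1 q.2) (t, y)) h
  obtain ⟨ε, hε, h2⟩ := Metric.eventually_nhds_iff.1 h1
  set s := Metric.closedBall (0 : ℝ) (ε / 2) with hs
  have h3 : ∀ t ∈ s, ∀ y ∈ K, HasDerivAt (fun t => k t y) (k' t y) t ∧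
      ContinuousAt (fun q : ℝ × X => k q.1 q.2) (t, y) ∧
      ContinuousAt (fun q : ℝ × X => k' q.1 q.2) (t, y) := fun t ht =>
    h2 (lt_of_le_of_lt (Metric.mem_closedBall.1 ht) (half_lt_self hε))
  have hks (k : ℝ → X → ℝ) {t : ℝ}
      (hk : ∀ y ∈ K, ContinuousAt (fun q : ℝ × X => k q.1 q.2) (t, y)) :
      ContinuousOn (fun y => r y * k t y) K :=
    hr.mul fun y hy => ((hk y hy).comp (f := fun y => (t, y))
      (by fun_prop)).continuousWithinAt
  obtain ⟨C, hC⟩ : ∃ C, ∀ p ∈ s ×ˢ K, ‖r p.2 * k' p.1 p.2‖ ≤ C := by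
    refine ((isCompact_closedBall 0 (ε / 2)).prod hK).exists_bound_of_continuousOn ?_
    refine ContinuousOn.mul (hr.comp continuousOn_snd fun p hp => hp.2) fun p hp => ?_
    exact (h3 p.1 hp.1 p.2 hp.2).2.2.continuousWithinAt
  have hmem : ∀ᶠ t in 𝓝 (0 : ℝ), s ∈ 𝓝 t :=
    eventually_mem_nhds_iff.2 (Metric.closedBall_mem_nhds 0 (half_pos hε))
  filter_upwards [hmem] with t ht
  have ht' := mem_of_mem_nhds ht
  have hae : ∀ᵐ y ∂μ.restrict K, y ∈ K := ae_restrict_mem hK.measurableSet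
  refine (hasDerivAt_integral_of_dominated_loc_of_deriv_le (μ := μ.restrict K)
    (F := fun t y => r y * k t y) (F' := fun t y => r y * k' t y) (bound := fun _ => C)
    ht ?_ ?_ ?_ ?_ ?_ ?_).2
  · filter_upwards [ht] with t' ht'
    exact (hks k fun y hy => (h3 t' ht' y hy).2.1).aestronglyMeasurable_of_isCompact hK
      hK.measurableSet
  · exact (hks k fun y hy => (h3 t ht' y hy).2.1).integrableOn_compact hK
  · exact (hks k' fun y hy => (h3 t ht' y hy).2.2).aestronglyMeasurable_of_isCompact hK
      hK.measurableSet
  · filter_upwards [hae] with y hy t' ht'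
    exact hC (t', y) ⟨ht', hy⟩
  · exact integrableOn_const hK.measure_lt_top.ne
  · filter_upwards [hae] with y hy t' ht'
    exact (h3 t' ht' y hy).1.const_mul (r y)

end Parameter

section Integral

variable {M : Type*} [TopologicalSpace M] [ChartedSpace Model4 M] [IsManifold (𝓡 4) ∞ M]
  [CompactSpace M] [T2Space M]

/-- The image in the chart at `c` of the support of the corresponding function of the partition of
unity. -/
noncomputable def chartSupport (c : M) : Set Model4 :=
  extChartAt (𝓡 4) c '' tsupport (chartPartition M c)

theorem tsupport_chartPartition_subset (c : M) :
    tsupport (chartPartition M c) ⊆ (chartAt Model4 c).source :=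
  (SmoothPartitionOfUnity.exists_isSubordinate_chartAt_source (𝓡 4) M).choose_spec c

theorem isCompact_chartSupport (c : M) : IsCompact (chartSupport c) := by
  refine (isClosed_tsupport _).isCompact.image_of_continuousOn
    ((continuousOn_extChartAt c).mono ?_)
  rw [extChartAt_source]
  exact tsupport_chartPartition_subset c

theorem exists_of_mem_chartSupport {c : M} {y : Model4} (hy : y ∈ chartSupport c) :
    y ∈ (extChartAt (𝓡 4) c).target ∧
      (extChartAt (𝓡 4) c).symm y ∈ (chartAt Model4 c).source := by
  obtain ⟨x, hx, rfl⟩ := hy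
  have hx' := tsupport_chartPartition_subset c hx
  rw [← extChartAt_source (𝓡 4)] at hx'
  refine ⟨(extChartAt (𝓡 4) c).map_source hx', ?_⟩
  rw [(extChartAt (𝓡 4) c).left_inv hx', ← extChartAt_source (𝓡 4)]
  exact hx'

variable (M) in
/-- The finitely many charts that contribute to an integral. -/
noncomputable def activeCharts : Finset M :=
  (chartPartition M).locallyFinite.finite_nonempty_of_compact.toFinset

/-- The integral as a finite sum of integrals over compact sets in charts. -/
theorem integral_eq_sum (o : ∀ x : M, Orientation ℝ (TangentSpace (𝓡 4) x) (Fin 4))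
    (η : ∀ x : M, (Fin 4 → TangentSpace (𝓡 4) x) → ℝ) :
    integral o η = ∑ c ∈ activeCharts M, ∫ y in chartSupport c,
      chartPartition M c ((extChartAt (𝓡 4) c).symm y) *
        (fun x => orientSign (o x) (coordFrame c x) * η x (coordFrame c x))
          ((extChartAt (𝓡 4) c).symm y) := by
  rw [integral, finsum_eq_sum_of_support_subset (s := activeCharts M)]
  · refine Finset.sum_congr rfl fun c _ => ?_
    refine MeasureTheory.setIntegral_eq_of_subset_of_forall_sdiff_eq_zero
      (isOpen_extChartAt_target c).measurableSet
      (fun y hy => (exists_of_mem_chartSupport hy).1) fun y hy => ?_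
    have h0 : chartPartition M c ((extChartAt (𝓡 4) c).symm y) = 0 := by
      by_contra hne
      exact hy.2 ⟨_, subset_tsupport _ hne, (extChartAt (𝓡 4) c).right_inv hy.1⟩
    simp only [h0, zero_mul]
  · intro c hc
    rw [activeCharts, Set.Finite.coe_toFinset]
    by_contra hne
    rw [mem_ofPred_eq, not_nonempty_iff_eq_empty, Function.support_eq_empty_iff] at hne
    refine hc ?_
    simp only [hne, Pi.zero_apply, zero_mul, MeasureTheory.integral_zero]

end Integral

/-! ### The second variation of the action -/

section Action

variable {Λ : ℝ}

/-- `rootVol` along a quartic curve as a function of the parameter and the coefficients. -/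
noncomputable def rootVolPath (Λ : ℝ) (q : ℝ × (Fin 5 → Fin 3 → Fin 3 → ℝ)) : ℝ :=
  rootVol Λ (quarticCurve (fun k => Matrix.of (q.2 k)) q.1)

theorem contDiff_quarticCurve_path : ContDiff ℝ ∞
    (fun (q : ℝ × (Fin 5 → Fin 3 → Fin 3 → ℝ)) (i j : Fin 3) =>
      quarticCurve (fun k => Matrix.of (q.2 k)) q.1 i j) := by
  refine contDiff_pi.2 fun i => contDiff_pi.2 fun j => ?_
  simp only [quarticCurve, Matrix.sum_apply, Matrix.smul_apply, Matrix.of_apply, smul_eq_mul]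
  fun_prop

theorem contDiffAt_rootVolPath {w : Fin 5 → Fin 3 → Fin 3 → ℝ} (hw : (Matrix.of (w 0)).PosDef) :
    ContDiffAt ℝ ∞ (rootVolPath Λ) (0, w) := by
  let f : (Fin 3 → Fin 3 → ℝ) → ℝ := rootVol Λ
  have hf : ContDiffAt ℝ ∞ f (fun i j => quarticCurve (fun k => Matrix.of (w k)) 0 i j) := by
    simp only [quarticCurve_zero]
    exact contDiffAt_rootVol hw
  exact ContDiffAt.comp (F := Fin 3 → Fin 3 → ℝ) (g := f) (0, w) hf
    contDiff_quarticCurve_path.contDiffAt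

theorem eventually_quarticCurve_path_posDef {w : Fin 5 → Fin 3 → Fin 3 → ℝ}
    (hw : (Matrix.of (w 0)).PosDef) :
    ∀ᶠ q : ℝ × (Fin 5 → Fin 3 → Fin 3 → ℝ) in 𝓝 (0, w),
      (∀ k, (Matrix.of (q.2 k)).transpose = Matrix.of (q.2 k)) →
        (quarticCurve (fun k => Matrix.of (q.2 k)) q.1).PosDef := by
  have h1 : Tendsto (fun q : ℝ × (Fin 5 → Fin 3 → Fin 3 → ℝ) =>
      quarticCurve (fun k => Matrix.of (q.2 k)) q.1) (𝓝 (0, w)) (𝓝 (Matrix.of (w 0))) := by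
    have h2 :=
      contDiff_quarticCurve_path.continuous.tendsto (0, w)
    have h3 : (fun i j => quarticCurve (fun k => Matrix.of (w k)) 0 i j) = w 0 := by
      rw [quarticCurve_zero]; rfl
    simp only [h3] at h2
    exact h2
  filter_upwards [h1.eventually (eventually_posDef hw)] with q hq hs
  refine hq ?_
  rw [Matrix.IsHermitian, Matrix.conjTranspose_eq_transpose_of_trivial, quarticCurve,
    Matrix.transpose_sum]
  exact Finset.sum_congr rfl fun k _ => by rw [Matrix.transpose_smul, hs]

variable {M : Type*} [TopologicalSpace M] [ChartedSpace Model4 M] [IsManifold (𝓡 4) ∞ M]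
  [T2Space M] {E : M → Type*} [TopologicalSpace (TotalSpace Model3 E)]
  [∀ x, NormedAddCommGroup (E x)] [∀ x, InnerProductSpace ℝ (E x)]
  [FiberBundle Model3 E] [VectorBundle ℝ Model3 E] [ContMDiffVectorBundle ∞ Model3 E (𝓡 4)]
  {A : CovariantDerivative (𝓡 4) Model3 E}
  {a : ∀ x : M, E x →L[ℝ] TangentSpace (𝓡 4) x →L[ℝ] E x}
  {o : ∀ x : M, Orientation ℝ (TangentSpace (𝓡 4) x) (Fin 4)} {c : M}

variable (Λ A a o) in
/-- The density of the volume form of `A + t a` in the chart at `c`. -/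
noncomputable def volDensity (c : M) (t : ℝ) (x : M) : ℝ :=
  orientSign (o x) (coordFrame c x) *
    volForm o Λ (A.addOneForm fun x => t • a x) (someFrame E x) (coordFrame c x)

/-- The integrand is the second derivative of the density of the action. -/
theorem deriv_deriv_volDensity (hΛ : Λ ≠ 0)
    (hA : CovariantDerivative.ContMDiffCovariantDerivative A ∞) (ha : IsSoOneForm a)
    (hAor : InducesOrientation o A) {x : M} (hx : x ∈ (chartAt Model4 c).source)
    (e : OrthonormalBasis (Fin 3) ℝ (E x)) :
    Λ / 2 * deriv (deriv fun t => volDensity Λ A a o c t x) 0 =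
      orientSign (o x) (coordFrame c x) *
        hessianIntegrand o Λ A a e (variationEnd A a o Λ e) (coordFrame c x) := by
  have h1 : (fun t => volDensity Λ A a o c t x) =ᶠ[𝓝 0] fun t =>
      (orientSign (o x) (coordFrame c x) * (posBasis o x).det (coordFrame c x)) *
        volCoeff o Λ (A.addOneForm fun x => t • a x) e := by
    filter_upwards [eventually_quarticCurve_posDef (chartPath_zero_posDef hA ha hAor hx e)
      (chartPath_transpose e)] with t ht
    rw [volDensity, volForm_coordFrame hA ha hx e _ ht, ← volForm_coordFrame hA ha hx e e ht,
      volForm]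
    ring
  have h2 (s : ℝ) (f : ℝ → ℝ) : deriv (deriv fun t => s * f t) 0 = s * deriv (deriv f) 0 := by
    rw [funext fun x => deriv_const_mul_field (x := x) s (v := f), deriv_const_mul_field]
  rw [h1.deriv.deriv_eq, h2, hessianIntegrand_det e hA ha,
    ← (variation_volCoeff e hΛ hA ha (hAor x e)).2.2.2]
  ring

variable [IsContMDiffRiemannianBundle (𝓡 4) ∞ Model3 E]

/-- In a smooth orthonormal frame the density is `rootVolPath`, evaluated at the parameter and at
the coefficients of the Gram matrix, which are continuous functions of the point. -/
theorem isDerivNear_volDensity (hA : CovariantDerivative.ContMDiffCovariantDerivative A ∞)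
    (ha : IsSoOneForm a) (ho : IsOrientation o) (hAor : InducesOrientation o A) {y : Model4}
    (hy : y ∈ (extChartAt (𝓡 4) c).target)
    (hx : (extChartAt (𝓡 4) c).symm y ∈ (chartAt Model4 c).source) :
    let k := fun t y => volDensity Λ A a o c t ((extChartAt (𝓡 4) c).symm y)
    IsDerivNear k (paramDeriv k) y ∧ IsDerivNear (paramDeriv k) (paramDeriv (paramDeriv k)) y := by
  intro k
  obtain ⟨b, hb⟩ := exists_smooth_orthonormal_frame (E := E) ((extChartAt (𝓡 4) c).symm y)
  have hsymm : ∀ᶠ z in 𝓝 y, ContinuousAt (extChartAt (𝓡 4) c).symm z := by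
    filter_upwards [(isOpen_extChartAt_target c).mem_nhds hy] with z hz
    exact continuousAt_extChartAt_symm'' hz
  have htend := hsymm.self_of_nhds
  let g : Model4 → Fin 5 → Fin 3 → Fin 3 → ℝ := fun z k i j =>
    chartPath A a o c (b ((extChartAt (𝓡 4) c).symm z)) k i j
  have hpd : (Matrix.of (g y 0)).PosDef := chartPath_zero_posDef hA ha hAor hx _
  have hg : ∀ᶠ z in 𝓝 y, ContinuousAt g z := by
    have h1 : ∀ᶠ x in 𝓝 ((extChartAt (𝓡 4) c).symm y), ∀ k i j,
        ContinuousAt (fun x => chartPath A a o c (b x) k i j) x :=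
      eventually_all.2 fun k => eventually_all.2 fun i => eventually_all.2 fun j =>
        (smoothFunNear_chartPath hA ha ho hx hb k i j).mono fun x hx => hx.continuousAt
    filter_upwards [htend.eventually h1, hsymm] with z h2 h3
    exact continuousAt_pi.2 fun k => continuousAt_pi.2 fun i => continuousAt_pi.2 fun j =>
      ContinuousAt.comp (g := fun x => chartPath A a o c (b x) k i j) (h2 k i j) h3
  refine isDerivNear_twice (Ψ := rootVolPath Λ) (g := g) (contDiffAt_rootVolPath hpd) hg ?_
  have hcont : ContinuousAt (fun p : ℝ × Model4 => (p.1, g p.2)) (0, y) :=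
    continuousAt_fst.prodMk (ContinuousAt.comp (g := g) hg.self_of_nhds continuousAt_snd)
  have hsnd : Tendsto (fun p : ℝ × Model4 => p.2) (𝓝 (0, y)) (𝓝 y) := continuousAt_snd
  filter_upwards [hcont.eventually (eventually_quarticCurve_path_posDef hpd),
    hsnd.eventually (htend.eventually ((chartAt Model4 c).open_source.mem_nhds hx))] with p h1 h2
  exact volForm_coordFrame hA ha h2 (b _) _ (h1 fun k => chartPath_transpose _ k)

variable [CompactSpace M]

/-- The action is twice differentiable along `A + t a`, and its second derivative is the integral
of the pointwise second variation. -/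
theorem hasHessianAt_action (hΛ : Λ ≠ 0)
    (hA : CovariantDerivative.ContMDiffCovariantDerivative A ∞) (ha : IsSoOneForm a)
    (ho : IsOrientation o) (hAor : InducesOrientation o A)
    (e : ∀ x : M, OrthonormalBasis (Fin 3) ℝ (E x)) :
    HasHessianAt o Λ A a
      (integral o fun x => hessianIntegrand o Λ A a (e x) (variationEnd A a o Λ (e x))) := by
  let k (c : M) (t : ℝ) (y : Model4) : ℝ := volDensity Λ A a o c t ((extChartAt (𝓡 4) c).symm y)
  let I (k : M → ℝ → Model4 → ℝ) (t : ℝ) : ℝ := Λ / 2 * ∑ c ∈ activeCharts M,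
    ∫ y in chartSupport c, chartPartition M c ((extChartAt (𝓡 4) c).symm y) * k c t y
  have hI : actionAlong o Λ A a = I k := by
    funext t
    rw [actionAlong, action, integral_eq_sum]
    rfl
  have hr (c : M) : ContinuousOn
      (fun y => chartPartition M c ((extChartAt (𝓡 4) c).symm y)) (chartSupport c) :=
    (chartPartition M c).2.continuous.comp_continuousOn ((continuousOn_extChartAt_symm c).mono
      fun y hy => (exists_of_mem_chartSupport hy).1)
  have hstep {k k' : M → ℝ → Model4 → ℝ}
      (h : ∀ c, ∀ y ∈ chartSupport c, IsDerivNear (k c) (k' c) y) :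
      ∀ᶠ t in 𝓝 0, HasDerivAt (I k) (I k' t) t := by
    filter_upwards [(Filter.eventually_all_finset (activeCharts M)).2 fun c _ =>
      hasDerivAt_setIntegral (μ := MeasureTheory.volume) (isCompact_chartSupport c) (hr c)
        (h c)] with t ht
    exact (HasDerivAt.fun_sum ht).const_mul (Λ / 2)
  have hk (c : M) (y : Model4) (hy : y ∈ chartSupport c) :=
    isDerivNear_volDensity (Λ := Λ) hA ha ho hAor (exists_of_mem_chartSupport hy).1
      (exists_of_mem_chartSupport hy).2
  have h1 := hstep fun c y hy => (hk c y hy).1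
  have h2 := hstep fun c y hy => (hk c y hy).2
  have hval : I (fun c => paramDeriv (paramDeriv (k c))) 0 =
      integral o fun x => hessianIntegrand o Λ A a (e x) (variationEnd A a o Λ (e x)) := by
    simp only [I]
    rw [integral_eq_sum, Finset.mul_sum]
    refine Finset.sum_congr rfl fun c _ => ?_
    rw [← MeasureTheory.integral_const_mul]
    refine MeasureTheory.setIntegral_congr_fun (isCompact_chartSupport c).measurableSet
      fun y hy => ?_
    have h3 := deriv_deriv_volDensity hΛ hA ha hAor (exists_of_mem_chartSupport hy).2 (e _)
    beta_reduce
    rw [← h3, mul_left_comm]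
    rfl
  -- The first derivative exists in a neighbourhood of `0`, and is differentiable at `0`.
  rw [HasHessianAt, hI, ← hval]
  refine ⟨h1.mono fun t ht => ht.differentiableAt, ?_⟩
  exact h2.self_of_nhds.congr_of_eventuallyEq (h1.mono fun t ht => ht.deriv)

end Action

theorem mainTheorem5
    {M : Type*} [TopologicalSpace M] [ChartedSpace Model4 M] [IsManifold (𝓡 4) ∞ M]
    [CompactSpace M] [T2Space M]
    (o : ∀ x : M, Orientation ℝ (TangentSpace (𝓡 4) x) (Fin 4)) (ho : IsOrientation o)
    {E : M → Type*} [TopologicalSpace (TotalSpace Model3 E)]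
    [∀ x, NormedAddCommGroup (E x)] [∀ x, InnerProductSpace ℝ (E x)]
    [FiberBundle Model3 E] [VectorBundle ℝ Model3 E]
    [ContMDiffVectorBundle ∞ Model3 E (𝓡 4)]
    [IsContMDiffRiemannianBundle (𝓡 4) ∞ Model3 E]
    (Λ : ℝ) (hΛ : Λ ≠ 0)
    (A : CovariantDerivative (𝓡 4) Model3 E)
    (hAsmooth : CovariantDerivative.ContMDiffCovariantDerivative A ∞) (hAmetric : A.IsMetricCompatible)
    (hAdef : IsDefinite A) (hAor : InducesOrientation o A)
    (hAcrit : IsCriticalPoint o Λ A)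
    (a : ∀ x : M, E x →L[ℝ] TangentSpace (𝓡 4) x →L[ℝ] E x) (ha : IsSoOneForm a)
    (e : ∀ x : M, OrthonormalBasis (Fin 3) ℝ (E x)) :
    ∃ (N : M → Matrix (Fin 3) (Fin 3) ℝ) (φ : ∀ x : M, E x →L[ℝ] E x),
      (∀ (x : M) (i : Fin 3), IsSelfDualPart (selfDualForms o Λ A (e x))
        (extCovDerivComp A (e x) a i) (∑ j, N x i j • sigmaForm o Λ A (e x) j)) ∧
      ContMDiff (𝓡 4) ((𝓡 4).prod 𝓘(ℝ, Model3 →L[ℝ] Model3)) ∞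
        (fun x => TotalSpace.mk' (Model3 →L[ℝ] Model3)
          (E := fun x => E x →L[ℝ] E x) x (φ x)) ∧
      (∀ (x : M) (ψ : E x →L[ℝ] E x),
        (IsSymTraceFree ψ ∧
          symTraceFree (matX o Λ A (e x) * endMatrix (e x) ψ) =
            symTraceFree (matX o Λ A (e x) * N x)) ↔ ψ = φ x) ∧
      HasHessianAt o Λ A a
        (integral o fun x => hessianIntegrand o Λ A a (e x) (φ x)) := by
  refine ⟨fun x => selfDualMatrix A a o Λ (e x), fun x => variationEnd A a o Λ (e x),
    ?_, ?_, ?_, ?_⟩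
  · exact fun x i => isSelfDualPart_selfDualMatrix (e x) hΛ hAsmooth ha (hAor x (e x)) i
  · exact contMDiff_variationEnd hAsmooth ha ho hAor e
  · exact fun x ψ => eq_variationEnd_iff (e x) hΛ hAsmooth ha (hAor x (e x)) ψ
  · exact hasHessianAt_action hΛ hAsmooth ha ho hAor e
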